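/- **Conventions.** A *convex polyhedron* is a finite intersection of closed half-spaces of a finite-dimensional real vector space; a *face* of a convex set $C$ is a convex subset $F\subseteq C$ such that every segment in $C$ with a relative interior point in $F$ has both endpoints in $F$ (so $\emptyset$ and $C$ are faces of $C$). **Polyhedral structures.** A *polyhedral structure* $\Pi$ on a second countable topological space $X$ is a locally finite covering of $X$ by distinct closed subsets $\sigma$ (the *polyhedra*), together with, for each $\sigma$, a finite-dimensional vector space $M_\sigma$ of continuous real functions on $\sigma$ such that the evaluation map $\phi_\sigma\colon \sigma\to N_\sigma=\operatorname{Hom}(M_\sigma,\mathbb R)$ is a homeomorphism onto a full-dimensional convex polyhedron of a hyperplane of $N_\sigma$ not containing $0$ (in the zero space the hyperplane is empty, which is the case $\sigma=\emptyset$, $M_\sigma=0$). The faces of $\sigma$ are the preimages of the faces of $\phi_\sigma(\sigma)$. It is required that every face of a polyhedron $\sigma$ is a polyhedron whose space of functions consists of the restrictions of the functions in $M_\sigma$, and that any two polyhedra intersect in a common face. Put $\dim\sigma=\dim M_\sigma-1$, and write $\tau\prec\sigma$ if $\tau$ is a face of $\sigma$. A map from $\sigma$ to a vector space, or between polyhedra,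 is *affine* if it is so after identifying polyhedra with their images under the evaluation maps. A *subdivision* of $\Pi$ is a polyhedral structure each of whose polyhedra is contained in a polyhedron of $\Pi$, with affine inclusion; two polyhedral structures are *equivalent* if they have a common subdivision. A *polyhedral space* is a second countable space with an equivalence class of polyhedral structures. It has *pure dimension* $n$ if, for every structure in the class, all maximal polyhedra have dimension $n$. **Euclidean polyhedral spaces.** A *Euclidean polyhedral space* is a polyhedral space $X$ with a finite-dimensional real inner product space $N$ and a map $\iota\colon X\to N$ whose image lies in an affine hyperplane not containing $0$, such that for some polyhedral structure in the class, $\iota$ is affine and injective on each polyhedron. The structures in the class with this last property are the *polyhedral complexes* on $X$. **Balancing.** Let $X$ be a Euclidean polyhedral space of pure dimension $n$, $V\subseteq X$ open and $\Pi$ a polyhedral complex on $X$; let $\Pi|_V(k)$ be the set of $k$-dimensional polyhedra of $\Pi$ that meet $V$. For a nonempty facet $\tau$ of $\sigma\in\Pi$ (a face with $\dim\tau=\dim\sigma-1$), let $v_{\sigma\setminus\tau}\in N$ be the unit vector that is orthogonal to the affine span of $\iota(\tau)$, parallel to the affine span of $\iota(\sigma)$, and points from $\tau$ towards $\sigma$.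 The open set $V$ *admits a balancing condition* if there are a polyhedral complex $\Pi$ on $X$ and a function $b\colon\Pi|_V(n)\to\mathbb R_{>0}$ such that $$\sum_{\sigma\in\Pi|_V(n),\ \sigma\succ\tau} b(\sigma)\,v_{\sigma\setminus\tau}=0\qquad\text{for all }\tau\in\Pi|_V(n-1).$$ The space $X$ is *locally balanceable* if it has pure dimension $n$ for some $n\geq 0$ and is covered by open subsets that admit a balancing condition. **Concave functions.** Let $U\subseteq X$ be open. A function $f\colon U\to\mathbb R$ is *concave* if $$f(x)\ \ge\ \sum_{i\in I}\nu_i\, f(x_i)$$ for all finite families $(x_i)_{i\in I}$ of points of $U$ and $(\nu_i)_{i\in I}$ of nonnegative real numbers and all $x\in U$ such that $\sum_i\nu_i=1$, $\sum_i\nu_i\,\iota(x_i)=\iota(x)$, and for which there are a polyhedral complex $\Pi$ on $X$ and polyhedra $\tau,\sigma_i\in\Pi$ with $x\in\tau$, $\sigma_i\succ\tau$, $\sigma_i\subseteq U$ and $x_i\in\sigma_i$ for all $i\in I$. **Statement.** Let $X$ be a locally balanceable Euclidean polyhedral space, $U\subseteq X$ an open subset (not necessarily balanced), and $f\colon U\to\mathbb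 R$ a concave function. Then $f$ is continuous. -/

import Mathlib

/-! ### Convex polyhedra and their faces -/

/-- A convex polyhedron of a real vector space: the intersection of finitely many closed half-spaces
(possibly the whole space, possibly empty). -/
def IsConvexPolyhedron {E : Type*} [AddCommGroup E] [Module ℝ E] (P : Set E) : Prop :=
  ∃ (m : ℕ) (a : Fin m → Module.Dual ℝ E) (b : Fin m → ℝ), P = {x | ∀ i, a i x ≤ b i}

/-- `F` is a face of the convex set `P`: a convex subset of `P` such that every segment in `P` with a
relative interior point in `F` has its endpoints in `F`. The sets `∅` and `P` are faces of `P`. -/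
def IsConvexFace {E : Type*} [AddCommGroup E] [Module ℝ E] (P F : Set E) : Prop :=
  Convex ℝ F ∧ IsExtreme ℝ P F

/-! ### Polyhedral structures -/

/-- The evaluation map `s → Hom(M, ℝ)` of a space `M` of continuous functions on `s`. -/
def evalMap {X : Type*} [TopologicalSpace X] {s : Set X} (M : Submodule ℝ C(s, ℝ)) (x : s) :
    Module.Dual ℝ M where
  toFun g := (g : C(s, ℝ)) x
  map_add' _ _ := rfl
  map_smul' _ _ := rfl

/-- The set `t` is a face of `s`, where `s` is identified with a subset of `Hom(M, ℝ)` through the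
evaluation map. -/
def IsFaceVia {X : Type*} [TopologicalSpace X] {s : Set X} (M : Submodule ℝ C(s, ℝ))
    (t : Set X) : Prop :=
  t ⊆ s ∧ IsConvexFace (Set.range (evalMap M)) (evalMap M '' {x : s | (x : X) ∈ t})

/-- A polyhedral structure on a topological space `X`. The polyhedra are recorded as a set of subsets
of `X`, so that they are automatically different from each other.

A hyperplane of a finite-dimensional vector space is a coatom of the lattice of its affine subspaces;
in the zero space the only one is the empty subspace, which is the case of the empty polyhedron. -/
structure PolyhedralStructure (X : Type*) [TopologicalSpace X] where
  /-- the polyhedra -/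
  cells : Set (Set X)
  /-- the space `M_σ` of continuous real functions on the polyhedron `σ` -/
  M : ∀ σ : cells, Submodule ℝ C((σ : Set X), ℝ)
  isClosed : ∀ σ : cells, IsClosed (σ : Set X)
  sUnion_cells : ⋃₀ cells = Set.univ
  locallyFinite : LocallyFinite (fun σ : cells => (σ : Set X))
  finiteDimensional : ∀ σ : cells, FiniteDimensional ℝ (M σ)
  /-- The evaluation map is a homeomorphism onto its image. The canonical topology of the
  finite-dimensional space `Hom(M_σ, ℝ)` is the topology of pointwise convergence, that is, the one
  induced by the product topology of `M_σ → ℝ`. -/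
  isEmbedding_eval : ∀ σ : cells,
    Topology.IsEmbedding (fun x : (σ : Set X) => (fun g : M σ => evalMap (M σ) x g))
  /-- The image of the evaluation map is a convex polyhedron ... -/
  isConvexPolyhedron : ∀ σ : cells, IsConvexPolyhedron (Set.range (evalMap (M σ)))
  /-- ... which is full-dimensional in a hyperplane `H_σ` not passing through the origin. -/
  exists_hyperplane : ∀ σ : cells, ∃ H : AffineSubspace ℝ (Module.Dual ℝ (M σ)),
    IsCoatom H ∧ 0 ∉ H ∧ affineSpan ℝ (Set.range (evalMap (M σ))) = H
  /-- Every face of a polyhedron is a polyhedron, and its space of functions consists of the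
  restrictions of the functions of the larger polyhedron. -/
  face_mem : ∀ (σ : cells) (t : Set X), IsFaceVia (M σ) t →
    ∃ ht : t ∈ cells, ∀ g : C(t, ℝ), g ∈ M ⟨t, ht⟩ ↔
      ∃ h ∈ M σ, ∀ (x : X) (hx : x ∈ t) (hx' : x ∈ (σ : Set X)), g ⟨x, hx⟩ = h ⟨x, hx'⟩
  /-- Every two polyhedra intersect in a common face. -/
  inter_face : ∀ σ σ' : cells,
    IsFaceVia (M σ) ((σ : Set X) ∩ σ') ∧ IsFaceVia (M σ') ((σ : Set X) ∩ σ')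

namespace PolyhedralStructure

variable {X : Type*} [TopologicalSpace X]

/-- The evaluation map `φ_σ : σ → N_σ = Hom(M_σ, ℝ)`. -/
def φ (P : PolyhedralStructure X) (σ : P.cells) : ↥(σ : Set X) → Module.Dual ℝ (P.M σ) :=
  evalMap (P.M σ)

/-- `P.IsFace τ σ`: the polyhedron `τ` is a face of the polyhedron `σ`, that is, `τ ≺ σ`. -/
def IsFace (P : PolyhedralStructure X) (τ σ : P.cells) : Prop :=
  IsFaceVia (P.M σ) (τ : Set X)

/-- The dimension of a polyhedron; the empty polyhedron has dimension `-1`. -/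
noncomputable def dim (P : PolyhedralStructure X) (σ : P.cells) : ℤ :=
  (Module.finrank ℝ (P.M σ) : ℤ) - 1

/-- The map `g` is affine on the polyhedron `σ`. -/
def AffineOn (P : PolyhedralStructure X) (σ : P.cells) {E : Type*} [AddCommGroup E] [Module ℝ E]
    (g : X → E) : Prop :=
  ∃ A : Module.Dual ℝ (P.M σ) →ᵃ[ℝ] E, ∀ x : (σ : Set X), g x = A (P.φ σ x)

/-- `P'` is a subdivision of `P`: every polyhedron of `P'` is contained in a polyhedron of `P`, the
inclusion being an affine map. -/
def IsSubdivision (P' P : PolyhedralStructure X) : Prop :=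
  ∀ σ' : P'.cells, ∃ (σ : P.cells) (h : (σ' : Set X) ⊆ σ)
    (A : Module.Dual ℝ (P'.M σ') →ᵃ[ℝ] Module.Dual ℝ (P.M σ)),
    ∀ x : (σ' : Set X), P.φ σ (Set.inclusion h x) = A (P'.φ σ' x)

/-- Two polyhedral structures are equivalent if they admit a common subdivision. -/
def Equivalent (P P' : PolyhedralStructure X) : Prop :=
  ∃ P'' : PolyhedralStructure X, P''.IsSubdivision P ∧ P''.IsSubdivision P'

/-- The set `P|_U(k)` of the `k`-dimensional polyhedra of `P` that meet `U`. -/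
def restrict (P : PolyhedralStructure X) (U : Set X) (k : ℤ) : Set P.cells :=
  {σ | ((σ : Set X) ∩ U).Nonempty ∧ P.dim σ = k}

/-- Only finitely many polyhedra have a given nonempty polyhedron as a face. -/
theorem finite_setOf_isFace (P : PolyhedralStructure X) (τ : P.cells) (hτ : (τ : Set X).Nonempty) :
    {σ : P.cells | P.IsFace τ σ}.Finite := by
  obtain ⟨x, hx⟩ := hτ
  exact (P.locallyFinite.point_finite x).subset fun σ hσ => hσ.1 hx

end PolyhedralStructure

/-! ### Polyhedral spaces -/

/-- A polyhedral space: a second countable topological space with an equivalence class of polyhedral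
structures, whose members are the polyhedral complexes on the space. -/
structure PolyhedralSpace (X : Type*) [TopologicalSpace X] [SecondCountableTopology X] where
  /-- the equivalence class of polyhedral structures -/
  complexes : Set (PolyhedralStructure X)
  isClass : ∃ P₀ : PolyhedralStructure X, complexes = {P | P₀.Equivalent P}

/-- `X` has pure dimension `n`: every maximal polyhedron of a polyhedral complex on `X` has
dimension `n`. -/
def PolyhedralSpace.HasPureDimension {X : Type*} [TopologicalSpace X] [SecondCountableTopology X]
    (S : PolyhedralSpace X) (n : ℕ) : Prop :=
  ∀ P ∈ S.complexes, ∀ σ : P.cells,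
    Maximal (fun s => s ∈ P.cells) (σ : Set X) → P.dim σ = n

/-- A quasi-embedded polyhedral space `(X, N, ι)`. When `N` is an inner product space, this is a
Euclidean polyhedral space. -/
structure QuasiEmbeddedPolyhedralSpace (X N : Type*) [TopologicalSpace X]
    [SecondCountableTopology X] [AddCommGroup N] [Module ℝ N] [FiniteDimensional ℝ N] extends
    PolyhedralSpace X where
  /-- the quasi-embedding -/
  ι : X → N
  /-- The image of `ι` lies in an affine hyperplane not containing zero. -/
  exists_hyperplane : ∃ H : AffineSubspace ℝ N, IsCoatom H ∧ 0 ∉ H ∧ ∀ x, ι x ∈ H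
  /-- On some polyhedral complex, `ι` is affine and injective on every polyhedron. -/
  exists_complex : ∃ P ∈ complexes, ∀ σ : P.cells, P.AffineOn σ ι ∧ Set.InjOn ι (σ : Set X)

namespace QuasiEmbeddedPolyhedralSpace

section Concave

variable {X N : Type*} [TopologicalSpace X] [SecondCountableTopology X] [AddCommGroup N]
  [Module ℝ N] [FiniteDimensional ℝ N]

/-- `P` is a polyhedral complex on the quasi-embedded polyhedral space `S`: a polyhedral complex on
the underlying polyhedral space such that `ι` is affine and injective on each of its polyhedra. -/
def IsComplex (S : QuasiEmbeddedPolyhedralSpace X N) (P : PolyhedralStructure X) : Prop :=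
  P ∈ S.complexes ∧ ∀ σ : P.cells, P.AffineOn σ S.ι ∧ Set.InjOn S.ι (σ : Set X)

/-- `(x, (x_i), (ν_i))` is a convex combination in `U`. -/
def IsConvexCombination (S : QuasiEmbeddedPolyhedralSpace X N) (U : Set X) {m : ℕ}
    (x : X) (y : Fin m → X) (ν : Fin m → ℝ) : Prop :=
  x ∈ U ∧ (∀ i, y i ∈ U) ∧ (∀ i, 0 ≤ ν i) ∧ ∑ i, ν i = 1 ∧ ∑ i, ν i • S.ι (y i) = S.ι x

/-- The convex combination `(x, (x_i), (ν_i))` in `U` is polyhedral: for some polyhedral complex,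
there are a polyhedron `τ` containing `x` and polyhedra `σ_i ⊆ U` containing `x_i` and having `τ` as
a face. -/
def IsPolyhedralConvexCombination (S : QuasiEmbeddedPolyhedralSpace X N) (U : Set X) {m : ℕ}
    (x : X) (y : Fin m → X) (ν : Fin m → ℝ) : Prop :=
  S.IsConvexCombination U x y ν ∧
    ∃ P : PolyhedralStructure X, S.IsComplex P ∧ ∃ (τ : P.cells) (σ : Fin m → P.cells),
      x ∈ (τ : Set X) ∧ ∀ i, P.IsFace τ (σ i) ∧ (σ i : Set X) ⊆ U ∧ y i ∈ (σ i : Set X)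

/-- The real function `f` on `U` is concave (only the values of `f` on `U` matter). -/
def IsConcaveOn (S : QuasiEmbeddedPolyhedralSpace X N) (U : Set X) (f : X → ℝ) : Prop :=
  ∀ (m : ℕ) (x : X) (y : Fin m → X) (ν : Fin m → ℝ),
    S.IsPolyhedralConvexCombination U x y ν → ∑ i, ν i * f (y i) ≤ f x

end Concave

section Euclidean

variable {X N : Type*} [TopologicalSpace X] [SecondCountableTopology X] [NormedAddCommGroup N]
  [InnerProductSpace ℝ N] [FiniteDimensional ℝ N]

/-- `v` is a unit vector that is orthogonal to the affine span of `ι(τ)`, parallel to the affine span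
of `ι(σ)`, and points towards `σ` from `τ`. -/
def IsUnitNormal (S : QuasiEmbeddedPolyhedralSpace X N) (τ σ : Set X) (v : N) : Prop :=
  ‖v‖ = 1 ∧ v ∈ (vectorSpan ℝ (S.ι '' τ))ᗮ ∧ v ∈ vectorSpan ℝ (S.ι '' σ) ∧
    ∀ x ∈ τ, ∀ y ∈ σ, 0 ≤ inner ℝ v (S.ι y - S.ι x)

/-- The unit vector `v_{σ \ τ}` normal to `τ` in the direction of `σ`, for a nonempty facet `τ` of a
polyhedron `σ`; it exists and is unique by `existsUnique_isUnitNormal` below. -/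
noncomputable def unitNormal (S : QuasiEmbeddedPolyhedralSpace X N) (τ σ : Set X) : N :=
  Classical.epsilon (S.IsUnitNormal τ σ)

/-- The weight `c : P|_U(k) → ℝ` is a Minkowski weight. For each `τ` the sum is finite, because `τ`
is nonempty. -/
def IsMinkowskiWeight (S : QuasiEmbeddedPolyhedralSpace X N) (P : PolyhedralStructure X)
    (U : Set X) (k : ℤ) (c : P.restrict U k → ℝ) : Prop :=
  ∀ τ ∈ P.restrict U (k - 1),
    ∑ᶠ (σ : P.restrict U k) (_ : P.IsFace τ σ), c σ • S.unitNormal (τ : Set X) (σ : Set X) = 0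

/-- The open subset `U` of a Euclidean polyhedral space of pure dimension `n` admits a balancing
condition: the cycle of an `n`-dimensional Minkowski weight on `P|_U` which is strictly positive on
all `n`-dimensional polyhedra of `P|_U`, for some polyhedral complex `P`. -/
def AdmitsBalancing (S : QuasiEmbeddedPolyhedralSpace X N) (n : ℕ) (U : Set X) : Prop :=
  ∃ P : PolyhedralStructure X, S.IsComplex P ∧ ∃ b : P.restrict U n → ℝ,
    S.IsMinkowskiWeight P U n b ∧ ∀ σ, 0 < b σ

/-- A Euclidean polyhedral space is locally balanceable if it has pure dimension and an open covering
each of whose members admits a balancing condition. -/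
def IsLocallyBalanceable (S : QuasiEmbeddedPolyhedralSpace X N) : Prop :=
  ∃ n : ℕ, S.HasPureDimension n ∧ ∃ 𝒰 : Set (Set X),
    (∀ V ∈ 𝒰, IsOpen V ∧ S.AdmitsBalancing n V) ∧ ⋃₀ 𝒰 = Set.univ

end Euclidean

end QuasiEmbeddedPolyhedralSpace

/-! ### Well-definedness of the unit normal vectors -/

/-- A direction of a convex set is a positive multiple of a difference of two of its points. -/
theorem exists_smul_sub_of_mem_vectorSpan {E : Type*} [AddCommGroup E] [Module ℝ E] {C : Set E}
    (hC : Convex ℝ C) (hne : C.Nonempty) {d : E} (hd : d ∈ vectorSpan ℝ C) :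
    ∃ x ∈ C, ∃ y ∈ C, ∃ c : ℝ, 0 < c ∧ d = c • (x - y) := by
  obtain ⟨p, hp⟩ := hne
  rw [vectorSpan_def] at hd
  induction hd using Submodule.span_induction with
  | mem d h =>
    obtain ⟨x, hx, y, hy, rfl⟩ := h
    exact ⟨x, hx, y, hy, 1, one_pos, by simp⟩
  | zero => exact ⟨p, hp, p, hp, 1, one_pos, by simp⟩
  | add d e _ _ h h' =>
    obtain ⟨x, hx, y, hy, a, ha, rfl⟩ := h
    obtain ⟨x', hx', y', hy', b, hb, rfl⟩ := h'
    have hab : a + b ≠ 0 := by positivity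
    refine ⟨(a / (a + b)) • x + (b / (a + b)) • x', hC hx hx' (by positivity) (by positivity)
      (by field_simp), (a / (a + b)) • y + (b / (a + b)) • y', hC hy hy' (by positivity)
      (by positivity) (by field_simp), a + b, by positivity, ?_⟩
    simp only [smul_sub, smul_add, smul_smul, mul_div_cancel₀ _ hab]
    abel
  | smul r d _ h =>
    obtain ⟨x, hx, y, hy, a, ha, rfl⟩ := h
    rcases lt_trichotomy r 0 with hr | rfl | hr
    · exact ⟨y, hy, x, hx, -r * a, by nlinarith, by
        rw [smul_smul, ← neg_sub x y, smul_neg, ← neg_smul]; congr 1; ring⟩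
    · exact ⟨p, hp, p, hp, 1, one_pos, by simp⟩
    · exact ⟨x, hx, y, hy, r * a, by positivity, by rw [smul_smul]⟩

/-- A point of a convex set that lies in the affine span of a face lies in this face. -/
theorem IsConvexFace.mem_of_sub_mem {E : Type*} [AddCommGroup E] [Module ℝ E] {C F : Set E}
    (hF : IsConvexFace C F) {p z : E} (hp : p ∈ F) (hz : z ∈ C) (h : z - p ∈ vectorSpan ℝ F) :
    z ∈ F := by
  obtain ⟨x, hx, y, hy, c, hc, hd⟩ := exists_smul_sub_of_mem_vectorSpan hF.1 ⟨p, hp⟩ h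
  have hc' : 1 + c ≠ 0 := by positivity
  have hw : (1 / (1 + c)) • p + (c / (1 + c)) • x ∈ F :=
    hF.1 hp hx (by positivity) (by positivity) (by field_simp)
  refine hF.2.left_mem_of_mem_openSegment hz (hF.2.subset hy) hw
    ⟨1 / (1 + c), c / (1 + c), by positivity, by positivity, by field_simp, ?_⟩
  have : z = p + c • (x - y) := by rw [← hd]; abel
  rw [this, div_eq_mul_one_div c, mul_comm c, mul_smul, mul_smul, ← smul_add, ← smul_add]
  congr 1
  rw [smul_sub]; abel

/-- If `A` is affine and injective on a convex set `C`, then it is injective on the directions. -/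
theorem linear_injOn_vectorSpan {E E' : Type*} [AddCommGroup E] [Module ℝ E] [AddCommGroup E']
    [Module ℝ E'] {C : Set E} (hC : Convex ℝ C) (hne : C.Nonempty) (A : E →ᵃ[ℝ] E')
    (hA : Set.InjOn A C) {d : E} (hd : d ∈ vectorSpan ℝ C) (h : A.linear d = 0) : d = 0 := by
  obtain ⟨x, hx, y, hy, c, hc, rfl⟩ := exists_smul_sub_of_mem_vectorSpan hC hne hd
  have h1 : A.linear (x - y) = 0 := by simpa [hc.ne'] using h
  have h2 : A x = A y := by
    rw [← vsub_eq_sub, A.linearMap_vsub, vsub_eq_sub, sub_eq_zero] at h1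
    exact h1
  simp [hA hx hy h2]

theorem IsConvexPolyhedron.convex {E : Type*} [AddCommGroup E] [Module ℝ E] {P : Set E}
    (h : IsConvexPolyhedron P) : Convex ℝ P := by
  obtain ⟨m, a, b, rfl⟩ := h
  intro x hx y hy s t hs ht hst i
  have h1 := hx i
  have h2 := hy i
  simp only [map_add, map_smul, smul_eq_mul]
  calc s * a i x + t * a i y ≤ s * b i + t * b i := by gcongr
    _ = b i := by rw [← add_mul, hst, one_mul]

namespace QuasiEmbeddedPolyhedralSpace

variable {X N : Type*} [TopologicalSpace X] [SecondCountableTopology X] [NormedAddCommGroup N]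
  [InnerProductSpace ℝ N] [FiniteDimensional ℝ N]

/-- The dimension of a nonempty polyhedron is the dimension of the affine span of its image. -/
theorem finrank_vectorSpan (S : QuasiEmbeddedPolyhedralSpace X N) {P : PolyhedralStructure X}
    (hP : S.IsComplex P) (σ : P.cells) (hσ : (σ : Set X).Nonempty) :
    (Module.finrank ℝ (vectorSpan ℝ (S.ι '' (σ : Set X))) : ℤ) = P.dim σ := by
  have := P.finiteDimensional σ
  obtain ⟨⟨A, hA⟩, hinj⟩ := hP.2 σ
  obtain ⟨x₀, hx₀⟩ := hσ
  set R := Set.range (P.φ σ) with hR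
  have hι : S.ι '' (σ : Set X) = A '' R := by
    ext z; constructor
    · rintro ⟨x, hx, rfl⟩; exact ⟨_, ⟨⟨x, hx⟩, rfl⟩, (hA ⟨x, hx⟩).symm⟩
    · rintro ⟨_, ⟨x, rfl⟩, rfl⟩; exact ⟨x, x.2, hA x⟩
  have hAinj : Set.InjOn A R := by
    rintro _ ⟨x, rfl⟩ _ ⟨y, rfl⟩ h
    rw [← hA, ← hA] at h
    rw [Subtype.ext (hinj x.2 y.2 h)]
  have hconv : Convex ℝ R := (P.isConvexPolyhedron σ).convex
  obtain ⟨H, hco, h0, hH⟩ := P.exists_hyperplane σ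
  have hp : P.φ σ ⟨x₀, hx₀⟩ ∈ H := hH ▸ subset_affineSpan ℝ R ⟨_, rfl⟩
  have hdir : vectorSpan ℝ R = H.direction := by rw [← direction_affineSpan]; exact congrArg _ hH
  have h1 : Module.finrank ℝ (vectorSpan ℝ R) + 1 = Module.finrank ℝ (P.M σ) := by
    rw [hdir, ← Subspace.dual_finrank_eq]
    set p := P.φ σ ⟨x₀, hx₀⟩
    have hp0 : p ≠ 0 := fun h => h0 (h ▸ hp)
    have hc : IsCompl H.direction (Submodule.span ℝ {p}) := by
      refine ⟨?_, ?_⟩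
      · rw [Submodule.disjoint_span_singleton' hp0]
        intro h
        refine h0 ?_
        have := AffineSubspace.vadd_mem_of_mem_direction (neg_mem h) hp
        simpa using this
      · rw [codisjoint_iff]
        have htop : H ⊔ affineSpan ℝ {0} = ⊤ := by
          refine hco.2 _ (lt_of_le_of_ne le_sup_left fun h => h0 ?_)
          rw [h]
          exact (le_sup_right : _ ≤ H ⊔ affineSpan ℝ {0}) (mem_affineSpan ℝ (Set.mem_singleton _))
        have := AffineSubspace.direction_sup hp (mem_affineSpan ℝ (Set.mem_singleton (0 : Module.Dual ℝ (P.M σ))))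
        rw [htop, AffineSubspace.direction_top, direction_affineSpan, vectorSpan_singleton,
          sup_bot_eq, vsub_eq_sub, zero_sub] at this
        rw [this, ← Set.neg_singleton, Submodule.span_neg]
    rw [← Submodule.finrank_add_eq_of_isCompl hc, finrank_span_singleton hp0]
  have h2 : vectorSpan ℝ (S.ι '' (σ : Set X)) = (vectorSpan ℝ R).map A.linear := by
    rw [hι, ← AffineMap.map_vectorSpan]
  have h3 : Module.finrank ℝ (vectorSpan ℝ (S.ι '' (σ : Set X))) =
      Module.finrank ℝ (vectorSpan ℝ R) := by
    rw [h2, ← LinearMap.range_domRestrict]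
    refine LinearMap.finrank_range_of_inj ((injective_iff_map_eq_zero _).2 fun d hd => ?_)
    exact Subtype.ext (linear_injOn_vectorSpan hconv ⟨_, ⟨⟨x₀, hx₀⟩, rfl⟩⟩ A hAinj d.2 hd)
  rw [h3, PolyhedralStructure.dim]
  omega

/-- The map `ι` sends polyhedra to convex sets and faces to faces. -/
theorem isConvexFace_image (S : QuasiEmbeddedPolyhedralSpace X N) {P : PolyhedralStructure X}
    (hP : S.IsComplex P) (τ σ : P.cells) (h : P.IsFace τ σ) :
    Convex ℝ (S.ι '' (σ : Set X)) ∧ IsConvexFace (S.ι '' (σ : Set X)) (S.ι '' (τ : Set X)) := by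
  obtain ⟨⟨A, hA⟩, hinj⟩ := hP.2 σ
  have hι : S.ι '' (σ : Set X) = A '' Set.range (P.φ σ) := by
    ext z; constructor
    · rintro ⟨x, hx, rfl⟩; exact ⟨_, ⟨⟨x, hx⟩, rfl⟩, (hA ⟨x, hx⟩).symm⟩
    · rintro ⟨_, ⟨x, rfl⟩, rfl⟩; exact ⟨x, x.2, hA x⟩
  have hι' : S.ι '' (τ : Set X) = A '' (P.φ σ '' {x | (x : X) ∈ (τ : Set X)}) := by
    ext z; constructor
    · rintro ⟨x, hx, rfl⟩
      exact ⟨_, ⟨⟨x, h.1 hx⟩, hx, rfl⟩, (hA ⟨x, h.1 hx⟩).symm⟩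
    · rintro ⟨_, ⟨x, hx, rfl⟩, rfl⟩; exact ⟨x, hx, hA x⟩
  have hconv : Convex ℝ (Set.range (P.φ σ)) := (P.isConvexPolyhedron σ).convex
  have hAinj : Set.InjOn A (Set.range (P.φ σ)) := by
    rintro _ ⟨x, rfl⟩ _ ⟨y, rfl⟩ h
    rw [← hA, ← hA] at h
    rw [Subtype.ext (hinj x.2 y.2 h)]
  have hsub : P.φ σ '' {x | (x : X) ∈ (τ : Set X)} ⊆ Set.range (P.φ σ) :=
    Set.image_subset_range _ _
  rw [hι, hι']
  refine ⟨hconv.affine_image A, Convex.affine_image A h.2.1, Set.image_mono hsub, ?_⟩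
  rintro _ ⟨x, hx, rfl⟩ _ ⟨y, hy, rfl⟩ _ ⟨z, hz, rfl⟩ ⟨a, b, ha, hb, hab, he⟩
  rw [← Convex.combo_affine_apply hab] at he
  have := hAinj (hconv hx hy ha.le hb.le hab) (hsub hz) he
  exact ⟨x, h.2.2.left_mem_of_mem_openSegment hx hy hz ⟨a, b, ha, hb, hab, this⟩, rfl⟩

/-- For a nonempty facet `τ` of a polyhedron `σ`, the unit normal vector exists and is unique. -/
theorem existsUnique_isUnitNormal (S : QuasiEmbeddedPolyhedralSpace X N)
    {P : PolyhedralStructure X} (hP : S.IsComplex P) (τ σ : P.cells)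
    (hτ : (τ : Set X).Nonempty) (h : P.IsFace τ σ) (hdim : P.dim τ = P.dim σ - 1) :
    ∃! v, S.IsUnitNormal τ σ v := by
  obtain ⟨x₀, hx₀⟩ := hτ
  have hx₀σ := h.1 hx₀
  obtain ⟨hconv, hface⟩ := S.isConvexFace_image hP τ σ h
  have e1 := S.finrank_vectorSpan hP τ ⟨x₀, hx₀⟩
  have e2 := S.finrank_vectorSpan hP σ ⟨x₀, hx₀σ⟩
  have hle : vectorSpan ℝ (S.ι '' (τ : Set X)) ≤ vectorSpan ℝ (S.ι '' (σ : Set X)) :=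
    vectorSpan_mono ℝ hface.2.subset
  set F := S.ι '' (τ : Set X)
  set C := S.ι '' (σ : Set X)
  have e3 : Module.finrank ℝ ((vectorSpan ℝ F)ᗮ ⊓ vectorSpan ℝ C : Submodule ℝ N) = 1 :=
    Submodule.finrank_add_inf_finrank_orthogonal' hle (by omega)
  obtain ⟨w, hw0, hw⟩ := finrank_eq_one_iff'.1 e3
  have hspan : ∀ u ∈ (vectorSpan ℝ F)ᗮ, u ∈ vectorSpan ℝ C → ∃ c : ℝ, c • (w : N) = u := by
    intro u h1 h2
    obtain ⟨c, hc⟩ := hw ⟨u, h1, h2⟩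
    exact ⟨c, congrArg Subtype.val hc⟩
  have hwn : (w : N) ≠ 0 := fun h => hw0 (Subtype.ext h)
  have hF0 : ∀ u ∈ (vectorSpan ℝ F)ᗮ, ∀ p ∈ F, ∀ q ∈ F, inner ℝ u (p - q) = 0 := fun u hu p hp q hq =>
    (Submodule.mem_orthogonal' _ _).1 hu _ (vsub_mem_vectorSpan ℝ hp hq)
  have hp₀ : S.ι x₀ ∈ F := ⟨x₀, hx₀, rfl⟩
  -- all points of `C` are on one side
  have hside : ∀ y ∈ C, ∀ z ∈ C, ¬ (inner ℝ (w : N) (y - S.ι x₀) < 0 ∧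
      0 < inner ℝ (w : N) (z - S.ι x₀)) := by
    rintro y hy z hz ⟨h1, h2⟩
    set a := inner ℝ (w : N) (z - S.ι x₀)
    set b := -inner ℝ (w : N) (y - S.ι x₀) with hb
    have hb0 : 0 < b := by linarith
    have hs : (a / (a + b)) + (b / (a + b)) = 1 := by field_simp
    set q := (a / (a + b)) • y + (b / (a + b)) • z with hq
    have hqC : q ∈ C := hconv hy hz (by positivity) (by positivity) hs
    have hq0 : inner ℝ (w : N) (q - S.ι x₀) = 0 := by
      have : q - S.ι x₀ = (a / (a + b)) • (y - S.ι x₀) + (b / (a + b)) • (z - S.ι x₀) := by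
        have : S.ι x₀ = ((a / (a + b)) + (b / (a + b))) • S.ι x₀ := by rw [hs, one_smul]
        conv_lhs => rw [this]
        rw [hq, smul_sub, smul_sub, add_smul]; abel
      rw [this, inner_add_right, inner_smul_right, inner_smul_right]
      change _ * _ + _ * a = 0
      rw [show inner ℝ (w : N) (y - S.ι x₀) = -b by rw [hb, neg_neg]]
      ring
    have hqF : q - S.ι x₀ ∈ vectorSpan ℝ F := by
      have hmem : q - S.ι x₀ ∈ vectorSpan ℝ C := vsub_mem_vectorSpan ℝ hqC (hface.2.subset hp₀)
      obtain ⟨u, hu, t, ht, hut⟩ := (vectorSpan ℝ F).exists_add_mem_mem_orthogonal (q - S.ι x₀)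
      have htC : t ∈ vectorSpan ℝ C := by
        have : t = (q - S.ι x₀) - u := by rw [hut]; abel
        rw [this]; exact sub_mem hmem (hle hu)
      obtain ⟨c, rfl⟩ := hspan t ht htC
      rw [hut, inner_add_right, inner_smul_right,
        (Submodule.mem_orthogonal' _ _).1 w.2.1 u hu, zero_add] at hq0
      have hc : c = 0 := by
        rcases mul_eq_zero.1 hq0 with h | h
        · exact h
        · exact absurd (inner_self_eq_zero.1 h) hwn
      rw [hut, hc]; simpa using hu
    have hyF : y ∈ F := hface.2.left_mem_of_mem_openSegment hy hz
      (hface.mem_of_sub_mem hp₀ hqC hqF) ⟨_, _, by positivity, by positivity, hs, rfl⟩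
    exact h1.ne (hF0 w w.2.1 y hyF _ hp₀)
  -- hence `w` or `-w` points towards `C`
  have hdir : ∃ u ∈ (vectorSpan ℝ F)ᗮ, u ∈ vectorSpan ℝ C ∧ u ≠ 0 ∧
      ∀ y ∈ C, 0 ≤ inner ℝ u (y - S.ι x₀) := by
    by_cases hn : ∃ y ∈ C, inner ℝ (w : N) (y - S.ι x₀) < 0
    · obtain ⟨y, hy, hyn⟩ := hn
      refine ⟨-w, neg_mem w.2.1, neg_mem w.2.2, neg_ne_zero.2 hwn, fun z hz => ?_⟩
      rw [inner_neg_left]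
      have := hside y hy z hz
      push Not at this
      linarith [this hyn]
    · push Not at hn
      exact ⟨w, w.2.1, w.2.2, hwn, hn⟩
  obtain ⟨u, hu1, hu2, hu0, hu3⟩ := hdir
  have hun : 0 < ‖u‖ := norm_pos_iff.2 hu0
  refine ⟨(‖u‖⁻¹ : ℝ) • u, ⟨?_, Submodule.smul_mem _ _ hu1, Submodule.smul_mem _ _ hu2, ?_⟩, ?_⟩
  · rw [norm_smul, norm_inv, norm_norm, inv_mul_cancel₀ hun.ne']
  · intro x hx y hy
    rw [inner_smul_left]
    have : S.ι y - S.ι x = (S.ι y - S.ι x₀) - (S.ι x - S.ι x₀) := by abel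
    rw [this, inner_sub_right, hF0 u hu1 _ ⟨x, hx, rfl⟩ _ hp₀, sub_zero]
    exact mul_nonneg (by simp) (hu3 _ ⟨y, hy, rfl⟩)
  · rintro v ⟨hv1, hv2, hv3, hv4⟩
    have : ∃ c : ℝ, v = c • u := by
      obtain ⟨c, hc⟩ := hspan v hv2 hv3
      obtain ⟨d, hd⟩ := hspan u hu1 hu2
      have hd0 : d ≠ 0 := by rintro rfl; exact hu0 (by rw [← hd, zero_smul])
      exact ⟨c / d, by rw [← hd, ← hc, smul_smul, div_mul_cancel₀ _ hd0]⟩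
    obtain ⟨c, rfl⟩ := this
    rw [norm_smul, Real.norm_eq_abs] at hv1
    rcases lt_or_ge c 0 with hc | hc
    · exfalso
      have hz : ∀ y ∈ C, inner ℝ u (y - S.ι x₀) = 0 := by
        rintro _ ⟨y, hy, rfl⟩
        have h1 := hv4 x₀ hx₀ y hy
        have h2 := hu3 _ ⟨y, hy, rfl⟩
        rw [inner_smul_left] at h1
        simp only [conj_trivial] at h1
        nlinarith
      obtain ⟨p, hp, q, hq, t, ht, he⟩ := exists_smul_sub_of_mem_vectorSpan hconv
        ⟨_, hface.2.subset hp₀⟩ hu2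
      have : inner ℝ u u = 0 := by
        nth_rewrite 2 [he]
        rw [inner_smul_right, show p - q = (p - S.ι x₀) - (q - S.ι x₀) by abel,
          inner_sub_right, hz p hp, hz q hq, sub_zero, mul_zero]
      exact hu0 (inner_self_eq_zero.1 this)
    · rw [abs_of_nonneg hc] at hv1
      rw [eq_inv_of_mul_eq_one_left hv1]

/-- The chosen unit normal vector has the defining property. -/
theorem isUnitNormal_unitNormal (S : QuasiEmbeddedPolyhedralSpace X N)
    {P : PolyhedralStructure X} (hP : S.IsComplex P) (τ σ : P.cells)
    (hτ : (τ : Set X).Nonempty) (h : P.IsFace τ σ) (hdim : P.dim τ = P.dim σ - 1) :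
    S.IsUnitNormal τ σ (S.unitNormal τ σ) :=
  Classical.epsilon_spec (S.existsUnique_isUnitNormal hP τ σ hτ h hdim).exists

end QuasiEmbeddedPolyhedralSpace

/-! Continuity at `p` follows from two one-sided Lipschitz estimates on the star of `p`, the union
of the polyhedra containing `p`. Concavity only tests polyhedra inside `U`, so the complex is
subdivided until the star is bounded and lies in `U` (`IsComplex.exists_small_star`).

The lower estimate needs no balancing. On a compact polyhedron `f` is bounded below by its least
value at a vertex, and since the polyhedron is a cone near `p`, a nearby point lies between `p` and
a point of the polyhedron at a fixed distance (`IsConcaveOn.exists_lower_lipschitz`). The upper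
estimate must look beyond `p`. If `ι p` is a relative interior point of the convex hull of the image
of the star, then `p` is a convex combination of a given `y` and of points of the star that
compensate `y`; as `f` is bounded below there, `f y` cannot exceed `f p` by much
(`IsConcaveOn.upper_lipschitz`).

By separation (`exists_radius_of_forall_isMin`), relative interiority follows if every linear
functional `l` with a minimum at `p` on the star is constant there. This minimum principle,
`BalancedStar.eq_of_isMin`, is where balancing enters. Pass to tangent cones at `p`, where `l ≥ 0`,
and suppose `l r > 0` for some `r` in a cone `k₀` of the full dimension `m + 1`. Slice the cones by
a generic fibre of a linear map to `ℝ^m` whose kernel in the direction of `k₀` is spanned by `r`.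
The slice is a graph: cones of dimension `m + 1` give edges and cones of dimension `m` give
vertices. It inherits the balancing condition, each edge being weighted by `b` times a Jacobian that
does not depend on the end from which it is computed (`exists_weight_mul_norm`). Summing `l` over
the weighted outgoing edge directions gives zero at each vertex. Grouped by edges, the contributions
of bounded edges cancel, rays contribute nonnegatively because `l` stays nonnegative along them, and
the edge in `k₀` contributes positively. This is a contradiction. -/

/-! ### Convex polyhedra and their faces: basic facts -/

section Polyhedra

variable {E F : Type*} [AddCommGroup E] [Module ℝ E] [AddCommGroup F] [Module ℝ F]

/-- Convex polyhedra may be described by any finite family of inequalities. -/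
theorem isConvexPolyhedron_setOf {κ : Type*} [Finite κ] (a : κ → Module.Dual ℝ E) (b : κ → ℝ) :
    IsConvexPolyhedron {x | ∀ i, a i x ≤ b i} := by
  obtain ⟨m, ⟨e⟩⟩ := Finite.exists_equiv_fin κ
  refine ⟨m, fun i => a (e.symm i), fun i => b (e.symm i), ?_⟩
  ext x
  exact ⟨fun h i => h _, fun h i => by simpa using h (e i)⟩

theorem IsConvexPolyhedron.inter {P Q : Set E} (hP : IsConvexPolyhedron P)
    (hQ : IsConvexPolyhedron Q) : IsConvexPolyhedron (P ∩ Q) := by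
  obtain ⟨m, a, b, rfl⟩ := hP
  obtain ⟨k, c, d, rfl⟩ := hQ
  have := isConvexPolyhedron_setOf (Sum.elim a c) (Sum.elim b d)
  simpa [Sum.forall, Set.ofPred_and] using this

theorem IsConvexPolyhedron.preimage {P : Set F} (hP : IsConvexPolyhedron P) (A : E →ᵃ[ℝ] F) :
    IsConvexPolyhedron (A ⁻¹' P) := by
  obtain ⟨m, a, b, rfl⟩ := hP
  refine ⟨m, fun i => (a i).comp A.linear, fun i => b i - a i (A 0), ?_⟩
  ext x
  have hx : A x = A.linear x + A 0 := by
    have := A.map_vadd 0 x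
    simpa using this
  simp only [Set.mem_preimage, Set.mem_ofPred_eq, hx, map_add, LinearMap.comp_apply]
  exact forall_congr' fun i => by rw [le_sub_iff_add_le]

theorem isConvexPolyhedron_Iic (c : ℝ) : IsConvexPolyhedron (Set.Iic c) := by
  have := isConvexPolyhedron_setOf (fun _ : Unit => (LinearMap.id : ℝ →ₗ[ℝ] ℝ)) (fun _ => c)
  simpa [Set.Iic] using this

theorem isConvexPolyhedron_Ici (c : ℝ) : IsConvexPolyhedron (Set.Ici c) := by
  have := isConvexPolyhedron_setOf (fun _ : Unit => -(LinearMap.id : ℝ →ₗ[ℝ] ℝ)) (fun _ => -c)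
  simpa [Set.Ici] using this

theorem isConvexPolyhedron_singleton_real (c : ℝ) : IsConvexPolyhedron ({c} : Set ℝ) := by
  rw [← Set.Icc_self, ← Set.Ici_inter_Iic]
  exact (isConvexPolyhedron_Ici c).inter (isConvexPolyhedron_Iic c)

theorem isConvexPolyhedron_zero [FiniteDimensional ℝ E] : IsConvexPolyhedron ({0} : Set E) := by
  let e := Module.finBasis ℝ E
  have := isConvexPolyhedron_setOf
    (Sum.elim (fun i => e.coord i) (fun i => -e.coord i)) (fun _ => 0)
  convert this
  ext x
  simp only [Set.mem_singleton_iff, Sum.forall, Sum.elim_inl, Sum.elim_inr, LinearMap.neg_apply,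
    Set.mem_ofPred_eq, Left.neg_nonpos_iff, ← forall_and]
  constructor
  · rintro rfl i; simp
  · intro h
    exact e.ext_elem fun i => by simpa using le_antisymm (h i).1 (h i).2

/-- An affine map which is injective on a convex set has an affine left inverse on this set. -/
theorem exists_affine_leftInverse {C : Set E} (hC : Convex ℝ C) (A : E →ᵃ[ℝ] F)
    (hA : Set.InjOn A C) : ∃ L : F →ᵃ[ℝ] E, ∀ x ∈ C, L (A x) = x := by
  rcases C.eq_empty_or_nonempty with rfl | ⟨x₀, hx₀⟩
  · exact ⟨AffineMap.const ℝ F 0, by simp⟩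
  -- `A` may fail to be injective on `E`; only its restriction to the direction of `C` is inverted,
  -- by a linear map defined on all of `F`.
  obtain ⟨g, hg⟩ := (A.linear.domRestrict (vectorSpan ℝ C)).exists_leftInverse_of_injective
    (LinearMap.ker_eq_bot'.2 fun d hd =>
      Subtype.ext (linear_injOn_vectorSpan hC ⟨x₀, hx₀⟩ A hA d.2 hd))
  refine ⟨⟨fun z => (g (z - A x₀) : E) + x₀, (vectorSpan ℝ C).subtype.comp g, ?_⟩, ?_⟩
  · intro p v
    simp only [vadd_eq_add, LinearMap.comp_apply, Submodule.subtype_apply]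
    rw [add_sub_assoc, map_add]
    simp [add_assoc]
  · intro x hx
    have h1 : A x - A x₀ = A.linear.domRestrict (vectorSpan ℝ C)
        ⟨x - x₀, vsub_mem_vectorSpan ℝ hx hx₀⟩ := by
      simp [LinearMap.domRestrict_apply, ← vsub_eq_sub, A.linearMap_vsub]
    have h2 := LinearMap.congr_fun hg ⟨x - x₀, vsub_mem_vectorSpan ℝ hx hx₀⟩
    simp only [LinearMap.comp_apply, LinearMap.id_apply] at h2
    change (g (A x - A x₀) : E) + x₀ = x
    rw [h1, h2]; simp

/-- Injectivity on `P` makes elimination of variables unnecessary: with an affine left inverse `L`,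
the image is cut out by the conditions `L z ∈ P` and `A (L z) = z`. -/
theorem IsConvexPolyhedron.image [FiniteDimensional ℝ F] {P : Set E} (hP : IsConvexPolyhedron P)
    (A : E →ᵃ[ℝ] F) (hA : Set.InjOn A P) : IsConvexPolyhedron (A '' P) := by
  obtain ⟨L, hL⟩ := exists_affine_leftInverse hP.convex A hA
  have := (hP.preimage L).inter
    ((isConvexPolyhedron_zero (E := F)).preimage (A.comp L - AffineMap.id ℝ F))
  convert this using 1
  ext z
  simp only [Set.mem_inter_iff, Set.mem_preimage, Set.mem_singleton_iff]
  constructor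
  · rintro ⟨x, hx, rfl⟩
    rw [hL x hx]
    exact ⟨hx, by simp [hL x hx]⟩
  · rintro ⟨h1, h2⟩
    exact ⟨L z, h1, by simpa [sub_eq_zero] using h2⟩

/-- Faces of convex sets intersect to faces of the intersection. -/
theorem IsConvexFace.inter_preimage {P G : Set E} {Q H : Set F} (hG : IsConvexFace P G)
    (hH : IsConvexFace Q H) (A : E →ᵃ[ℝ] F) :
    IsConvexFace (P ∩ A ⁻¹' Q) (G ∩ A ⁻¹' H) := by
  refine ⟨hG.1.inter (hH.1.affine_preimage A),
    Set.inter_subset_inter hG.2.subset (Set.preimage_mono hH.2.subset), ?_⟩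
  rintro x ⟨hx, hx'⟩ y ⟨hy, hy'⟩ z ⟨hz, hz'⟩ hxy
  refine ⟨hG.2.2 hx hy hz hxy, hH.2.2 hx' hy' hz' ?_⟩
  rw [← image_openSegment]
  exact ⟨z, hxy, rfl⟩

theorem IsConvexFace.refl {P : Set E} (hP : Convex ℝ P) : IsConvexFace P P :=
  ⟨hP, IsExtreme.refl ℝ P⟩

/-- Faces under an injective affine map. -/
theorem IsConvexFace.of_image {P G : Set E} (A : E →ᵃ[ℝ] F) (hP : Convex ℝ P) (hGP : G ⊆ P)
    (hA : Set.InjOn A P) (h : IsConvexFace (A '' P) (A '' G)) : IsConvexFace P G := by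
  have key : G = P ∩ A ⁻¹' (A '' G) := by
    ext x
    constructor
    · exact fun hx => ⟨hGP hx, x, hx, rfl⟩
    · rintro ⟨hx, y, hy, hxy⟩
      rwa [← hA (hGP hy) hx hxy]
  have key' : P = P ∩ A ⁻¹' (A '' P) := by
    rw [Set.inter_eq_left.2 (Set.subset_preimage_image A P)]
  rw [key]
  nth_rewrite 1 [key']
  exact (IsConvexFace.refl hP).inter_preimage h A

theorem IsConvexFace.image {P G : Set E} (A : E →ᵃ[ℝ] F) (hP : Convex ℝ P)
    (hA : Set.InjOn A P) (h : IsConvexFace P G) : IsConvexFace (A '' P) (A '' G) := by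
  refine ⟨h.1.affine_image A, Set.image_mono h.2.subset, ?_⟩
  rintro _ ⟨x, hx, rfl⟩ _ ⟨y, hy, rfl⟩ _ ⟨z, hz, rfl⟩ ⟨a, b, ha, hb, hab, he⟩
  rw [← Convex.combo_affine_apply hab] at he
  have := hA (hP hx hy ha.le hb.le hab) (h.2.subset hz) he
  exact ⟨x, h.2.left_mem_of_mem_openSegment hx hy hz ⟨a, b, ha, hb, hab, this⟩, rfl⟩

/-- A supporting hyperplane cuts out a face. -/
theorem isConvexFace_of_le {P : Set E} (hP : Convex ℝ P) (c : Module.Dual ℝ E) (d : ℝ)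
    (h : ∀ x ∈ P, c x ≤ d) : IsConvexFace P {x ∈ P | c x = d} := by
  refine ⟨?_, fun x hx => hx.1, ?_⟩
  · rintro x ⟨hx, hx'⟩ y ⟨hy, hy'⟩ s t hs ht hst
    exact ⟨hP hx hy hs ht hst, by simp [hx', hy', ← add_mul, hst]⟩
  · rintro x hx y hy z ⟨hz, hz'⟩ ⟨s, t, hs, ht, hst, rfl⟩
    refine ⟨hx, le_antisymm (h x hx) ?_⟩
    simp only [map_add, map_smul, smul_eq_mul] at hz'
    have := h y hy
    have h1 : s * d + t * d = d := by rw [← add_mul, hst, one_mul]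
    nlinarith

/-- One can move inside a polyhedron in every direction which is compatible with those
inequalities that are equalities at the given point. -/
theorem exists_step {m : ℕ} {a : Fin m → Module.Dual ℝ E} {b : Fin m → ℝ} {x u : E}
    (hx : ∀ i, a i x ≤ b i) (hu : ∀ i, a i x = b i → a i u ≤ 0) :
    ∃ t : ℝ, 0 < t ∧ ∀ i, a i (x + t • u) ≤ b i := by
  have : ∀ i, ∃ T : ℝ, 0 < T ∧ ∀ t : ℝ, 0 < t → t ≤ T → a i (x + t • u) ≤ b i := by
    intro i
    rcases eq_or_lt_of_le (hx i) with h | h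
    · refine ⟨1, one_pos, fun t ht _ => ?_⟩
      rw [map_add, map_smul, smul_eq_mul, h]
      nlinarith [hu i h]
    -- The summand `1` keeps the denominator positive when `a i u = 0`.
    · refine ⟨(b i - a i x) / (1 + |a i u|), by
        have := abs_nonneg (a i u)
        exact div_pos (by linarith) (by linarith), fun t ht hT => ?_⟩
      rw [le_div_iff₀ (by positivity)] at hT
      simp only [map_add, map_smul, smul_eq_mul]
      nlinarith [le_abs_self (a i u)]
  choose T hT hT' using this
  obtain ⟨t, ht, htT⟩ : ∃ t : ℝ, 0 < t ∧ ∀ i, t ≤ T i := by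
    rcases isEmpty_or_nonempty (Fin m) with h | h
    · exact ⟨1, one_pos, fun i => h.elim i⟩
    · obtain ⟨i₀, hi₀⟩ := Finite.exists_min T
      exact ⟨T i₀, hT i₀, hi₀⟩
  exact ⟨t, ht, fun i => hT' i t ht (htT i)⟩

/-- A segment between two points of a polyhedron can be extended beyond a point at which only
those inequalities are equalities that are so at the other point. -/
theorem exists_extend_segment {m : ℕ} {a : Fin m → Module.Dual ℝ E} {b : Fin m → ℝ} {x y : E}
    (hx : ∀ i, a i x ≤ b i) (hxy : ∀ i, a i x = b i → a i y = b i) :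
    ∃ z, (∀ i, a i z ≤ b i) ∧ x ∈ openSegment ℝ y z := by
  -- An inequality that is an equality at `x` is one at `y` too, so its functional vanishes on `x -
  -- y`.
  obtain ⟨t, ht, h⟩ := exists_step (u := x - y) hx fun i hi => by rw [map_sub, hi, hxy i hi, sub_self]
  refine ⟨x + t • (x - y), h, t / (1 + t), 1 / (1 + t), by positivity,
    by positivity, by field_simp; ring, ?_⟩
  have h1 : (1 + t) • x = t • y + (x + t • (x - y)) := by
    rw [smul_sub, add_smul, one_smul]; abel
  have h2 : x = (1 / (1 + t)) • ((1 + t) • x) := by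
    rw [smul_smul, one_div_mul_cancel (by positivity), one_smul]
  nth_rewrite 3 [h2]
  rw [h1, smul_add (1 / (1 + t)) (t • y), smul_smul, one_div_mul_eq_div]

/-- A nonempty face of a polyhedron is cut out by turning some of the inequalities into
equalities. -/
theorem IsConvexFace.exists_eq {m : ℕ} {a : Fin m → Module.Dual ℝ E} {b : Fin m → ℝ} {G : Set E}
    (hG : IsConvexFace {x | ∀ i, a i x ≤ b i} G) (hne : G.Nonempty) :
    ∃ I : Set (Fin m), G = {x | (∀ i, a i x ≤ b i) ∧ ∀ i ∈ I, a i x = b i} := by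
  let T : E → Set (Fin m) := fun x => {i | a i x = b i}
  -- A point `x` of `G` with an inclusion-minimal set of active inequalities serves as a relative
  -- interior point: at its midpoint with another point of `G` only common inequalities are active,
  -- and a segment reaching `x` from a point satisfying the equations in `I` can be prolonged.
  obtain ⟨I, ⟨⟨x, hx, hxI⟩, hmin⟩⟩ := (Set.toFinite (T '' G)).exists_minimal (hne.image T)
  refine ⟨I, Set.Subset.antisymm (fun y hy => ⟨hG.2.subset hy, ?_⟩) ?_⟩
  · have hw : (1 / 2 : ℝ) • x + (1 / 2 : ℝ) • y ∈ G :=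
      hG.1 hx hy (by norm_num) (by norm_num) (by norm_num)
    have hsub : ∀ i ∈ T ((1 / 2 : ℝ) • x + (1 / 2 : ℝ) • y), a i x = b i ∧ a i y = b i := by
      intro i hi
      have h1 := hG.2.subset hx i
      have h2 := hG.2.subset hy i
      simp only [T, Set.mem_ofPred_eq, map_add, map_smul, smul_eq_mul] at hi
      constructor <;> linarith
    intro i hi
    exact (hsub i (hmin ⟨_, hw, rfl⟩ (fun i hi => hxI ▸ (hsub i hi).1) hi)).2
  · rintro y ⟨hy, hyI⟩
    have hxP := hG.2.subset hx
    obtain ⟨z, hz, hxyz⟩ := exists_extend_segment hxP (fun i hi => hyI i (hxI ▸ hi))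
    exact hG.2.left_mem_of_mem_openSegment hy hz hx hxyz

/-- The faces of the intersection of a polyhedron with a half-space. -/
theorem IsConvexFace.exists_of_inter_Iic {P : Set E} (hP : IsConvexPolyhedron P) (h : E →ᵃ[ℝ] ℝ)
    {G : Set E} (hG : IsConvexFace (P ∩ h ⁻¹' Set.Iic 0) G) (hne : G.Nonempty) :
    ∃ G', IsConvexFace P G' ∧ (G = G' ∩ h ⁻¹' Set.Iic 0 ∨ G = G' ∩ h ⁻¹' {0}) := by
  obtain ⟨m, a, b, rfl⟩ := hP
  have hh : ∀ x, h x = h.linear x + h 0 := fun x => by simpa using h.map_vadd 0 x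
  have e : {x | ∀ i, a i x ≤ b i} ∩ h ⁻¹' Set.Iic 0 =
      {x | ∀ i : Fin (m + 1), (Fin.cons h.linear a : Fin (m + 1) → Module.Dual ℝ E) i x ≤
        (Fin.cons (-h 0) b : Fin (m + 1) → ℝ) i} := by
    ext x
    simp only [Set.mem_inter_iff, Set.mem_ofPred_eq, Set.mem_preimage, Set.mem_Iic, hh x,
      Fin.forall_fin_succ, Fin.cons_zero, Fin.cons_succ]
    rw [and_comm, le_neg_iff_add_nonpos_right]
  rw [e] at hG
  obtain ⟨I, rfl⟩ := hG.exists_eq hne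
  have e' : ∀ x, (∀ i : Fin (m + 1), (Fin.cons h.linear a : Fin (m + 1) → Module.Dual ℝ E) i x ≤
        (Fin.cons (-h 0) b : Fin (m + 1) → ℝ) i) ↔ (∀ i, a i x ≤ b i) ∧ h x ≤ 0 := by
    intro x
    have := Set.ext_iff.1 e x
    simpa using this.symm
  have hconv : Convex ℝ {x | ∀ i, a i x ≤ b i} := IsConvexPolyhedron.convex ⟨m, a, b, rfl⟩
  -- The face of `P` keeps the equations coming from `P`. Index `0` stands for `h`, and its
  -- membership in `I` decides between `h = 0` and `h ≤ 0`.
  refine ⟨{x | (∀ i, a i x ≤ b i) ∧ ∀ i, i.succ ∈ I → a i x = b i}, ⟨?_, fun x hx => hx.1, ?_⟩, ?_⟩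
  · rintro x ⟨hx, hx'⟩ y ⟨hy, hy'⟩ s t hs ht hst
    exact ⟨hconv hx hy hs ht hst, fun i hi => by simp [hx' i hi, hy' i hi, ← add_mul, hst]⟩
  · rintro x hx y hy z ⟨hz, hz'⟩ hxy
    exact ⟨hx, fun i hi => ((isConvexFace_of_le hconv (a i) (b i) fun x hx => hx i).2.2 hx hy
      ⟨hz, hz' i hi⟩ hxy).2⟩
  · have hc : ∀ x, Fin.cons (α := fun _ => Module.Dual ℝ E) h.linear a 0 x =
        Fin.cons (α := fun _ => ℝ) (-h 0) b 0 ↔ h x = 0 := by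
      intro x
      rw [hh x, Fin.cons_zero, Fin.cons_zero, eq_neg_iff_add_eq_zero]
    by_cases h0 : (0 : Fin (m + 1)) ∈ I
    · right
      ext x
      simp only [Set.mem_ofPred_eq, e', Set.mem_inter_iff, Set.mem_preimage, Set.mem_singleton_iff]
      rw [Fin.forall_fin_succ, hc]
      simp only [h0, Fin.cons_succ]
      constructor
      · rintro ⟨⟨h1, h2⟩, h3, h4⟩; exact ⟨⟨h1, h4⟩, h3 trivial⟩
      · rintro ⟨⟨h1, h2⟩, h3⟩; exact ⟨⟨h1, h3.le⟩, fun _ => h3, h2⟩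
    · left
      ext x
      simp only [Set.mem_ofPred_eq, e', Set.mem_inter_iff, Set.mem_preimage, Set.mem_Iic]
      rw [Fin.forall_fin_succ, hc]
      simp only [h0, Fin.cons_succ]
      tauto

end Polyhedra

/-! ### Polyhedra in finite dimension: extreme points and conical neighbourhoods -/

section FiniteDimensional

variable {E : Type*} [NormedAddCommGroup E] [NormedSpace ℝ E] [FiniteDimensional ℝ E]

theorem IsConvexPolyhedron.isClosed {P : Set E} (hP : IsConvexPolyhedron P) : IsClosed P := by
  obtain ⟨m, a, b, rfl⟩ := hP
  simp only [Set.ofPred_forall]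
  exact isClosed_iInter fun i =>
    isClosed_le (LinearMap.continuous_of_finiteDimensional (a i)) continuous_const

/-- An extreme point is determined by its set of active inequalities: from any other point of the
polyhedron at which these are active, the segment could be prolonged beyond the extreme point. -/
theorem IsConvexPolyhedron.finite_extremePoints {E : Type*} [AddCommGroup E] [Module ℝ E] {P : Set E} (hP : IsConvexPolyhedron P) :
    (P.extremePoints ℝ).Finite := by
  obtain ⟨m, a, b, rfl⟩ := hP
  refine Set.Finite.of_finite_image (f := fun x => {i | a i x = b i}) (Set.toFinite _) ?_
  intro x hx y hy hxy
  simp only at hxy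
  obtain ⟨z, hz, hxyz⟩ := exists_extend_segment (y := y) hx.1 (fun i hi => by
    have : i ∈ {i | a i x = b i} := hi
    rwa [hxy] at this)
  exact (hx.2 hy.1 hz hxyz).symm

/-- A bounded polyhedron is the convex hull of finitely many points. -/
theorem IsConvexPolyhedron.exists_eq_convexHull {P : Set E} (hP : IsConvexPolyhedron P)
    (hb : Bornology.IsBounded P) : ∃ V : Set E, V.Finite ∧ P = convexHull ℝ V := by
  refine ⟨P.extremePoints ℝ, hP.finite_extremePoints, ?_⟩
  -- Krein–Milman yields the closure of the convex hull, which is closed already for finitely many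
  -- points.
  rw [← (Set.Finite.isClosed_convexHull ℝ hP.finite_extremePoints).closure_eq]
  exact (closure_convexHull_extremePoints (Metric.isCompact_of_isClosed_isBounded hP.isClosed hb)
    hP.convex).symm

/-- Near each of its points, a polyhedron is a cone. -/
theorem IsConvexPolyhedron.exists_radius {P : Set E} (hP : IsConvexPolyhedron P) {p : E}
    (hp : p ∈ P) : ∃ δ > 0, ∀ y ∈ P, ∀ s : ℝ, 0 ≤ s → ‖s • (y - p)‖ ≤ δ →
      p + s • (y - p) ∈ P := by
  obtain ⟨m, a, b, rfl⟩ := hP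
  -- Inequalities strict at `p` survive in a ball, while those active at `p` are preserved by every
  -- nonnegative scaling centred at `p`.
  have : ∀ᶠ z in nhds p, ∀ i, a i p < b i → a i z < b i := by
    refine Filter.eventually_all.2 fun i => ?_
    by_cases h : a i p < b i
    · filter_upwards [(LinearMap.continuous_of_finiteDimensional (a i)).continuousAt.eventually_lt
        continuousAt_const h] with z hz _ using hz
    · exact Filter.Eventually.of_forall fun z hz => absurd hz h
  obtain ⟨δ, hδ, hball⟩ := Metric.eventually_nhds_iff.1 this
  refine ⟨δ / 2, by positivity, fun y hy s hs hsy i => ?_⟩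
  rcases eq_or_lt_of_le (hp i) with h | h
  · simp only [map_add, map_smul, map_sub, smul_eq_mul, h]
    nlinarith [hy i]
  · refine (hball ?_ i h).le
    rw [dist_eq_norm, add_sub_cancel_left]
    linarith

end FiniteDimensional

/-! ### Restricting spaces of functions -/

section Restriction

variable {X : Type*} [TopologicalSpace X] {s t : Set X}

/-- Restriction of continuous functions to a subset. -/
def restrictMap (h : t ⊆ s) : C(s, ℝ) →ₗ[ℝ] C(t, ℝ) where
  toFun g := g.comp ⟨Set.inclusion h, continuous_inclusion h⟩
  map_add' _ _ := rfl
  map_smul' _ _ := rfl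

/-- The map of dual spaces induced by the restriction of functions. -/
def restrictDual (M : Submodule ℝ C(s, ℝ)) (h : t ⊆ s) :
    Module.Dual ℝ (M.map (restrictMap h)) →ₗ[ℝ] Module.Dual ℝ M :=
  ((restrictMap h).submoduleMap M).dualMap

theorem restrictDual_injective (M : Submodule ℝ C(s, ℝ)) (h : t ⊆ s) :
    Function.Injective (restrictDual M h) :=
  LinearMap.dualMap_injective_of_surjective ((restrictMap h).submoduleMap_surjective M)

theorem image_restrictDual (M : Submodule ℝ C(s, ℝ)) (h : t ⊆ s) {u : Set X} (hu : u ⊆ t) :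
    restrictDual M h '' (evalMap (M.map (restrictMap h)) '' {x | (x : X) ∈ u}) =
      evalMap M '' {x | (x : X) ∈ u} := by
  ext z
  constructor
  · rintro ⟨_, ⟨x, hx, rfl⟩, rfl⟩
    exact ⟨Set.inclusion h x, hx, rfl⟩
  · rintro ⟨x, hx, rfl⟩
    exact ⟨_, ⟨⟨x, hu hx⟩, hx, rfl⟩, rfl⟩

theorem image_restrictDual_range (M : Submodule ℝ C(s, ℝ)) (h : t ⊆ s) :
    restrictDual M h '' Set.range (evalMap (M.map (restrictMap h))) =
      evalMap M '' {x | (x : X) ∈ t} := by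
  rw [← image_restrictDual M h subset_rfl, ← Set.image_univ]
  congr 2
  ext x; simp

theorem isConvexPolyhedron_range_restrict (M : Submodule ℝ C(s, ℝ)) (h : t ⊆ s)
    (hP : IsConvexPolyhedron (evalMap M '' {x | (x : X) ∈ t})) :
    IsConvexPolyhedron (Set.range (evalMap (M.map (restrictMap h)))) := by
  have := hP.preimage (restrictDual M h).toAffineMap
  rw [← image_restrictDual_range M h] at this
  rwa [LinearMap.coe_toAffineMap, Set.preimage_image_eq _ (restrictDual_injective M h)] at this

theorem isFaceVia_restrict_iff (M : Submodule ℝ C(s, ℝ)) (h : t ⊆ s) {u : Set X} (hu : u ⊆ t)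
    (hP : IsConvexPolyhedron (evalMap M '' {x | (x : X) ∈ t})) :
    IsFaceVia (M.map (restrictMap h)) u ↔
      IsConvexFace (evalMap M '' {x | (x : X) ∈ t}) (evalMap M '' {x | (x : X) ∈ u}) := by
  have hc := (isConvexPolyhedron_range_restrict M h hP).convex
  have hi : Set.InjOn (restrictDual M h).toAffineMap
      (Set.range (evalMap (M.map (restrictMap h)))) := (restrictDual_injective M h).injOn
  rw [← image_restrictDual_range M h, ← image_restrictDual M h hu]
  constructor
  · rintro ⟨-, hf⟩
    exact hf.image _ hc hi
  · intro hf
    exact ⟨hu, hf.of_image (restrictDual M h).toAffineMap hc (Set.image_subset_range _ _) hi⟩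

/-- The topology of pointwise evaluation restricts to subsets. -/
theorem isEmbedding_eval_restrict (M : Submodule ℝ C(s, ℝ)) (h : t ⊆ s)
    (hM : Topology.IsEmbedding (fun x : s => (fun g : M => evalMap M x g))) :
    Topology.IsEmbedding (fun x : t => (fun g : M.map (restrictMap h) => evalMap _ x g)) := by
  have h1 := hM.comp (Topology.IsEmbedding.inclusion h)
  have h2 : Continuous fun (f : M.map (restrictMap h) → ℝ) (g : M) =>
      f ((restrictMap h).submoduleMap M g) := by fun_prop
  refine Topology.IsEmbedding.of_comp ?_ h2 h1
  exact continuous_pi fun g => (g : C(t, ℝ)).continuous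

/-- If a finite-dimensional space of functions contains the constants, then its evaluation map
spans a hyperplane not passing through the origin. -/
theorem exists_hyperplane_of_one (M : Submodule ℝ C(s, ℝ)) [FiniteDimensional ℝ M] (u : M)
    (hu : ∀ x, (u : C(s, ℝ)) x = 1) : ∃ H : AffineSubspace ℝ (Module.Dual ℝ M),
      IsCoatom H ∧ 0 ∉ H ∧ affineSpan ℝ (Set.range (evalMap M)) = H := by
  have hspan : Submodule.span ℝ (Set.range (evalMap M)) = ⊤ := by
    -- A functional that kills all evaluations is, by reflexivity, the evaluation at some `g ∈ M`,
    -- and this `g` vanishes at every point.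
    by_contra hne
    obtain ⟨f, hf0, hf⟩ := Submodule.exists_le_ker_of_lt_top _ (lt_top_iff_ne_top.2 hne)
    obtain ⟨g, rfl⟩ := (Module.evalEquiv ℝ M).surjective f
    refine hf0 ?_
    have : g = 0 := by
      ext x
      have := hf (Submodule.subset_span ⟨x, rfl⟩)
      exact this
    rw [this, map_zero]
  have h1 : ∀ ξ ∈ affineSpan ℝ (Set.range (evalMap M)), ξ u = 1 := by
    intro ξ hξ
    refine affineSpan_induction hξ ?_ ?_
    · rintro _ ⟨x, rfl⟩
      exact hu x
    · intro c ξ η ζ h1 h2 h3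
      simp [h1, h2, h3]
  -- With `h1`, this identifies the affine span with `{ξ | ξ u = 1}`, which is empty when `s` is.
  have h2 : ∀ ξ : Module.Dual ℝ M, ξ u = 1 → ξ ∈ affineSpan ℝ (Set.range (evalMap M)) := by
    intro ξ hξ
    rcases isEmpty_or_nonempty s with hs | ⟨⟨x₀⟩⟩
    · have : u = 0 := by ext x; exact hs.elim x
      rw [this, map_zero] at hξ
      exact absurd hξ zero_ne_one
    · have hle : Submodule.span ℝ (Set.range (evalMap M)) ≤
          vectorSpan ℝ (Set.range (evalMap M)) ⊔ Submodule.span ℝ {evalMap M x₀} := by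
        refine Submodule.span_le.2 ?_
        rintro _ ⟨x, rfl⟩
        rw [SetLike.mem_coe, ← sub_add_cancel (evalMap M x) (evalMap M x₀)]
        exact Submodule.add_mem_sup (vsub_mem_vectorSpan ℝ ⟨x, rfl⟩ ⟨x₀, rfl⟩)
          (Submodule.mem_span_singleton_self _)
      rw [hspan] at hle
      obtain ⟨d, hd, e, he, rfl⟩ := Submodule.mem_sup.1 (hle (Submodule.mem_top (x := ξ)))
      obtain ⟨c, rfl⟩ := Submodule.mem_span_singleton.1 he
      have hx₀ : evalMap M x₀ ∈ affineSpan ℝ (Set.range (evalMap M)) :=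
        subset_affineSpan ℝ _ ⟨x₀, rfl⟩
      rw [← direction_affineSpan] at hd
      have hmem := AffineSubspace.vadd_mem_of_mem_direction hd hx₀
      have hd0 : d u = 0 := by
        have := h1 _ hmem
        have h' := h1 _ hx₀
        simpa [h'] using this
      have h' := h1 _ hx₀
      have hc : c = 1 := by simpa [hd0, h'] using hξ
      simpa [hc] using hmem
  refine ⟨_, ⟨fun h => ?_, fun K hK => ?_⟩, fun h => ?_, rfl⟩
  · have := h1 0 (h ▸ AffineSubspace.mem_top ℝ _ _)
    simp at this
  · obtain ⟨hle, η, hη, hη'⟩ := SetLike.lt_iff_le_and_exists.1 hK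
    refine eq_top_iff.2 fun ξ _ => ?_
    rcases isEmpty_or_nonempty s with hs | ⟨⟨x₀⟩⟩
    · have : ξ = η := by
        ext g
        have : g = 0 := by ext x; exact hs.elim x
        simp [this]
      rwa [this]
    · have hx₀ : evalMap M x₀ ∈ affineSpan ℝ (Set.range (evalMap M)) :=
        subset_affineSpan ℝ _ ⟨x₀, rfl⟩
      have hs : η u - 1 ≠ 0 := fun h => hη' (h2 η (sub_eq_zero.1 h))
      have hζ : ξ - ((ξ u - 1) / (η u - 1)) • (η - evalMap M x₀) ∈
          affineSpan ℝ (Set.range (evalMap M)) := by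
        refine h2 _ ?_
        have h' := h1 _ hx₀
        simp [h', div_mul_cancel₀ _ hs]
      have := AffineSubspace.smul_vsub_vadd_mem K ((ξ u - 1) / (η u - 1)) hη (hle hx₀) (hle hζ)
      simpa using this
  · have := h1 0 h
    simp at this

end Restriction

/-! ### Subdivisions whose functions are restrictions -/

namespace PolyhedralStructure

variable {X : Type*} [TopologicalSpace X]

theorem φ_injective (P : PolyhedralStructure X) (σ : P.cells) : Function.Injective (P.φ σ) :=
  fun _ _ h => (P.isEmbedding_eval σ).injective (funext fun g => LinearMap.congr_fun h g)

/-- The functions on a polyhedron contain the constants. -/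
theorem exists_one (P : PolyhedralStructure X) (σ : P.cells) :
    ∃ u ∈ P.M σ, ∀ x, u x = 1 := by
  have := P.finiteDimensional σ
  obtain ⟨H, -, h0, hH⟩ := P.exists_hyperplane σ
  rcases isEmpty_or_nonempty (σ : Set X) with hs | ⟨⟨x₀⟩⟩
  · exact ⟨0, zero_mem _, fun x => hs.elim x⟩
  have hmem : ∀ x, P.φ σ x ∈ H := fun x => hH ▸ subset_affineSpan ℝ _ ⟨x, rfl⟩
  have hd : P.φ σ x₀ ∉ H.direction := fun h => h0 (by
    simpa using AffineSubspace.vadd_mem_of_mem_direction (neg_mem h) (hmem x₀))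
  -- Such an `f` comes from a function in `M σ` by reflexivity; vanishing on the direction of `H`
  -- but not at `φ σ x₀`, it yields a nonzero constant on `σ`.
  obtain ⟨f, hf1, hf⟩ := Submodule.exists_le_ker_of_notMem hd
  obtain ⟨g, rfl⟩ := (Module.evalEquiv ℝ (P.M σ)).surjective f
  set c : ℝ := (g : C(↑σ, ℝ)) x₀ with hc
  have hc0 : c ≠ 0 := hf1
  refine ⟨c⁻¹ • (g : C(↑σ, ℝ)), Submodule.smul_mem _ _ g.2, fun x => ?_⟩
  have h1 : (Module.evalEquiv ℝ (P.M σ) g) (P.φ σ x - P.φ σ x₀) = 0 :=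
    hf (AffineSubspace.vsub_mem_direction (hmem x) (hmem x₀))
  have h2 : (g : C(↑σ, ℝ)) x = c := by
    rw [map_sub, sub_eq_zero] at h1
    exact h1
  simp [h2, hc0]

theorem isFace_self (P : PolyhedralStructure X) (σ : P.cells) : P.IsFace σ σ := by
  refine ⟨subset_rfl, ?_⟩
  have : evalMap (P.M σ) '' {x : (σ : Set X) | (x : X) ∈ (σ : Set X)} =
      Set.range (evalMap (P.M σ)) := by
    rw [← Set.image_univ]; congr 1; ext x; simp
  rw [this]
  exact IsConvexFace.refl (P.isConvexPolyhedron σ).convex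

theorem empty_mem_cells (P : PolyhedralStructure X) (σ : P.cells) : ∅ ∈ P.cells :=
  (P.face_mem σ ∅ ⟨Set.empty_subset _, by
    have : {x : (σ : Set X) | (x : X) ∈ (∅ : Set X)} = ∅ := by ext; simp
    rw [this, Set.image_empty]
    exact ⟨convex_empty, Set.empty_subset _, fun x _ y _ z hz => hz.elim⟩⟩).1

theorem inter_mem_cells (P : PolyhedralStructure X) (σ σ' : P.cells) :
    (σ : Set X) ∩ σ' ∈ P.cells :=
  (P.face_mem σ _ (P.inter_face σ σ').1).1

/-- The spaces of functions of a face are the restrictions. -/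
theorem M_eq_map_of_isFaceVia (P : PolyhedralStructure X) (σ τ : P.cells)
    (h : IsFaceVia (P.M σ) (τ : Set X)) : P.M τ = (P.M σ).map (restrictMap h.1) := by
  obtain ⟨ht, hg⟩ := P.face_mem σ τ h
  ext g
  rw [show g ∈ P.M τ ↔ _ from hg g, Submodule.mem_map]
  refine exists_congr fun k => and_congr_right fun _ => ⟨fun hk => ?_, fun hk => ?_⟩
  · ext x; exact (hk x x.2 (h.1 x.2)).symm
  · rintro x hx hx'
    exact (DFunLike.congr_fun hk ⟨x, hx⟩).symm

open Classical in
/-- The restrictions of the functions on a polyhedron of `P` to a subset. -/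
noncomputable def restrictM (P : PolyhedralStructure X) (t : Set X) : Submodule ℝ C(t, ℝ) :=
  if h : ∃ σ : P.cells, t ⊆ σ then (P.M h.choose).map (restrictMap h.choose_spec) else ⊥

theorem map_restrictMap_map {s t u : Set X} (M : Submodule ℝ C(s, ℝ)) (h : t ⊆ s) (h' : u ⊆ t) :
    (M.map (restrictMap h)).map (restrictMap h') = M.map (restrictMap (h'.trans h)) := by
  rw [← Submodule.map_comp]; rfl

/-- The choice in `restrictM` is immaterial: two polyhedra containing `t` induce the same functions
on their intersection, a common face that contains `t`. -/
theorem restrictM_eq (P : PolyhedralStructure X) {t : Set X} (σ : P.cells) (h : t ⊆ σ) :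
    P.restrictM t = (P.M σ).map (restrictMap h) := by
  have hex : ∃ σ : P.cells, t ⊆ σ := ⟨σ, h⟩
  rw [restrictM, dif_pos hex]
  obtain ⟨σ', hσ'⟩ : ∃ σ' : P.cells, σ' = hex.choose := ⟨_, rfl⟩
  have h' : t ⊆ σ' := hσ' ▸ hex.choose_spec
  suffices (P.M σ').map (restrictMap h') = (P.M σ).map (restrictMap h) by
    subst hσ'; exact this
  let ρ : P.cells := ⟨_, P.inter_mem_cells σ σ'⟩
  have h1 := P.M_eq_map_of_isFaceVia σ ρ (P.inter_face σ σ').1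
  have h2 := P.M_eq_map_of_isFaceVia σ' ρ (P.inter_face σ σ').2
  rw [h1] at h2
  have := congrArg (Submodule.map (restrictMap (Set.subset_inter h h'))) h2
  rw [map_restrictMap_map, map_restrictMap_map] at this
  exact this.symm

/-- Construction of subdivisions: the functions on the new polyhedra are the restrictions. -/
noncomputable def subdivide (P : PolyhedralStructure X) (C : Set (Set X))
    (hclosed : ∀ t ∈ C, IsClosed t) (hcover : ⋃₀ C = Set.univ)
    (hfin : LocallyFinite (fun t : C => (t : Set X)))
    (hC : ∀ t ∈ C, ∃ σ : P.cells, t ⊆ σ ∧ IsConvexPolyhedron (P.φ σ '' {x | (x : X) ∈ t}) ∧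
      (∀ u ⊆ t, IsConvexFace (P.φ σ '' {x | (x : X) ∈ t}) (P.φ σ '' {x | (x : X) ∈ u}) → u ∈ C) ∧
      ∀ t' ∈ C, IsConvexFace (P.φ σ '' {x | (x : X) ∈ t})
        (P.φ σ '' {x | (x : X) ∈ t ∩ t'})) :
    PolyhedralStructure X where
  cells := C
  M t := P.restrictM t
  isClosed t := hclosed t t.2
  sUnion_cells := hcover
  locallyFinite := hfin
  finiteDimensional t := by
    obtain ⟨σ, h, -⟩ := hC t t.2
    have := P.finiteDimensional σ
    rw [P.restrictM_eq σ h]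
    infer_instance
  isEmbedding_eval t := by
    obtain ⟨σ, h, -⟩ := hC t t.2
    rw [P.restrictM_eq σ h]
    exact isEmbedding_eval_restrict _ h (P.isEmbedding_eval σ)
  isConvexPolyhedron t := by
    obtain ⟨σ, h, hP, -⟩ := hC t t.2
    rw [P.restrictM_eq σ h]
    exact isConvexPolyhedron_range_restrict _ h hP
  exists_hyperplane t := by
    obtain ⟨σ, h, -⟩ := hC t t.2
    have := P.finiteDimensional σ
    obtain ⟨u, hu, hu1⟩ := P.exists_one σ
    rw [P.restrictM_eq σ h]
    exact exists_hyperplane_of_one _ ⟨restrictMap h u, Submodule.mem_map_of_mem hu⟩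
      fun x => hu1 _
  face_mem t u hu := by
    obtain ⟨σ, h, hP, hface, -⟩ := hC t t.2
    have hut : u ⊆ t := hu.1
    rw [P.restrictM_eq σ h, isFaceVia_restrict_iff _ h hut hP] at hu
    refine ⟨hface u hut hu, fun g => ?_⟩
    rw [P.restrictM_eq σ h, P.restrictM_eq σ (hut.trans h), ← map_restrictMap_map _ h hut,
      Submodule.mem_map]
    refine exists_congr fun k => and_congr_right fun _ => ⟨fun hk => ?_, fun hk => ?_⟩
    · rintro x hx hx'
      exact (DFunLike.congr_fun hk ⟨x, hx⟩).symm
    · ext x; exact (hk x x.2 (hut x.2)).symm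
  inter_face t t' := by
    constructor
    · obtain ⟨σ, h, hP, -, hint⟩ := hC t t.2
      rw [P.restrictM_eq σ h, isFaceVia_restrict_iff _ h Set.inter_subset_left hP]
      exact hint t' t'.2
    · obtain ⟨σ, h, hP, -, hint⟩ := hC t' t'.2
      rw [P.restrictM_eq σ h, isFaceVia_restrict_iff _ h Set.inter_subset_right hP,
        Set.inter_comm]
      exact hint t t.2

/-- Expanding `φ σ x` in the dual of a basis of `M σ` writes `g` as a constant plus a combination of
fixed vectors with coefficients in `M σ`, which are continuous. No topology on the dual space is
needed. -/
theorem AffineOn.continuousOn {P : PolyhedralStructure X} {σ : P.cells} {E : Type*}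
    [AddCommGroup E] [Module ℝ E] [TopologicalSpace E] [ContinuousAdd E] [ContinuousSMul ℝ E]
    {g : X → E} (hg : P.AffineOn σ g) : ContinuousOn g σ := by
  have := P.finiteDimensional σ
  obtain ⟨A, hA⟩ := hg
  rw [continuousOn_iff_continuous_domRestrict]
  let e := Module.finBasis ℝ (P.M σ)
  have : (σ : Set X).domRestrict g =
      fun x => (∑ i, (e i : C(↑σ, ℝ)) x • A.linear (e.dualBasis i)) + A 0 := by
    funext x
    have h1 : A (P.φ σ x) = A.linear (P.φ σ x) + A 0 := by
      simpa using A.map_vadd 0 (P.φ σ x)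
    have h2 : P.φ σ x = ∑ i, (e i : C(↑σ, ℝ)) x • e.dualBasis i := by
      refine e.ext fun j => ?_
      simp only [LinearMap.sum_apply, LinearMap.smul_apply, Module.Basis.dualBasis_apply_self,
        smul_eq_mul, mul_ite, mul_one, mul_zero, Finset.sum_ite_eq,
        Finset.mem_univ, if_true]
      rfl
    rw [Set.domRestrict_apply, hA, h1]
    nth_rewrite 1 [h2]
    simp
  rw [this]
  fun_prop

theorem AffineOn.of_isSubdivision {P P' : PolyhedralStructure X} (hs : P'.IsSubdivision P)
    {E : Type*} [AddCommGroup E] [Module ℝ E] {g : X → E} (hg : ∀ σ, P.AffineOn σ g)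
    (σ' : P'.cells) : P'.AffineOn σ' g := by
  obtain ⟨σ, h, A, hA⟩ := hs σ'
  obtain ⟨B, hB⟩ := hg σ
  exact ⟨B.comp A, fun x => by
    rw [AffineMap.comp_apply, ← hA, ← hB]⟩

theorem AffineOn.comp {P : PolyhedralStructure X} {σ : P.cells} {E F : Type*} [AddCommGroup E]
    [Module ℝ E] [AddCommGroup F] [Module ℝ F] {g : X → E} (hg : P.AffineOn σ g)
    (B : E →ᵃ[ℝ] F) : P.AffineOn σ (B ∘ g) := by
  obtain ⟨A, hA⟩ := hg
  exact ⟨B.comp A, fun x => by simp [hA]⟩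

theorem IsSubdivision.trans {P P' P'' : PolyhedralStructure X} (h : P''.IsSubdivision P')
    (h' : P'.IsSubdivision P) : P''.IsSubdivision P := by
  intro σ''
  obtain ⟨σ', hs, A, hA⟩ := h σ''
  obtain ⟨σ, hs', B, hB⟩ := h' σ'
  exact ⟨σ, hs.trans hs', B.comp A, fun x => by
    rw [AffineMap.comp_apply, ← hA, ← hB]⟩

/-! ### Cutting along the zero set of a piecewise affine function -/

/-- The pieces into which the real line is cut by the origin. -/
def signSets : Set (Set ℝ) := {Set.Iic 0, Set.Ici 0, {0}}

theorem isConvexPolyhedron_of_mem_signSets {J : Set ℝ} (hJ : J ∈ signSets) :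
    IsConvexPolyhedron J := by
  rcases hJ with rfl | rfl | rfl
  exacts [isConvexPolyhedron_Iic 0, isConvexPolyhedron_Ici 0, isConvexPolyhedron_singleton_real 0]

/-- The intersection axiom for `cut` is pulled back from this subdivision of the line. -/
theorem isConvexFace_inter_signSets {J K : Set ℝ} (hJ : J ∈ signSets) (hK : K ∈ signSets) :
    J ∩ K ∈ signSets ∧ IsConvexFace J (J ∩ K) := by
  have h1 : IsConvexFace (Set.Iic (0 : ℝ)) {0} := by
    have := isConvexFace_of_le (convex_Iic (0 : ℝ)) LinearMap.id 0 (fun x hx => hx)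
    convert this using 1
    ext x; simpa using fun h : x = 0 => h.le
  have h2 : IsConvexFace (Set.Ici (0 : ℝ)) {0} := by
    have := isConvexFace_of_le (convex_Ici (0 : ℝ)) (-LinearMap.id) 0 (fun x hx => by simpa using hx)
    convert this using 1
    ext x; simpa using fun h : x = 0 => h.ge
  have e1 : Set.Iic (0 : ℝ) ∩ Set.Ici 0 = {0} := by rw [Set.inter_comm, Set.Ici_inter_Iic, Set.Icc_self]
  have e2 : Set.Ici (0 : ℝ) ∩ Set.Iic 0 = {0} := by rw [Set.Ici_inter_Iic, Set.Icc_self]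
  have e3 : Set.Iic (0 : ℝ) ∩ {0} = {0} := by simp
  have e4 : Set.Ici (0 : ℝ) ∩ {0} = {0} := by simp
  have e5 : {0} ∩ Set.Iic (0 : ℝ) = {0} := by simp
  have e6 : {0} ∩ Set.Ici (0 : ℝ) = {0} := by simp
  have r := IsConvexFace.refl (isConvexPolyhedron_of_mem_signSets hJ).convex
  rcases hJ with rfl | rfl | rfl <;> rcases hK with rfl | rfl | rfl <;>
    simp only [e1, e2, e3, e4, e5, e6, Set.inter_self] <;>
    first
    | exact ⟨by simp [signSets], r⟩
    | exact ⟨by simp [signSets], h1⟩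
    | exact ⟨by simp [signSets], h2⟩

/-- The faces of the pieces into which a polyhedron is cut by a hyperplane. -/
theorem exists_face_of_inter_signSets {E : Type*} [AddCommGroup E] [Module ℝ E] {P : Set E}
    (hP : IsConvexPolyhedron P) (h : E →ᵃ[ℝ] ℝ) {J : Set ℝ} (hJ : J ∈ signSets) {G : Set E}
    (hG : IsConvexFace (P ∩ h ⁻¹' J) G) (hne : G.Nonempty) :
    ∃ G', IsConvexFace P G' ∧ ∃ K ∈ signSets, G = G' ∩ h ⁻¹' K := by
  have hIic : ∀ {P : Set E}, IsConvexPolyhedron P → ∀ {G : Set E},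
      IsConvexFace (P ∩ h ⁻¹' Set.Iic 0) G → G.Nonempty →
      ∃ G', IsConvexFace P G' ∧ (G = G' ∩ h ⁻¹' Set.Iic 0 ∨ G = G' ∩ h ⁻¹' {0}) :=
    fun hP _ hG hne => hG.exists_of_inter_Iic hP h hne
  have e1 : h ⁻¹' Set.Ici 0 = (-h) ⁻¹' Set.Iic 0 := by ext x; simp
  have e2 : (-h) ⁻¹' {0} = h ⁻¹' {0} := by ext x; simp
  have hIci : ∀ {P : Set E}, IsConvexPolyhedron P → ∀ {G : Set E},
      IsConvexFace (P ∩ h ⁻¹' Set.Ici 0) G → G.Nonempty →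
      ∃ G', IsConvexFace P G' ∧ (G = G' ∩ h ⁻¹' Set.Ici 0 ∨ G = G' ∩ h ⁻¹' {0}) := by
    intro P hP G hG hne
    rw [e1] at hG
    obtain ⟨G', h1, h2⟩ := hG.exists_of_inter_Iic hP (-h) hne
    exact ⟨G', h1, by rwa [e1, ← e2]⟩
  rcases hJ with rfl | rfl | rfl
  · obtain ⟨G', h1, h2 | h2⟩ := hIic hP hG hne
    exacts [⟨G', h1, _, by simp [signSets], h2⟩, ⟨G', h1, _, by simp [signSets], h2⟩]
  · obtain ⟨G', h1, h2 | h2⟩ := hIci hP hG hne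
    exacts [⟨G', h1, _, by simp [signSets], h2⟩, ⟨G', h1, _, by simp [signSets], h2⟩]
  -- The hyperplane section is cut out by two half-spaces, so the half-space case is used twice.
  · have e3 : h ⁻¹' {0} = h ⁻¹' Set.Ici 0 ∩ h ⁻¹' Set.Iic 0 := by
      rw [← Set.preimage_inter, Set.Ici_inter_Iic, Set.Icc_self]
    rw [e3, ← Set.inter_assoc] at hG
    obtain ⟨G₁, h1, h2⟩ := hIic (hP.inter ((isConvexPolyhedron_Ici 0).preimage h)) hG hne
    have hne' : G₁.Nonempty := hne.mono (by
      rcases h2 with rfl | rfl <;> exact Set.inter_subset_left)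
    obtain ⟨G₂, h3, h4⟩ := hIci hP h1 hne'
    refine ⟨G₂, h3, {0}, by simp [signSets], ?_⟩
    rcases h2 with rfl | rfl <;> rcases h4 with rfl | rfl <;> ext x <;>
      simp only [Set.mem_inter_iff, Set.mem_preimage, Set.mem_Iic, Set.mem_Ici,
        Set.mem_singleton_iff] <;> grind

theorem φ_image_inter (P : PolyhedralStructure X) (σ : P.cells) {h : X → ℝ}
    {A : Module.Dual ℝ (P.M σ) →ᵃ[ℝ] ℝ} (hA : ∀ x : (σ : Set X), h x = A (P.φ σ x)) (s : Set X)
    (J : Set ℝ) : P.φ σ '' {x | (x : X) ∈ s ∩ h ⁻¹' J} =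
      P.φ σ '' {x | (x : X) ∈ s} ∩ A ⁻¹' J := by
  ext z
  constructor
  · rintro ⟨x, ⟨hx, hx'⟩, rfl⟩
    exact ⟨⟨x, hx, rfl⟩, by rw [Set.mem_preimage, ← hA]; exact hx'⟩
  · rintro ⟨⟨x, hx, rfl⟩, hx'⟩
    exact ⟨x, ⟨hx, by rw [Set.mem_preimage, hA]; exact hx'⟩, rfl⟩

theorem φ_image_self (P : PolyhedralStructure X) (σ : P.cells) :
    P.φ σ '' {x | (x : X) ∈ (σ : Set X)} = Set.range (P.φ σ) := by
  rw [← Set.image_univ]; congr 1; ext x; simp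

/-- The subdivision of a polyhedral structure by the zero set of a function which is affine on every
polyhedron. -/
noncomputable def cut (P : PolyhedralStructure X) (h : X → ℝ) (hh : ∀ σ, P.AffineOn σ h) :
    PolyhedralStructure X :=
  P.subdivide {t | ∃ σ ∈ P.cells, ∃ J ∈ signSets, t = σ ∩ h ⁻¹' J}
    (by
      rintro _ ⟨σ, hσ, J, hJ, rfl⟩
      refine (hh ⟨σ, hσ⟩).continuousOn.preimage_isClosed_of_isClosed (P.isClosed ⟨σ, hσ⟩)
        (isConvexPolyhedron_of_mem_signSets hJ).isClosed)
    (by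
      refine Set.eq_univ_of_forall fun x => ?_
      obtain ⟨σ, hσ, hx⟩ := Set.mem_sUnion.1 (P.sUnion_cells ▸ Set.mem_univ x)
      rcases le_total (h x) 0 with h0 | h0
      · exact ⟨_, ⟨σ, hσ, Set.Iic 0, by simp [signSets], rfl⟩, hx, h0⟩
      · exact ⟨_, ⟨σ, hσ, Set.Ici 0, by simp [signSets], rfl⟩, hx, h0⟩)
    (by
      intro x
      obtain ⟨W, hW, hfin⟩ := P.locallyFinite x
      have hfs : signSets.Finite := by simp [signSets]
      refine ⟨W, hW, Set.Finite.of_finite_image (f := Subtype.val) (Set.Finite.subset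
        ((hfin.prod hfs).image fun q : P.cells × Set ℝ => (q.1 : Set X) ∩ h ⁻¹' q.2) ?_)
        Subtype.val_injective.injOn⟩
      rintro _ ⟨⟨_, σ, hσ, J, hJ, rfl⟩, hne, rfl⟩
      exact ⟨⟨⟨σ, hσ⟩, J⟩, ⟨hne.mono (Set.inter_subset_inter_left _ Set.inter_subset_left), hJ⟩,
        rfl⟩)
    (by
      rintro _ ⟨σ, hσ, J, hJ, rfl⟩
      obtain ⟨A, hA⟩ := hh ⟨σ, hσ⟩
      refine ⟨⟨σ, hσ⟩, Set.inter_subset_left, ?_, ?_, ?_⟩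
      · rw [P.φ_image_inter _ hA, P.φ_image_self]
        exact (P.isConvexPolyhedron _).inter ((isConvexPolyhedron_of_mem_signSets hJ).preimage A)
      · intro u hu hf
        rcases u.eq_empty_or_nonempty with rfl | ⟨x₀, hx₀⟩
        · exact ⟨∅, P.empty_mem_cells ⟨σ, hσ⟩, J, hJ, by simp⟩
        rw [P.φ_image_inter _ hA, P.φ_image_self] at hf
        obtain ⟨G, hG, K, hK, hGK⟩ := exists_face_of_inter_signSets (P.isConvexPolyhedron _) A hJ
          hf ⟨_, ⟨x₀, (hu hx₀).1⟩, hx₀, rfl⟩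
        -- The old face whose intersection with a piece gives the new one, transported back to `X`.
        let ρ : Set X := Subtype.val '' (P.φ ⟨σ, hσ⟩ ⁻¹' G)
        have hρ : P.φ ⟨σ, hσ⟩ '' {x | (x : X) ∈ ρ} = G := by
          have : {x : σ | (x : X) ∈ ρ} = P.φ ⟨σ, hσ⟩ ⁻¹' G := by ext x; simp [ρ]
          rw [this]
          exact Set.image_preimage_eq_of_subset hG.2.subset
        refine ⟨ρ, (P.face_mem ⟨σ, hσ⟩ ρ ⟨?_, ?_⟩).1, K, hK, ?_⟩
        · rintro _ ⟨x, -, rfl⟩; exact x.2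
        · change IsConvexFace _ (P.φ ⟨σ, hσ⟩ '' {x | (x : X) ∈ ρ})
          rw [hρ]; exact hG
        · rw [← hρ, ← P.φ_image_inter _ hA] at hGK
          have hset := (P.φ_injective ⟨σ, hσ⟩).image_injective hGK
          ext x
          constructor
          · intro hx
            have : (⟨x, (hu hx).1⟩ : σ) ∈ {x : σ | (x : X) ∈ u} := hx
            rwa [hset] at this
          · rintro ⟨⟨y, hy, rfl⟩, hx⟩
            have : y ∈ {x : σ | (x : X) ∈ ρ ∩ h ⁻¹' K} := ⟨⟨y, hy, rfl⟩, hx⟩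
            rwa [← hset] at this
      · rintro _ ⟨σ', hσ', K, hK, rfl⟩
        have : σ ∩ h ⁻¹' J ∩ (σ' ∩ h ⁻¹' K) = (σ ∩ σ') ∩ h ⁻¹' (J ∩ K) := by
          ext x; simp; tauto
        rw [this, P.φ_image_inter _ hA, P.φ_image_inter _ hA, P.φ_image_self]
        exact (P.inter_face ⟨σ, hσ⟩ ⟨σ', hσ'⟩).1.2.inter_preimage
          (isConvexFace_inter_signSets hJ hK).2 A)

end PolyhedralStructure

namespace PolyhedralStructure

variable {X : Type*} [TopologicalSpace X]

theorem mem_cells_cut (P : PolyhedralStructure X) {h : X → ℝ} (hh : ∀ σ, P.AffineOn σ h)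
    {t : Set X} : t ∈ (P.cut h hh).cells ↔ ∃ σ ∈ P.cells, ∃ J ∈ signSets, t = σ ∩ h ⁻¹' J :=
  Iff.rfl

/-- The functions on a polyhedron of the subdivision `P.cut h hh` are restrictions. -/
theorem exists_linear_cut (P : PolyhedralStructure X) {h : X → ℝ} (hh : ∀ σ, P.AffineOn σ h)
    (t : (P.cut h hh).cells) (σ : P.cells) (ht : (t : Set X) ⊆ σ) :
    ∃ A : Module.Dual ℝ ((P.cut h hh).M t) →ₗ[ℝ] Module.Dual ℝ (P.M σ), Function.Injective A ∧
      ∀ x : (t : Set X), P.φ σ (Set.inclusion ht x) = A ((P.cut h hh).φ t x) := by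
  have key : ∀ M' : Submodule ℝ C((t : Set X), ℝ), M' = (P.M σ).map (restrictMap ht) →
      ∃ A : Module.Dual ℝ M' →ₗ[ℝ] Module.Dual ℝ (P.M σ), Function.Injective A ∧
      ∀ x : (t : Set X), P.φ σ (Set.inclusion ht x) = A (evalMap M' x) := by
    rintro _ rfl
    exact ⟨restrictDual _ ht, restrictDual_injective _ ht, fun x => rfl⟩
  exact key _ (P.restrictM_eq σ ht)

theorem isSubdivision_cut (P : PolyhedralStructure X) {h : X → ℝ} (hh : ∀ σ, P.AffineOn σ h) :
    (P.cut h hh).IsSubdivision P := by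
  rintro ⟨t, σ, hσ, J, hJ, rfl⟩
  obtain ⟨A, -, hA⟩ := P.exists_linear_cut hh ⟨_, σ, hσ, J, hJ, rfl⟩ ⟨σ, hσ⟩
    Set.inter_subset_left
  exact ⟨⟨σ, hσ⟩, Set.inter_subset_left, A.toAffineMap, hA⟩

/-- This keeps a cut structure in its equivalence class. The affine map is that of the given
subdivision, followed by a left inverse of the injection of dual spaces. -/
theorem IsSubdivision.cut {P P' : PolyhedralStructure X} (hs : P'.IsSubdivision P) {h : X → ℝ}
    (hh : ∀ σ, P.AffineOn σ h) (hh' : ∀ σ, P'.AffineOn σ h) :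
    (P'.cut h hh').IsSubdivision (P.cut h hh) := by
  rintro ⟨t, σ', hσ', J, hJ, rfl⟩
  obtain ⟨A', -, hA'⟩ := P'.exists_linear_cut hh' ⟨_, σ', hσ', J, hJ, rfl⟩ ⟨σ', hσ'⟩
    Set.inter_subset_left
  obtain ⟨σ, hsub, B, hB⟩ := hs ⟨σ', hσ'⟩
  obtain ⟨A, hAi, hA⟩ := P.exists_linear_cut hh ⟨_, σ, σ.2, J, hJ, rfl⟩ σ Set.inter_subset_left
  obtain ⟨L, hL⟩ := A.exists_leftInverse_of_injective (LinearMap.ker_eq_bot.2 hAi)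
  refine ⟨⟨_, σ, σ.2, J, hJ, rfl⟩, Set.inter_subset_inter_left _ hsub,
    L.toAffineMap.comp (B.comp A'.toAffineMap), fun x => ?_⟩
  simp only [AffineMap.comp_apply, LinearMap.coe_toAffineMap]
  rw [← hA', ← hB]
  have := hA (Set.inclusion (Set.inter_subset_inter_left _ hsub) x)
  have h2 := congrArg L this
  rw [← LinearMap.comp_apply, hL, LinearMap.id_apply] at h2
  exact h2.symm

/-- By local finiteness and closedness, some neighbourhood of `p` avoids every polyhedron that
misses `p`; thus the star of `p` is a neighbourhood of `p`. -/
theorem eventually_exists_mem_cell (P : PolyhedralStructure X) (p : X) :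
    ∀ᶠ y in nhds p, ∃ σ : P.cells, p ∈ (σ : Set X) ∧ y ∈ (σ : Set X) := by
  have := P.locallyFinite.eventually_subset P.isClosed p
  filter_upwards [this] with y hy
  obtain ⟨σ, hσ, hx⟩ := Set.mem_sUnion.1 (P.sUnion_cells ▸ Set.mem_univ y)
  exact ⟨⟨σ, hσ⟩, hy (show (⟨σ, hσ⟩ : P.cells) ∈ {i : P.cells | y ∈ (i : Set X)} from hx), hx⟩

/-- The polyhedra containing a point have a common face containing this point. -/
theorem exists_common_face (P : PolyhedralStructure X) (p : X) :
    ∃ τ : P.cells, p ∈ (τ : Set X) ∧ ∀ σ : P.cells, p ∈ (σ : Set X) → P.IsFace τ σ := by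
  have hne : {σ : P.cells | p ∈ (σ : Set X)}.Nonempty := by
    obtain ⟨σ, h, -⟩ := (P.eventually_exists_mem_cell p).self_of_nhds
    exact ⟨σ, h⟩
  -- A minimal polyhedron containing `p` equals its intersection with any other one, and this
  -- intersection is a face of both.
  obtain ⟨τ, hτ, hmin⟩ := Set.Finite.exists_minimalFor (fun σ : P.cells => (σ : Set X)) _
    (P.locallyFinite.point_finite p) hne
  refine ⟨τ, hτ, fun σ hσ => ?_⟩
  have h1 : (τ : Set X) ∩ σ = τ := Set.Subset.antisymm Set.inter_subset_left
    (hmin (j := ⟨_, P.inter_mem_cells τ σ⟩) ⟨hτ, hσ⟩ Set.inter_subset_left)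
  have := (P.inter_face τ σ).2
  rwa [h1] at this

end PolyhedralStructure

/-! ### Complexes compatible with `ι`: subdivision and images of polyhedra -/

namespace QuasiEmbeddedPolyhedralSpace

variable {X N : Type*} [TopologicalSpace X] [SecondCountableTopology X]

section

variable [AddCommGroup N] [Module ℝ N] [FiniteDimensional ℝ N]

/-- For membership in the class, a common subdivision of `P` and the reference structure is cut by
the same function; the result refines both the reference structure and the cut of `P`. -/
theorem IsComplex.cut {S : QuasiEmbeddedPolyhedralSpace X N} {P : PolyhedralStructure X}
    (hP : S.IsComplex P) (a : N →ᵃ[ℝ] ℝ) :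
    S.IsComplex (P.cut (a ∘ S.ι) fun σ => (hP.2 σ).1.comp a) := by
  refine ⟨?_, fun t => ⟨?_, ?_⟩⟩
  · have hP₀ := hP.1
    obtain ⟨P₀, hS⟩ := S.isClass
    rw [hS] at hP₀
    refine hS.symm.subset ?_
    obtain ⟨P', h1, h2⟩ := hP₀
    have hh' := fun σ => PolyhedralStructure.AffineOn.of_isSubdivision h2
      (fun σ => (hP.2 σ).1.comp a) σ
    exact ⟨P'.cut _ hh', (P'.isSubdivision_cut hh').trans h1, h2.cut _ hh'⟩
  · exact PolyhedralStructure.AffineOn.of_isSubdivision (P.isSubdivision_cut _)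
      (fun σ => (hP.2 σ).1) t
  · obtain ⟨t, σ, hσ, J, hJ, rfl⟩ := t
    exact (hP.2 ⟨σ, hσ⟩).2.mono Set.inter_subset_left

/-- A polyhedral complex can be subdivided so that the polyhedra containing a given point are cut
off by finitely many affine inequalities that are strict at this point. -/
theorem IsComplex.exists_subdivision {S : QuasiEmbeddedPolyhedralSpace X N}
    {P : PolyhedralStructure X} (hP : S.IsComplex P) (p : X) (l : List (N →ᵃ[ℝ] ℝ))
    (hl : ∀ a ∈ l, a (S.ι p) < 0) :
    ∃ P' : PolyhedralStructure X, S.IsComplex P' ∧ ∀ t, p ∈ t → (t ∈ P'.cells ↔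
      ∃ σ ∈ P.cells, t = σ ∩ {x | ∀ a ∈ l, a (S.ι x) ≤ 0}) := by
  induction l with
  | nil => exact ⟨P, hP, fun t ht => by simp⟩
  | cons a l ih =>
    obtain ⟨P', hP', h'⟩ := ih fun b hb => hl b (List.mem_cons_of_mem _ hb)
    have ha := hl a List.mem_cons_self
    refine ⟨_, hP'.cut a, fun t ht => ?_⟩
    rw [PolyhedralStructure.mem_cells_cut]
    have heq : ∀ σ : Set X, σ ∩ {x | ∀ b ∈ a :: l, b (S.ι x) ≤ 0} =
        (σ ∩ {x | ∀ b ∈ l, b (S.ι x) ≤ 0}) ∩ (a ∘ S.ι) ⁻¹' Set.Iic 0 := by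
      intro σ
      ext x
      simp only [List.forall_mem_cons, Set.mem_inter_iff, Set.mem_ofPred_eq, Set.mem_preimage,
        Function.comp_apply, Set.mem_Iic]
      tauto
    constructor
    · rintro ⟨σ', hσ', J, hJ, rfl⟩
      obtain ⟨σ, hσ, rfl⟩ := (h' σ' ht.1).1 hσ'
      have hpJ : a (S.ι p) ∈ J := ht.2
      -- Since `a` is negative at `ι p`, only this piece can contain its value.
      have : J = Set.Iic 0 := by
        rcases hJ with rfl | rfl | rfl
        · rfl
        · exact absurd hpJ (not_le.2 ha)
        · exact absurd hpJ ha.ne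
      exact ⟨σ, hσ, by rw [heq, this]⟩
    · rintro ⟨σ, hσ, rfl⟩
      rw [heq] at ht ⊢
      exact ⟨_, (h' _ ht.1).2 ⟨σ, hσ, rfl⟩, Set.Iic 0, by simp [PolyhedralStructure.signSets], rfl⟩

end

variable [NormedAddCommGroup N] [NormedSpace ℝ N] [FiniteDimensional ℝ N]

theorem IsComplex.image_eq {S : QuasiEmbeddedPolyhedralSpace X N} {P : PolyhedralStructure X}
    {σ : P.cells} {A : Module.Dual ℝ (P.M σ) →ᵃ[ℝ] N}
    (hA : ∀ x : (σ : Set X), S.ι x = A (P.φ σ x)) :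
    S.ι '' (σ : Set X) = A '' Set.range (P.φ σ) := by
  ext z; constructor
  · rintro ⟨x, hx, rfl⟩; exact ⟨_, ⟨⟨x, hx⟩, rfl⟩, (hA ⟨x, hx⟩).symm⟩
  · rintro ⟨_, ⟨x, rfl⟩, rfl⟩; exact ⟨x, x.2, hA x⟩

theorem IsComplex.injOn {S : QuasiEmbeddedPolyhedralSpace X N} {P : PolyhedralStructure X}
    (hP : S.IsComplex P) {σ : P.cells} {A : Module.Dual ℝ (P.M σ) →ᵃ[ℝ] N}
    (hA : ∀ x : (σ : Set X), S.ι x = A (P.φ σ x)) : Set.InjOn A (Set.range (P.φ σ)) := by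
  rintro _ ⟨x, rfl⟩ _ ⟨y, rfl⟩ h
  rw [← hA, ← hA] at h
  rw [Subtype.ext ((hP.2 σ).2 x.2 y.2 h)]

theorem IsComplex.isConvexPolyhedron_image {S : QuasiEmbeddedPolyhedralSpace X N}
    {P : PolyhedralStructure X} (hP : S.IsComplex P) (σ : P.cells) :
    IsConvexPolyhedron (S.ι '' (σ : Set X)) := by
  obtain ⟨A, hA⟩ := (hP.2 σ).1
  rw [image_eq hA]
  exact (P.isConvexPolyhedron σ).image A (hP.injOn hA)

/-- Every face of the image of a polyhedron is the image of a face. -/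
theorem IsComplex.exists_isFace {S : QuasiEmbeddedPolyhedralSpace X N}
    {P : PolyhedralStructure X} (hP : S.IsComplex P) (σ : P.cells) {G : Set N}
    (hG : IsConvexFace (S.ι '' (σ : Set X)) G) :
    ∃ τ : P.cells, P.IsFace τ σ ∧ S.ι '' (τ : Set X) = G := by
  obtain ⟨A, hA⟩ := (hP.2 σ).1
  have hsub : (σ : Set X) ∩ S.ι ⁻¹' G ⊆ σ := Set.inter_subset_left
  have himg : S.ι '' ((σ : Set X) ∩ S.ι ⁻¹' G) = G := by
    rw [Set.image_inter_preimage, Set.inter_eq_right.2 hG.2.subset]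
  have himg' : A '' (P.φ σ '' {x | (x : X) ∈ (σ : Set X) ∩ S.ι ⁻¹' G}) = G := by
    conv_rhs => rw [← himg]
    ext z
    constructor
    · rintro ⟨_, ⟨x, hx, rfl⟩, rfl⟩
      exact ⟨x, hx, hA x⟩
    · rintro ⟨x, hx, rfl⟩
      exact ⟨_, ⟨⟨x, hx.1⟩, hx, rfl⟩, (hA ⟨x, hx.1⟩).symm⟩
  have hface : IsFaceVia (P.M σ) ((σ : Set X) ∩ S.ι ⁻¹' G) := by
    refine ⟨hsub, IsConvexFace.of_image A (P.isConvexPolyhedron σ).convex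
      (Set.image_subset_range _ _) (hP.injOn hA) ?_⟩
    change IsConvexFace (A '' Set.range (P.φ σ)) (A '' (P.φ σ '' _))
    rw [himg', ← image_eq hA]
    exact hG
  exact ⟨⟨_, (P.face_mem σ _ hface).1⟩, hface, himg⟩

/-- The map `ι` is an embedding on every polyhedron. -/
theorem IsComplex.isInducing {S : QuasiEmbeddedPolyhedralSpace X N}
    {P : PolyhedralStructure X} (hP : S.IsComplex P) (σ : P.cells) :
    Topology.IsInducing ((σ : Set X).domRestrict S.ι) := by
  obtain ⟨A, hA⟩ := (hP.2 σ).1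
  obtain ⟨L, hL⟩ := exists_affine_leftInverse (P.isConvexPolyhedron σ).convex A (hP.injOn hA)
  -- Followed by the left inverse `L`, the map `ι` becomes the evaluation embedding, so it cannot
  -- induce a coarser topology.
  refine Topology.IsInducing.of_comp
    (continuousOn_iff_continuous_domRestrict.1 (hP.2 σ).1.continuousOn)
    (g := fun z (g : P.M σ) => L z g) (continuous_pi fun g => ?_) ?_
  · exact (((LinearMap.applyₗ g : Module.Dual ℝ (P.M σ) →ₗ[ℝ] ℝ).toAffineMap).comp
      L).continuous_of_finiteDimensional
  · convert (P.isEmbedding_eval σ).isInducing using 1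
    funext x g
    simp only [Function.comp_apply, Set.domRestrict_apply]
    rw [hA, show L (A (P.φ σ x)) = P.φ σ x from hL _ ⟨x, rfl⟩]
    rfl

end QuasiEmbeddedPolyhedralSpace

/-! ### Tangent cones of polyhedra -/

section TangentCone

variable {E : Type*} [AddCommGroup E] [Module ℝ E]

/-- The cone of the directions in which one can move from `p` inside `K`. -/
def feasibleCone (K : Set E) (p : E) : Set E := {u | ∃ ε : ℝ, 0 < ε ∧ p + ε • u ∈ K}

theorem feasibleCone_mono {K L : Set E} (h : K ⊆ L) (p : E) :
    feasibleCone K p ⊆ feasibleCone L p := fun _ ⟨ε, hε, hu⟩ => ⟨ε, hε, h hu⟩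

theorem sub_mem_feasibleCone {K : Set E} {x : E} (p : E) (hx : x ∈ K) :
    x - p ∈ feasibleCone K p := ⟨1, one_pos, by simpa using hx⟩

theorem mem_vectorSpan_of_mem_feasibleCone {K : Set E} {p u : E} (hp : p ∈ K)
    (hu : u ∈ feasibleCone K p) : u ∈ vectorSpan ℝ K := by
  obtain ⟨ε, hε, hu⟩ := hu
  have := vsub_mem_vectorSpan ℝ hu hp
  rw [vsub_eq_sub, add_sub_cancel_left] at this
  exact (Submodule.smul_mem_iff _ hε.ne').1 this

theorem nonneg_of_mem_feasibleCone {K : Set E} {p u : E} {c : Module.Dual ℝ E}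
    (hc : ∀ x ∈ K, c p ≤ c x) (hu : u ∈ feasibleCone K p) : 0 ≤ c u := by
  obtain ⟨ε, hε, hu⟩ := hu
  have := hc _ hu
  rw [map_add, map_smul, smul_eq_mul, le_add_iff_nonneg_right] at this
  exact nonneg_of_mul_nonneg_right this hε

theorem feasibleCone_inter {K L : Set E} (hK : Convex ℝ K) (hL : Convex ℝ L) {p u : E}
    (hpK : p ∈ K) (hpL : p ∈ L) (h : u ∈ feasibleCone K p) (h' : u ∈ feasibleCone L p) :
    u ∈ feasibleCone (K ∩ L) p := by
  obtain ⟨ε, hε, hu⟩ := h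
  obtain ⟨ε', hε', hu'⟩ := h'
  have key : ∀ {M : Set E} {η : ℝ}, Convex ℝ M → p ∈ M → 0 < η → p + η • u ∈ M →
      min ε ε' ≤ η → p + min ε ε' • u ∈ M := by
    intro M η hM hp hη hu hle
    have := hM.add_smul_mem hp hu (t := min ε ε' / η)
      ⟨by positivity, (div_le_one hη).2 hle⟩
    rwa [smul_smul, div_mul_cancel₀ _ hη.ne'] at this
  exact ⟨min ε ε', lt_min hε hε', key hK hpK hε hu (min_le_left _ _),
    key hL hpL hε' hu' (min_le_right _ _)⟩

/-- A ray that leaves the tangent cone of a polyhedron does so through a face. -/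
theorem IsConvexPolyhedron.exists_exit_face {K : Set E} (hK : IsConvexPolyhedron K) {p q d : E}
    (hp : p ∈ K) (hq : q ∈ feasibleCone K p) {s : ℝ} (hs : 0 < s)
    (hsd : q + s • d ∉ feasibleCone K p) :
    ∃ (t : ℝ) (c : Module.Dual ℝ E), (∀ x ∈ K, c x ≤ c p) ∧ 0 < c d ∧
      q + t • d ∈ feasibleCone {x ∈ K | c x = c p} p := by
  obtain ⟨m, a, b, rfl⟩ := hK
  -- Only the inequalities active at `p` cut out the tangent cone.
  have hcone : ∀ u, u ∈ feasibleCone {x | ∀ i, a i x ≤ b i} p ↔ ∀ i, a i p = b i → a i u ≤ 0 := by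
    intro u
    refine ⟨?_, fun h => ?_⟩
    · rintro ⟨ε, hε, hu⟩ i hi
      have := hu i
      rw [map_add, map_smul, hi, smul_eq_mul, add_le_iff_nonpos_right] at this
      exact nonpos_of_mul_nonpos_right this hε
    · obtain ⟨t, ht, hu⟩ := exists_step hp h
      exact ⟨t, ht, hu⟩
  rw [hcone] at hq hsd
  push Not at hsd
  obtain ⟨j, hj, hjd⟩ := hsd
  rw [map_add, map_smul, smul_eq_mul] at hjd
  have hjq := hq j hj
  have hne : {i | a i p = b i ∧ 0 < a i d}.Nonempty :=
    ⟨j, hj, pos_of_mul_pos_right (show 0 < s * a j d by linarith) hs.le⟩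
  -- Among the active inequalities that bound the ray, `i` is one that is reached first.
  obtain ⟨i, ⟨hi, hid⟩, hmin⟩ := Set.exists_min_image _ (fun i => -(a i q) / a i d)
    (Set.toFinite _) hne
  refine ⟨-(a i q) / a i d, a i, fun x hx => hi ▸ hx i, hid, ?_⟩
  have h0 : a i (q + (-(a i q) / a i d) • d) = 0 := by
    rw [map_add, map_smul, smul_eq_mul, div_mul_cancel₀ _ hid.ne', add_neg_cancel]
  have hnn : 0 ≤ -(a i q) / a i d := div_nonneg (by linarith [hq i hi]) hid.le
  have hmem : q + (-(a i q) / a i d) • d ∈ feasibleCone {x | ∀ i, a i x ≤ b i} p := by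
    rw [hcone]
    intro k hk
    rw [map_add, map_smul, smul_eq_mul]
    rcases le_or_gt (a k d) 0 with h | h
    · have := hq k hk
      nlinarith
    · have := mul_le_mul_of_nonneg_right (hmin k ⟨hk, h⟩) h.le
      rw [div_mul_cancel₀ _ h.ne'] at this
      linarith
  obtain ⟨ε, hε, hx⟩ := hmem
  exact ⟨ε, hε, hx, by rw [map_add, map_smul, h0, smul_zero, add_zero]⟩

/-- A convex set is not contained in a finite union of affine subspaces unless its affine span is
contained in one of them. -/
theorem exists_mem_forall_sub_notMem {K : Set E} (hK : Convex ℝ K) (hne : K.Nonempty) (p : E)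
    {κ : Type*} [Finite κ] (Z : κ → Submodule ℝ E) (hZ : ∀ j, ¬ vectorSpan ℝ K ≤ Z j) :
    ∃ x ∈ K, ∀ j, x - p ∉ Z j := by
  -- A real vector space is not a finite union of proper subspaces. On a segment in such a direction
  -- `u`, each `Z j` excludes at most one point.
  obtain ⟨u, hu, huZ⟩ : ∃ u ∈ vectorSpan ℝ K, ∀ j, u ∉ Z j := by
    by_contra! hcon
    obtain ⟨j, hj⟩ := Subspace.exists_eq_top_of_iUnion_eq_univ
      (p := fun j => (Z j).comap (vectorSpan ℝ K).subtype)
      (Set.eq_univ_of_forall fun u => by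
        obtain ⟨j, hj⟩ := hcon u u.2
        exact Set.mem_iUnion.2 ⟨j, hj⟩)
    exact hZ j fun u hu => by
      have : (⟨u, hu⟩ : vectorSpan ℝ K) ∈ (Z j).comap (vectorSpan ℝ K).subtype := hj ▸ trivial
      exact this
  obtain ⟨x, hx, y, hy, c, hc, rfl⟩ := exists_smul_sub_of_mem_vectorSpan hK hne hu
  have hfin : (⋃ j, {t : ℝ | y + t • (x - y) - p ∈ Z j}).Finite := by
    refine Set.finite_iUnion fun j => Set.Subsingleton.finite fun t ht t' ht' => ?_
    by_contra hne
    have h1 := (Z j).sub_mem ht ht'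
    rw [show y + t • (x - y) - p - (y + t' • (x - y) - p) = (t - t') • (x - y) by
      rw [sub_smul]; abel, Submodule.smul_mem_iff _ (sub_ne_zero.2 hne)] at h1
    exact huZ j ((Z j).smul_mem c h1)
  obtain ⟨t, ht, htZ⟩ := ((Set.Icc_infinite (zero_lt_one' ℝ)).sdiff hfin).nonempty
  refine ⟨y + t • (x - y), hK.add_smul_sub_mem hy hx ht, fun j hj => htZ (Set.mem_iUnion.2 ⟨j, hj⟩)⟩

end TangentCone

/-! ### Jacobians of linear maps via Gram determinants -/

section Gram

variable {E : Type*} [NormedAddCommGroup E] [InnerProductSpace ℝ E] [FiniteDimensional ℝ E]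

/-- Decomposition of a vector with respect to a hyperplane and a unit normal vector. -/
theorem sub_inner_smul_mem {W' W : Submodule ℝ E} {m : ℕ} (hle : W' ≤ W)
    (hW' : Module.finrank ℝ W' = m) (hW : Module.finrank ℝ W = m + 1) {v : E} (hv : v ∈ W)
    (hvW' : v ∈ W'ᗮ) (hv1 : ‖v‖ = 1) {d : E} (hd : d ∈ W) : d - inner ℝ v d • v ∈ W' := by
  have hvne : v ≠ 0 := fun h => by simp [h] at hv1
  have hsup : W' ⊔ Submodule.span ℝ {v} = W := by
    refine Submodule.eq_of_le_of_finrank_eq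
      (sup_le hle (by simpa [Submodule.span_singleton_le_iff_mem] using hv)) ?_
    have h1 := Submodule.finrank_sup_add_finrank_inf_eq W' (Submodule.span ℝ {v})
    have h2 : W' ⊓ Submodule.span ℝ {v} = ⊥ := by
      rw [← disjoint_iff]
      refine (Submodule.disjoint_span_singleton' hvne).2 fun h => hvne ?_
      exact inner_self_eq_zero.1 ((Submodule.mem_orthogonal _ _).1 hvW' v h)
    rw [h2, finrank_bot, finrank_span_singleton hvne] at h1
    omega
  rw [← hsup] at hd
  obtain ⟨d', hd', e, he, rfl⟩ := Submodule.mem_sup.1 hd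
  obtain ⟨c, rfl⟩ := Submodule.mem_span_singleton.1 he
  have h0 : inner ℝ v d' = 0 := (Submodule.mem_orthogonal' _ _).1 hvW' d' hd'
  rw [inner_add_right, h0, inner_smul_right, real_inner_self_eq_norm_sq, hv1]
  simpa using hd'

/-- The map given by the inner products with finitely many vectors. -/
noncomputable def innerMap {m : ℕ} (a : Fin m → E) : E →ₗ[ℝ] (Fin m → ℝ) :=
  LinearMap.pi fun i => (innerₛₗ ℝ (a i) : E →ₗ[ℝ] ℝ)

omit [FiniteDimensional ℝ E] in
theorem innerMap_apply {m : ℕ} (a : Fin m → E) (x : E) (i : Fin m) :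
    innerMap a x i = inner ℝ (a i) x := rfl

open Matrix in
/-- The volume distortion of the orthogonal projections onto the kernels of given functionals in a
subspace is the product of the distortion on a hyperplane with the length of a vector of the kernel
with unit normal component. -/
theorem exists_weight_mul_norm {m : ℕ} (a : Fin m → E) (W' : Submodule ℝ E)
    (hW' : Module.finrank ℝ W' = m) (hinj : ∀ d ∈ W', innerMap a d = 0 → d = 0) :
    ∃ μ : ℝ, 0 < μ ∧ ∀ (W : Submodule ℝ E) (v w : E), W' ≤ W → Module.finrank ℝ W = m + 1 →
      v ∈ W → v ∈ W'ᗮ → ‖v‖ = 1 → w - v ∈ W' → innerMap a w = 0 →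
      μ * ‖w‖ = √(Matrix.det (Matrix.of fun i j => inner ℝ (a i) (W.starProjection (a j)))) := by
  let e : OrthonormalBasis (Fin m) ℝ W' := (stdOrthonormalBasis ℝ W').reindex (finCongr hW')
  -- The matrix of `innerMap a` on `W'` in an orthonormal basis; its absolute determinant is the
  -- Jacobian there, and is the weight `μ`.
  let B : Matrix (Fin m) (Fin m) ℝ := Matrix.of fun i j => inner ℝ (a i) (e j : E)
  have hexp : ∀ t ∈ W', t = ∑ k, inner ℝ (e k : E) t • (e k : E) := by
    intro t ht
    have := congrArg Subtype.val (e.sum_repr' ⟨t, ht⟩)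
    simpa using this.symm
  have hB : B.det ≠ 0 := by
    intro h
    obtain ⟨l, hl, hl0⟩ := Matrix.exists_mulVec_eq_zero_iff.2 h
    refine hl ?_
    have h1 : ∑ k, l k • (e k : E) = 0 := by
      refine hinj _ (Submodule.sum_mem _ fun k _ => Submodule.smul_mem _ _ (e k).2) ?_
      ext i
      have := congrFun hl0 i
      simp only [Matrix.mulVec, dotProduct, B, Matrix.of_apply, Pi.zero_apply] at this
      rw [innerMap_apply, inner_sum, Pi.zero_apply, ← this]
      exact Finset.sum_congr rfl fun k _ => by rw [inner_smul_right, mul_comm]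
    have h2 : ∑ k, l k • e k = 0 := Subtype.ext (by simpa using h1)
    funext k
    exact Fintype.linearIndependent_iff.1 e.orthonormal.linearIndependent l h2 k
  refine ⟨|B.det|, abs_pos.2 hB, fun W v w hle hW hv hvW' hv1 hwv hw => ?_⟩
  set l : Fin m → ℝ := fun k => inner ℝ (e k : E) (w - v) with hl
  have hve : ∀ k, inner ℝ v (e k : E) = 0 := fun k =>
    (Submodule.mem_orthogonal' _ _).1 hvW' _ (e k).2
  have hproj : ∀ y, W.starProjection y = ∑ k, inner ℝ (e k : E) y • (e k : E) + inner ℝ v y • v := by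
    intro y
    refine (Submodule.eq_starProjection_of_mem_of_inner_eq_zero (W.add_mem (W.sum_mem fun k _ =>
      W.smul_mem _ (hle (e k).2)) (W.smul_mem _ hv)) fun d hd => ?_)
    have hd' := sub_inner_smul_mem hle hW' hW hv hvW' hv1 hd
    have hde := hexp _ hd'
    have hort : ∀ j k, inner ℝ (e j : E) (e k : E) = if j = k then (1 : ℝ) else 0 := fun j k => by
      have := orthonormal_iff_ite.1 e.orthonormal j k
      simpa using this
    have hev : ∀ k, inner ℝ (e k : E) v = 0 := fun k => by rw [real_inner_comm, hve]
    have h3 : ∀ k, inner ℝ (y - (∑ k, inner ℝ (e k : E) y • (e k : E) + inner ℝ v y • v))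
        (e k : E) = 0 := by
      intro k
      simp only [inner_sub_left, inner_add_left, sum_inner, inner_smul_left, hort, hve,
        conj_trivial, mul_ite, mul_one, mul_zero, Finset.sum_ite_eq', Finset.mem_univ, if_true]
      rw [real_inner_comm]; ring
    have h4 : inner ℝ (y - (∑ k, inner ℝ (e k : E) y • (e k : E) + inner ℝ v y • v)) v = 0 := by
      simp only [inner_sub_left, inner_add_left, sum_inner, inner_smul_left, hev,
        conj_trivial, mul_zero, Finset.sum_const_zero, real_inner_self_eq_norm_sq, hv1]
      rw [real_inner_comm]; ring
    have h5 : d = (d - inner ℝ v d • v) + inner ℝ v d • v := by abel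
    rw [h5, inner_add_right, inner_smul_right, h4, hde, inner_sum]
    simp only [inner_smul_right, h3, mul_zero, Finset.sum_const_zero, add_zero]
  have hc : ∀ i, inner ℝ (a i) v = - ∑ k, B i k * l k := by
    intro i
    have h1 : inner ℝ (a i) w = 0 := congrFun hw i
    have h2 : w = v + ∑ k, l k • (e k : E) := by rw [← hexp _ hwv]; abel
    rw [h2, inner_add_right, inner_sum] at h1
    rw [eq_neg_iff_add_eq_zero, ← h1]
    congr 1
    exact Finset.sum_congr rfl fun k _ => by rw [inner_smul_right, mul_comm]; rfl
  -- In the orthonormal basis `e, v` of `W` the map has the matrix `(B | -B l)`, because it kills `w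
  -- = v + ∑ l k • e k`. The Gram determinant is thus `(det B)² (1 + l ⬝ᵥ l) = (det B)² ‖w‖²`.
  have hG : (Matrix.of fun i j => inner ℝ (a i) (W.starProjection (a j))) =
      B * (1 + replicateCol Unit l * replicateRow Unit l) * Bᵀ := by
    ext i j
    rw [Matrix.of_apply, hproj, inner_add_right, inner_sum, inner_smul_right,
      real_inner_comm (a j) v, hc i, hc j, Matrix.mul_add, Matrix.mul_one, Matrix.add_mul,
      Matrix.add_apply]
    congr 1
    · rw [Matrix.mul_apply]
      refine Finset.sum_congr rfl fun k _ => ?_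
      rw [inner_smul_right, mul_comm, real_inner_comm (a j) (e k : E)]; rfl
    · rw [← Matrix.mul_assoc, Matrix.mul_assoc, Matrix.mul_apply]
      simp only [Finset.univ_unique, Finset.sum_singleton, Matrix.mul_apply,
        Matrix.replicateCol_apply, Matrix.replicateRow_apply, Matrix.transpose_apply]
      simp only [mul_comm (l _)]
      ring
  have hnorm : ‖w‖ ^ 2 = 1 + l ⬝ᵥ l := by
    have h2 : w = v + ∑ k, l k • (e k : E) := by rw [← hexp _ hwv]; abel
    have h3 : inner ℝ v (∑ k, l k • (e k : E)) = 0 := by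
      simp [inner_sum, inner_smul_right, hve]
    have h4 : inner ℝ (∑ k, l k • (e k : E)) (∑ k, l k • (e k : E)) = l ⬝ᵥ l := by
      have h5 : w - v = ∑ k, l k • (e k : E) := by rw [← hexp _ hwv]
      nth_rewrite 1 [← h5]
      rw [inner_sum]
      simp only [inner_smul_right, dotProduct]
      exact Finset.sum_congr rfl fun k _ => by rw [real_inner_comm]
    rw [← real_inner_self_eq_norm_sq, h2, inner_add_left, inner_add_right, inner_add_right, h3,
      real_inner_comm v (∑ k, l k • (e k : E)), h3, h4, real_inner_self_eq_norm_sq, hv1]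
    ring
  rw [hG, Matrix.det_mul, Matrix.det_mul, Matrix.det_transpose,
    Matrix.det_one_add_replicateCol_mul_replicateRow, ← hnorm,
    show B.det * ‖w‖ ^ 2 * B.det = (B.det * ‖w‖) ^ 2 by ring, Real.sqrt_sq_eq_abs, abs_mul,
    abs_norm]

end Gram

/-! ### Balanced stars -/

section BalancedStar

variable {E J : Type*} [NormedAddCommGroup E] [InnerProductSpace ℝ E] [FiniteDimensional ℝ E]
  [Fintype J]

open Classical in
/-- The polyhedra of a complex which contain a given point `p`, with positive weights on the
polyhedra of dimension `m + 1` that are balanced along the polyhedra of dimension `m`. -/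
structure BalancedStar (E J : Type*) [NormedAddCommGroup E] [InnerProductSpace ℝ E]
    [FiniteDimensional ℝ E] [Fintype J] (m : ℕ) where
  /-- the polyhedra -/
  K : J → Set E
  /-- the common point of the polyhedra -/
  p : E
  /-- the face relation -/
  Face : J → J → Prop
  /-- the weights -/
  b : J → ℝ
  /-- the unit normal vectors -/
  v : J → J → E
  polyhedron : ∀ j, IsConvexPolyhedron (K j)
  mem : ∀ j, p ∈ K j
  convexFace : ∀ {j k}, Face j k → IsConvexFace (K k) (K j)
  face_inj : ∀ {j j' k}, Face j k → Face j' k → K j = K j' → j = j'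
  exists_face : ∀ k G, IsConvexFace (K k) G → p ∈ G → ∃ j, Face j k ∧ K j = G
  b_pos : ∀ k, 0 < b k
  norm_v : ∀ {j k}, Face j k → Module.finrank ℝ (vectorSpan ℝ (K j)) = m →
    Module.finrank ℝ (vectorSpan ℝ (K k)) = m + 1 → ‖v j k‖ = 1
  v_mem_orthogonal : ∀ {j k}, Face j k → Module.finrank ℝ (vectorSpan ℝ (K j)) = m →
    Module.finrank ℝ (vectorSpan ℝ (K k)) = m + 1 → v j k ∈ (vectorSpan ℝ (K j))ᗮ
  v_mem : ∀ {j k}, Face j k → Module.finrank ℝ (vectorSpan ℝ (K j)) = m →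
    Module.finrank ℝ (vectorSpan ℝ (K k)) = m + 1 → v j k ∈ vectorSpan ℝ (K k)
  v_nonneg : ∀ {j k}, Face j k → Module.finrank ℝ (vectorSpan ℝ (K j)) = m →
    Module.finrank ℝ (vectorSpan ℝ (K k)) = m + 1 → ∀ x ∈ K k, 0 ≤ inner ℝ (v j k) (x - p)
  balanced : ∀ j, Module.finrank ℝ (vectorSpan ℝ (K j)) = m →
    ∑ k with Face j k ∧ Module.finrank ℝ (vectorSpan ℝ (K k)) = m + 1, b k • v j k = 0

namespace BalancedStar

variable {m : ℕ} (B : BalancedStar E J m)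

/-- The direction of a polyhedron of the star. -/
def dir (j : J) : Submodule ℝ E := vectorSpan ℝ (B.K j)

/-- The tangent cone of a polyhedron of the star. -/
def cone (j : J) : Set E := feasibleCone (B.K j) B.p

/-- The value `y` of the map with components `a` is attained transversally on all polyhedra. -/
def Generic (a : Fin m → E) (y : Fin m → ℝ) : Prop :=
  ∀ j, y ∈ (B.dir j).map (innerMap a) → (B.dir j).map (innerMap a) = ⊤

/-- The fibre over `y` meets the tangent cone of the `m`-dimensional polyhedron `j`. -/
def Meets (a : Fin m → E) (y : Fin m → ℝ) (j : J) : Prop :=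
  Module.finrank ℝ (B.dir j) = m ∧ ∃ u ∈ B.cone j, innerMap a u = y

/-- The fibre over `y` meets the facet `j` of the full-dimensional polyhedron `k`. -/
def Crosses (a : Fin m → E) (y : Fin m → ℝ) (j k : J) : Prop :=
  B.Meets a y j ∧ B.Face j k ∧ Module.finrank ℝ (B.dir k) = m + 1

variable {B} {a : Fin m → E} {y : Fin m → ℝ}

theorem cone_subset_dir (j : J) : B.cone j ⊆ B.dir j := fun _ hu =>
  mem_vectorSpan_of_mem_feasibleCone (B.mem j) hu

theorem dir_le {j k : J} (h : B.Face j k) : B.dir j ≤ B.dir k :=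
  vectorSpan_mono ℝ (B.convexFace h).2.subset

theorem cone_subset {j k : J} (h : B.Face j k) : B.cone j ⊆ B.cone k :=
  feasibleCone_mono (B.convexFace h).2.subset _

/-- A generic fibre misses the cones of dimension less than `m`, since these cannot map onto `ℝ^m`.
-/
theorem Generic.le_finrank (hy : B.Generic a y) {j : J} {u : E} (hu : u ∈ B.dir j)
    (huy : innerMap a u = y) : m ≤ Module.finrank ℝ (B.dir j) := by
  have := hy j ⟨u, hu, huy⟩
  have h2 := Submodule.finrank_map_le (innerMap a) (B.dir j)
  rw [this, finrank_top, Module.finrank_fin_fun] at h2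
  exact h2

theorem Meets.map_eq_top (hy : B.Generic a y) {j : J} (hj : B.Meets a y j) :
    (B.dir j).map (innerMap a) = ⊤ := by
  obtain ⟨-, u, hu, huy⟩ := hj
  exact hy j ⟨u, cone_subset_dir j hu, huy⟩

/-- In dimension `m` surjectivity is bijectivity, so the fibre meets the cone in a single point, a
vertex of the slice. -/
theorem Meets.injective (hy : B.Generic a y) {j : J} (hj : B.Meets a y j) {d : E}
    (hd : d ∈ B.dir j) (h0 : innerMap a d = 0) : d = 0 := by
  have h1 : Function.Surjective ((innerMap a).domRestrict (B.dir j)) := by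
    rw [← LinearMap.range_eq_top, LinearMap.range_domRestrict]
    exact hj.map_eq_top hy
  have h2 : Function.Injective ((innerMap a).domRestrict (B.dir j)) :=
    (LinearMap.injective_iff_surjective_of_finrank_eq_finrank (by
      rw [hj.1, Module.finrank_fin_fun])).2 h1
  have := @h2 ⟨d, hd⟩ 0 (by rw [map_zero]; exact h0)
  exact congrArg Subtype.val this

/-- The vector `w` is the direction in which the slice leaves the vertex `j` into `k`. Its
normalization by unit normal component, not unit length, lets it inherit the balancing condition
with the weights `b` unchanged. -/
theorem Crosses.exists_kernel_vector (hy : B.Generic a y) {j k : J} (h : B.Crosses a y j k) :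
    ∃ w, w - B.v j k ∈ B.dir j ∧ innerMap a w = 0 := by
  have : -innerMap a (B.v j k) ∈ (B.dir j).map (innerMap a) := by
    rw [h.1.map_eq_top hy]; trivial
  obtain ⟨t, ht, hta⟩ := this
  exact ⟨B.v j k + t, by simpa using ht, by rw [map_add, hta, add_neg_cancel]⟩

theorem Crosses.inner_v_nonneg {j k : J} (h : B.Crosses a y j k) {u : E} (hu : u ∈ B.cone k) :
    0 ≤ inner ℝ (B.v j k) u := by
  obtain ⟨ε, hε, hx⟩ := hu
  have := B.v_nonneg h.2.1 h.1.1 h.2.2 _ hx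
  rw [add_sub_cancel_left, inner_smul_right] at this
  exact nonneg_of_mul_nonneg_right this hε

theorem Crosses.inner_eq_zero {j k : J} (h : B.Crosses a y j k) {u : E} (hu : u ∈ B.dir j) :
    inner ℝ (B.v j k) u = 0 :=
  (Submodule.mem_orthogonal' _ _).1 (B.v_mem_orthogonal h.2.1 h.1.1 h.2.2) u hu

theorem Crosses.inner_v_self {j k : J} (h : B.Crosses a y j k) :
    inner ℝ (B.v j k) (B.v j k) = (1 : ℝ) := by
  rw [real_inner_self_eq_norm_sq, B.norm_v h.2.1 h.1.1 h.2.2, one_pow]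

theorem Crosses.inner_w {j k : J} (h : B.Crosses a y j k) {w : E}
    (hw : w - B.v j k ∈ B.dir j) : inner ℝ (B.v j k) w = (1 : ℝ) := by
  have h1 := h.inner_eq_zero hw
  rw [inner_sub_right, h.inner_v_self, sub_eq_zero] at h1
  exact h1

theorem Crosses.w_mem {j k : J} (h : B.Crosses a y j k) {w : E} (hw : w - B.v j k ∈ B.dir j) :
    w ∈ B.dir k := by
  rw [← sub_add_cancel w (B.v j k)]
  exact add_mem (dir_le h.2.1 hw) (B.v_mem h.2.1 h.1.1 h.2.2)

/-- The kernel in a full-dimensional polyhedron is spanned by `w`. -/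
theorem Crosses.eq_inner_smul (hy : B.Generic a y) {j k : J} (h : B.Crosses a y j k) {w d : E}
    (hw : w - B.v j k ∈ B.dir j) (hw0 : innerMap a w = 0) (hd : d ∈ B.dir k)
    (hd0 : innerMap a d = 0) : d = (inner ℝ (B.v j k) d : ℝ) • w := by
  have h1 := sub_inner_smul_mem (dir_le h.2.1) h.1.1 h.2.2 (B.v_mem h.2.1 h.1.1 h.2.2)
    (B.v_mem_orthogonal h.2.1 h.1.1 h.2.2) (B.norm_v h.2.1 h.1.1 h.2.2) hd
  have h2 := Submodule.sub_mem _ h1 (Submodule.smul_mem _ (inner ℝ (B.v j k) d) hw)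
  rw [smul_sub, sub_sub_sub_cancel_right] at h2
  exact sub_eq_zero.1 (h.1.injective hy h2 (by rw [map_sub, map_smul, hw0, hd0, smul_zero, sub_zero]))

/-- Two crossed facets of the same polyhedron with a common point of the fibre are equal. -/
theorem Crosses.eq_of_mem (hy : B.Generic a y) {j j' k : J} (h : B.Crosses a y j k)
    (h' : B.Crosses a y j' k) {u : E} (hu : u ∈ B.cone j) (hu' : u ∈ B.cone j')
    (huy : innerMap a u = y) : j = j' := by
  have hf := B.convexFace h.2.1
  have hf' := B.convexFace h'.2.1
  -- The common face contains a direction in the fibre, so it has dimension at least `m` by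
  -- genericity and exhausts both facets.
  obtain ⟨i, hi, hiK⟩ := B.exists_face k (B.K j ∩ B.K j')
    ⟨hf.1.inter hf'.1, hf.2.inter hf'.2⟩ ⟨B.mem j, B.mem j'⟩
  have hui : u ∈ B.cone i := by
    rw [cone, hiK]
    exact feasibleCone_inter hf.1 hf'.1 (B.mem j) (B.mem j') hu hu'
  have hfin := hy.le_finrank (cone_subset_dir i hui) huy
  have key : ∀ l, B.Crosses a y l k → B.K i ⊆ B.K l → B.K i = B.K l := by
    intro l hl hsub
    have hd : B.dir i = B.dir l := Submodule.eq_of_le_of_finrank_le (vectorSpan_mono ℝ hsub)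
      (by rw [hl.1.1]; exact hfin)
    refine Set.Subset.antisymm hsub fun x hx => (B.convexFace hi).mem_of_sub_mem (B.mem i)
      ((B.convexFace hl.2.1).2.subset hx) ?_
    change x - B.p ∈ B.dir i
    rw [hd]
    exact vsub_mem_vectorSpan ℝ hx (B.mem l)
  refine B.face_inj h.2.1 h'.2.1 ?_
  rw [← key j h (hiK ▸ Set.inter_subset_left), ← key j' h' (hiK ▸ Set.inter_subset_right)]

/-- The two end points of a segment of the fibre contribute opposite vectors. -/
theorem Crosses.exists_neg (hy : B.Generic a y) {j j' k : J} (h : B.Crosses a y j k)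
    (h' : B.Crosses a y j' k) (hne : j ≠ j') {w w' : E} (hw : w - B.v j k ∈ B.dir j)
    (hw0 : innerMap a w = 0) (hw' : w' - B.v j' k ∈ B.dir j') (hw0' : innerMap a w' = 0)
    {μ μ' : ℝ} (hμμ' : μ * ‖w‖ = μ' * ‖w'‖) :
    μ' • w' = -(μ • w) := by
  obtain ⟨q, hq, hqy⟩ := h.1.2
  obtain ⟨q', hq', hqy'⟩ := h'.1.2
  have hqk := cone_subset h.2.1 hq
  have hqk' := cone_subset h'.2.1 hq'
  -- The kernel in the direction of `k` is a line. So `q' - q` is a nonnegative multiple of `w` and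
  -- `q - q'` one of `w'`: the two vectors are opposite up to scale, and `hμμ'` fixes the scale.
  have h1 := h.eq_inner_smul hy hw hw0
    (sub_mem (cone_subset_dir k hqk') (cone_subset_dir k hqk)) (by rw [map_sub, hqy, hqy', sub_self])
  have h2 := h'.eq_inner_smul hy hw' hw0'
    (sub_mem (cone_subset_dir k hqk) (cone_subset_dir k hqk')) (by rw [map_sub, hqy, hqy', sub_self])
  rw [inner_sub_right, h.inner_eq_zero (cone_subset_dir j hq), sub_zero] at h1
  rw [inner_sub_right, h'.inner_eq_zero (cone_subset_dir j' hq'), sub_zero] at h2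
  have ht := h.inner_v_nonneg hqk'
  have ht' := h'.inner_v_nonneg hqk
  generalize inner ℝ (B.v j k) q' = t at h1 ht
  generalize inner ℝ (B.v j' k) q = t' at h2 ht'
  have hqq : q' - q ≠ 0 := fun h0 => hne (h.eq_of_mem hy h' hq (by
    rwa [sub_eq_zero.1 h0] at hq') hqy)
  have ht'0 : 0 < t' := by
    refine lt_of_le_of_ne ht' ?_
    rintro rfl
    rw [zero_smul] at h2
    exact hqq (by rw [← neg_sub, h2, neg_zero])
  have h3 : t' • w' = -(t • w) := by rw [← h1, ← h2, neg_sub]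
  have hw'0 : 0 < ‖w'‖ := norm_pos_iff.2 fun h0 => by
    have := h'.inner_w hw'
    rw [h0, inner_zero_right] at this
    exact zero_ne_one this
  have h4 : t' * ‖w'‖ = t * ‖w‖ := by
    have := congrArg norm h3
    rwa [norm_neg, norm_smul, norm_smul, Real.norm_of_nonneg ht, Real.norm_of_nonneg ht'] at this
  have h5 : μ * t' = μ' * t := by
    have : (μ * t') * ‖w'‖ = (μ' * t) * ‖w'‖ := by
      calc (μ * t') * ‖w'‖ = μ * (t' * ‖w'‖) := by ring
        _ = t * (μ * ‖w‖) := by rw [h4]; ring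
        _ = (μ' * t) * ‖w'‖ := by rw [hμμ']; ring
    exact mul_right_cancel₀ hw'0.ne' this
  have h6 : t' • (μ' • w') = t' • (-(μ • w)) := by
    rw [smul_comm, h3, smul_neg, smul_neg, smul_smul, smul_smul, ← h5, mul_comm]
  exact smul_right_injective E ht'0.ne' h6

/-- The fibre leaves a full-dimensional polyhedron through a facet. -/
theorem Generic.exists_crosses (hy : B.Generic a y) {k : J}
    (hk : Module.finrank ℝ (B.dir k) = m + 1) {q d : E} (hq : q ∈ B.cone k)
    (hqy : innerMap a q = y) (hd : d ∈ B.dir k) (hd0 : innerMap a d = 0) {s : ℝ} (hs : 0 < s)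
    (hsd : q + s • d ∉ B.cone k) :
    ∃ j, B.Crosses a y j k ∧ ∃ c : Module.Dual ℝ E, (∀ u ∈ B.dir j, c u = 0) ∧
      (∀ u ∈ B.cone k, c u ≤ 0) ∧ 0 < c d := by
  obtain ⟨t, c, hc, hcd, hqt⟩ := (B.polyhedron k).exists_exit_face (B.mem k) hq hs hsd
  obtain ⟨j, hj, hjK⟩ := B.exists_face k _ (isConvexFace_of_le (B.polyhedron k).convex c (c B.p) hc)
    ⟨B.mem k, rfl⟩
  have hqj : q + t • d ∈ B.cone j := by rw [cone, hjK]; exact hqt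
  have hqjy : innerMap a (q + t • d) = y := by rw [map_add, map_smul, hd0, hqy, smul_zero, add_zero]
  have hc0 : ∀ u ∈ B.dir j, c u = 0 := by
    intro u hu
    have : B.dir j ≤ LinearMap.ker c := by
      refine Submodule.span_le.2 ?_
      rintro _ ⟨x, hx, z, hz, rfl⟩
      have hx' : x ∈ {x ∈ B.K k | c x = c B.p} := hjK ▸ hx
      have hz' : z ∈ {x ∈ B.K k | c x = c B.p} := hjK ▸ hz
      simp [hx'.2, hz'.2]
    exact this hu
  -- The exit face is proper because `c d > 0`; genericity bounds its dimension below by `m`, so it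
  -- is a facet.
  have hlt : Module.finrank ℝ (B.dir j) < m + 1 := by
    rw [← hk]
    refine Submodule.finrank_lt_finrank_of_lt (lt_of_le_of_ne (dir_le hj) fun h => ?_)
    exact hcd.ne' (hc0 d (h ▸ hd))
  have hle := hy.le_finrank (cone_subset_dir j hqj) hqjy
  refine ⟨j, ⟨⟨by omega, _, hqj, hqjy⟩, hj, hk⟩, c, hc0, fun u hu => ?_, hcd⟩
  have := nonneg_of_mem_feasibleCone (c := -c) (fun x hx => by simpa using hc x hx) hu
  simpa using this

/-- A functional which defines a facet is not positive on the inward normal vector. -/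
theorem Crosses.functional_nonpos {j k : J} (h : B.Crosses a y j k) {w : E}
    (hw : w - B.v j k ∈ B.dir j) {c : Module.Dual ℝ E} (hc0 : ∀ u ∈ B.dir j, c u = 0)
    (hc : ∀ u ∈ B.cone k, c u ≤ 0) : c w ≤ 0 := by
  have hcw : c w = c (B.v j k) := by
    have := hc0 _ hw
    rwa [map_sub, sub_eq_zero] at this
  -- The normal `v` is a positive multiple of some `x - z` with `x`, `z` in the polyhedron. As `z -
  -- p` has nonnegative normal component, that of `x - p` is positive.
  obtain ⟨u, hu, hvu⟩ : ∃ u ∈ B.cone k, 0 < (inner ℝ (B.v j k) u : ℝ) := by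
    obtain ⟨x, hx, z, hz, s, hs, he⟩ := exists_smul_sub_of_mem_vectorSpan (B.polyhedron k).convex
      ⟨_, B.mem k⟩ (B.v_mem h.2.1 h.1.1 h.2.2)
    refine ⟨x - B.p, sub_mem_feasibleCone _ hx, ?_⟩
    have h1 := h.inner_v_self
    have h2 := h.inner_v_nonneg (sub_mem_feasibleCone B.p hz)
    nth_rewrite 2 [he] at h1
    rw [inner_smul_right, show x - z = (x - B.p) - (z - B.p) by abel, inner_sub_right] at h1
    by_contra hcon
    push Not at hcon
    nlinarith
  have h1 := sub_inner_smul_mem (dir_le h.2.1) h.1.1 h.2.2 (B.v_mem h.2.1 h.1.1 h.2.2)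
    (B.v_mem_orthogonal h.2.1 h.1.1 h.2.2) (B.norm_v h.2.1 h.1.1 h.2.2) (cone_subset_dir k hu)
  have h2 := hc0 _ h1
  rw [map_sub, map_smul, sub_eq_zero, smul_eq_mul] at h2
  have h3 := hc u hu
  rw [hcw]
  by_contra hcon
  push Not at hcon
  nlinarith [mul_pos hvu hcon]

/-- Spares the proof that an edge has at most two ends: given two indices, the relations force every
further term to vanish. -/
theorem sum_nonneg_of_pairwise_neg {κ : Type*} [DecidableEq κ] (s : Finset κ) (x : κ → ℝ)
    (h : ∀ i ∈ s, ∀ j ∈ s, i ≠ j → x j = -x i) (h1 : ∀ i ∈ s, (∀ j ∈ s, j = i) → 0 ≤ x i) :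
    0 ≤ ∑ i ∈ s, x i := by
  by_cases hs : ∃ i ∈ s, ∃ j ∈ s, i ≠ j
  · obtain ⟨i, hi, j, hj, hij⟩ := hs
    rw [← Finset.sum_subset (s₁ := {i, j}) (by
      intro l hl
      rcases Finset.mem_insert.1 hl with rfl | hl
      · exact hi
      · rwa [Finset.mem_singleton.1 hl]), Finset.sum_pair hij, h i hi j hj hij, add_neg_cancel]
    intro l hl hl'
    simp only [Finset.mem_insert, Finset.mem_singleton, not_or] at hl'
    have e1 := h i hi l hl (Ne.symm hl'.1)
    have e2 := h j hj l hl (Ne.symm hl'.2)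
    have e3 := h i hi j hj hij
    linarith
  · push Not at hs
    exact Finset.sum_nonneg fun i hi => h1 i hi fun j hj => hs j hj i hi

open Classical in
/-- The contributions of the facets of a full-dimensional polyhedron sum up to something
nonnegative. -/
theorem Generic.sum_nonneg (hy : B.Generic a y) {k : J} {l : Module.Dual ℝ E}
    (hl : ∀ u ∈ B.cone k, 0 ≤ l u) (w : J → E) (μ : J → ℝ)
    (hw : ∀ j, B.Crosses a y j k → w j - B.v j k ∈ B.dir j ∧ innerMap a (w j) = 0)
    (hμ : ∀ j, B.Crosses a y j k → 0 < μ j)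
    (hμw : ∀ j j', B.Crosses a y j k → B.Crosses a y j' k → μ j * ‖w j‖ = μ j' * ‖w j'‖) :
    0 ≤ ∑ j with B.Crosses a y j k, μ j * l (w j) := by
  refine sum_nonneg_of_pairwise_neg _ _ ?_ ?_
  · intro i hi j hj hij
    replace hi := (Finset.mem_filter.1 hi).2
    replace hj := (Finset.mem_filter.1 hj).2
    have := congrArg l (hi.exists_neg hy hj hij (hw i hi).1 (hw i hi).2 (hw j hj).1 (hw j hj).2
      (hμw i j hi hj))
    simpa using this
  · intro i hi huniq
    replace hi := (Finset.mem_filter.1 hi).2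
    refine mul_nonneg (hμ i hi).le ?_
    obtain ⟨q, hq, hqy⟩ := hi.1.2
    by_contra hneg
    push Not at hneg
    -- If `l` decreased along `w i`, it would reach `-1` at this `s`, outside the cone. The ray
    -- would then exit through a facet, which by uniqueness is `i` itself, although `w i` points
    -- inwards from it.
    have hs : ∃ s : ℝ, 0 < s ∧ q + s • w i ∉ B.cone k := by
      have hlq := hl q (cone_subset hi.2.1 hq)
      refine ⟨(l q + 1) / -l (w i), div_pos (by linarith) (by linarith), fun hmem => ?_⟩
      have := hl _ hmem
      rw [map_add, map_smul, smul_eq_mul, div_mul_eq_mul_div, div_neg, mul_div_assoc,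
        div_self hneg.ne] at this
      linarith
    obtain ⟨s, hs, hsq⟩ := hs
    obtain ⟨j, hj, c, hc0, hc, hcw⟩ := hy.exists_crosses hi.2.2 (cone_subset hi.2.1 hq) hqy
      (hi.w_mem (hw i hi).1) (hw i hi).2 hs hsq
    obtain rfl := huniq j (by simpa using hj)
    exact absurd (hj.functional_nonpos (hw j hj).1 hc0 hc) (not_le.2 hcw)

open Classical in
/-- The contributions vanish along every facet, by the balancing condition. -/
theorem Meets.sum_eq_zero (hy : B.Generic a y) {j : J} (hj : B.Meets a y j) (w : J → E)
    (hw : ∀ k, B.Crosses a y j k → w k - B.v j k ∈ B.dir j ∧ innerMap a (w k) = 0) :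
    ∑ k with B.Crosses a y j k, B.b k • w k = 0 := by
  have hfilter : (Finset.univ.filter fun k => B.Crosses a y j k) =
      Finset.univ.filter fun k => B.Face j k ∧ Module.finrank ℝ (vectorSpan ℝ (B.K k)) = m + 1 :=
    Finset.filter_congr fun k _ => ⟨fun h => h.2, fun h => ⟨hj, h⟩⟩
  have hbal := B.balanced j hj.1
  rw [← hfilter] at hbal
  -- Modulo `dir j` each `w k` is the unit normal, so balancing puts the sum into `dir j`; it also
  -- lies in the kernel, which meets `dir j` only in zero.
  refine hj.injective hy ?_ ?_
  · rw [← sub_zero (∑ k with _, _), ← hbal, ← Finset.sum_sub_distrib]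
    refine Submodule.sum_mem _ fun k hk => ?_
    rw [← smul_sub]
    exact Submodule.smul_mem _ _ (hw k (Finset.mem_filter.1 hk).2).1
  · rw [map_sum]
    refine Finset.sum_eq_zero fun k hk => ?_
    rw [map_smul, (hw k (Finset.mem_filter.1 hk).2).2, smul_zero]

open Classical in
/-- On a balanced star, a linear functional which attains its minimum at the center is constant. -/
theorem eq_of_isMin (B : BalancedStar E J m) (l : Module.Dual ℝ E)
    (hl : ∀ k, ∀ x ∈ B.K k, l B.p ≤ l x) (k₀ : J)
    (hk₀ : Module.finrank ℝ (vectorSpan ℝ (B.K k₀)) = m + 1) : ∀ x ∈ B.K k₀, l x = l B.p := by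
  by_contra! hcon
  obtain ⟨x₀, hx₀, hne⟩ := hcon
  have hlc : ∀ k, ∀ u ∈ B.cone k, 0 ≤ l u := fun k u hu => nonneg_of_mem_feasibleCone (hl k) hu
  set r := x₀ - B.p with hr
  have hrc : r ∈ B.cone k₀ := sub_mem_feasibleCone _ hx₀
  have hlr : 0 < l r := lt_of_le_of_ne (hlc k₀ r hrc) (by
    rw [hr, map_sub]; exact fun h => hne (sub_eq_zero.1 h.symm))
  have hr0 : r ≠ 0 := fun h => by simp [h] at hlr
  have hrd : r ∈ B.dir k₀ := cone_subset_dir k₀ hrc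
  -- the orthogonal complement of `r` in the direction of `K k₀`
  have hR : Module.finrank ℝ ((Submodule.span ℝ {r})ᗮ ⊓ B.dir k₀ : Submodule ℝ E) = m :=
    Submodule.finrank_add_inf_finrank_orthogonal'
      (by simpa [Submodule.span_singleton_le_iff_mem] using hrd)
      (by rw [finrank_span_singleton hr0]; rw [add_comm]; exact hk₀.symm)
  let e := (stdOrthonormalBasis ℝ ((Submodule.span ℝ {r})ᗮ ⊓ B.dir k₀ : Submodule ℝ E)).reindex
    (finCongr hR)
  -- With this choice the kernel in the direction of `K k₀` is the line through `r`, so the edge of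
  -- the slice in `k₀` is parallel to `r`.
  let a : Fin m → E := fun i => (e i : E)
  have har : innerMap a r = 0 := by
    ext i
    exact (Submodule.mem_orthogonal' _ _).1 (e i).2.1 r (Submodule.mem_span_singleton_self r)
  have hmap : (B.dir k₀).map (innerMap a) = ⊤ := by
    refine eq_top_iff.2 fun z _ => ⟨∑ i, z i • a i, Submodule.sum_mem _ fun i _ =>
      Submodule.smul_mem _ _ (e i).2.2, ?_⟩
    ext i
    have hort : ∀ j k, inner ℝ (a j) (a k) = if j = k then (1 : ℝ) else 0 := fun j k => by
      have := orthonormal_iff_ite.1 e.orthonormal j k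
      simpa using this
    simp [innerMap_apply, inner_sum, inner_smul_right, hort]
  -- a generic point of `K k₀`
  obtain ⟨x, hx, hxgen⟩ := exists_mem_forall_sub_notMem (B.polyhedron k₀).convex ⟨_, B.mem k₀⟩ B.p
    (κ := {j : J // (B.dir j).map (innerMap a) ≠ ⊤})
    -- As `dir k₀` maps onto `ℝ^m`, no exceptional preimage contains it.
    (fun j => ((B.dir j).map (innerMap a)).comap (innerMap a)) (fun j hj => j.2 (by
      exact eq_top_iff.2 (hmap.ge.trans (Submodule.map_le_iff_le_comap.2 hj))))
  set q := x - B.p with hq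
  have hqc : q ∈ B.cone k₀ := sub_mem_feasibleCone _ hx
  obtain ⟨y, hqy⟩ : ∃ y, innerMap a q = y := ⟨_, rfl⟩
  have hy : B.Generic a y := by
    intro j hj
    by_contra hne
    exact hxgen ⟨j, hne⟩ (by rw [← hqy] at hj; exact hj)
  -- weights and kernel vectors
  have hμ : ∀ j, ∃ μ : ℝ, B.Meets a y j → 0 < μ ∧ ∀ (W : Submodule ℝ E) (v w : E), B.dir j ≤ W →
      Module.finrank ℝ W = m + 1 → v ∈ W → v ∈ (B.dir j)ᗮ → ‖v‖ = 1 → w - v ∈ B.dir j →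
      innerMap a w = 0 →
      μ * ‖w‖ = √(Matrix.det (Matrix.of fun i j => inner ℝ (a i) (W.starProjection (a j)))) := by
    intro j
    by_cases hj : B.Meets a y j
    · obtain ⟨μ, h⟩ := exists_weight_mul_norm a (B.dir j) hj.1 fun d => hj.injective hy
      exact ⟨μ, fun _ => h⟩
    · exact ⟨0, fun h => absurd h hj⟩
  choose μ hμ using hμ
  have hw : ∀ j k, ∃ w, B.Crosses a y j k → w - B.v j k ∈ B.dir j ∧ innerMap a w = 0 := by
    intro j k
    by_cases hj : B.Crosses a y j k
    · obtain ⟨w, h⟩ := hj.exists_kernel_vector hy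
      exact ⟨w, fun _ => h⟩
    · exact ⟨0, fun h => absurd h hj⟩
  choose w hw using hw
  -- The right-hand side depends on the edge `k` but not on its end `j`; this is what makes opposite
  -- ends cancel.
  have hμw : ∀ k j, B.Crosses a y j k → μ j * ‖w j k‖ = √(Matrix.det (Matrix.of fun i j =>
      inner ℝ (a i) ((B.dir k).starProjection (a j)))) := fun k j h =>
    (hμ j h.1).2 _ _ _ (dir_le h.2.1) h.2.2 (B.v_mem h.2.1 h.1.1 h.2.2)
      (B.v_mem_orthogonal h.2.1 h.1.1 h.2.2) (B.norm_v h.2.1 h.1.1 h.2.2) (hw j k h).1 (hw j k h).2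
  -- the total contribution vanishes
  have hzero : ∑ k, B.b k * ∑ j with B.Crosses a y j k, μ j * l (w j k) = 0 := by
    have h1 : ∀ j, ∑ k with B.Crosses a y j k, μ j * (B.b k * l (w j k)) = 0 := by
      intro j
      by_cases hj : B.Meets a y j
      · have := congrArg l (hj.sum_eq_zero hy (w j) (hw j))
        rw [map_sum, map_zero] at this
        rw [← Finset.mul_sum]
        simp only [map_smul, smul_eq_mul] at this
        rw [this, mul_zero]
      · refine Finset.sum_eq_zero fun k hk => absurd (Finset.mem_filter.1 hk).2.1 hj
    calc ∑ k, B.b k * ∑ j with B.Crosses a y j k, μ j * l (w j k)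
        = ∑ k, ∑ j, if B.Crosses a y j k then μ j * (B.b k * l (w j k)) else 0 := by
          refine Finset.sum_congr rfl fun k _ => ?_
          rw [Finset.mul_sum, Finset.sum_filter]
          exact Finset.sum_congr rfl fun j _ => by split_ifs <;> ring
      _ = ∑ j, ∑ k, if B.Crosses a y j k then μ j * (B.b k * l (w j k)) else 0 :=
          Finset.sum_comm
      _ = 0 := Finset.sum_eq_zero fun j _ => by rw [← Finset.sum_filter]; exact h1 j
  -- but it is positive
  refine hzero.not_gt (Finset.sum_pos' (fun k _ => mul_nonneg (B.b_pos k).le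
    (hy.sum_nonneg (hlc k) (fun j => w j k) μ (fun j => hw j k) (fun j h => (hμ j h.1).1)
      fun j j' h h' => by rw [hμw k j h, hμw k j' h'])) ⟨k₀, Finset.mem_univ _,
        mul_pos (B.b_pos k₀) (Finset.sum_pos ?_ ?_)⟩)
  · intro j hj
    replace hj := (Finset.mem_filter.1 hj).2
    refine mul_pos (hμ j hj.1).1 ?_
    -- At any end, `r` is a nonnegative multiple of the inward `w`, so `l r > 0` forces `l w > 0`.
    have h1 := hj.eq_inner_smul hy (hw j k₀ hj).1 (hw j k₀ hj).2 hrd har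
    have h2 := hj.inner_v_nonneg hrc
    have h3 := congrArg l h1
    rw [map_smul, smul_eq_mul] at h3
    rw [h3] at hlr
    exact pos_of_mul_pos_right hlr h2
  -- The edge does have an end: moving along `-r` lowers `l` to `-1` at this `s`, hence leaves the
  -- cone.
  · have hs : ∃ s : ℝ, 0 < s ∧ q + s • (-r) ∉ B.cone k₀ := by
      have hlq := hlc k₀ q hqc
      refine ⟨(l q + 1) / l r, div_pos (by linarith) hlr, fun hmem => ?_⟩
      have := hlc k₀ _ hmem
      rw [map_add, map_smul, smul_eq_mul, map_neg, mul_neg, div_mul_cancel₀ _ hlr.ne'] at this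
      linarith
    obtain ⟨s, hs, hsq⟩ := hs
    obtain ⟨j, hj, -⟩ := hy.exists_crosses hk₀ hqc hqy (neg_mem hrd) (by rw [map_neg, har, neg_zero])
      hs hsq
    exact ⟨j, by simpa using hj⟩

end BalancedStar

end BalancedStar

/-! ### Relative interior points by separation -/

section Separation

variable {E : Type*} [NormedAddCommGroup E] [NormedSpace ℝ E] [FiniteDimensional ℝ E]

/-- If every linear functional with a minimum at `p` is constant on the convex set `C`, then `p` is
a relative interior point of `C`. -/
theorem exists_radius_of_forall_isMin {C : Set E} (hC : Convex ℝ C) {p : E} (hp : p ∈ C)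
    (h : ∀ l : Module.Dual ℝ E, (∀ x ∈ C, l p ≤ l x) → ∀ x ∈ C, l x = l p) :
    ∃ r > 0, ∀ z, z - p ∈ vectorSpan ℝ C → ‖z - p‖ ≤ r → z ∈ C := by
  set W := vectorSpan ℝ C with hW
  let D : Set W := {w | p + w ∈ C}
  have hD : Convex ℝ D := by
    intro x hx y hy s t hs ht hst
    have := hC hx hy hs ht hst
    change p + ((s • x + t • y : W) : E) ∈ C
    convert this using 1
    simp only [Submodule.coe_add, Submodule.coe_smul, smul_add]
    have hp' : p = s • p + t • p := by rw [← add_smul, hst, one_smul]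
    nth_rewrite 1 [hp']
    abel
  have h0 : (0 : W) ∈ D := by simpa [D] using hp
  have hsub : ∀ x (hx : x ∈ C), (⟨x - p, vsub_mem_vectorSpan ℝ hx hp⟩ : W) ∈ D := fun x hx => by
    simpa [D] using hx
  have hspan : affineSpan ℝ D = ⊤ := by
    rw [AffineSubspace.affineSpan_eq_top_iff_vectorSpan_eq_top_of_nonempty _ _ _ ⟨0, h0⟩, eq_top_iff]
    rintro ⟨w, hw⟩ -
    obtain ⟨x, hx, y, hy, c, hc, he⟩ := exists_smul_sub_of_mem_vectorSpan hC ⟨p, hp⟩ hw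
    have : (⟨w, hw⟩ : W) = c • ((⟨x - p, vsub_mem_vectorSpan ℝ hx hp⟩ : W) -
        ⟨y - p, vsub_mem_vectorSpan ℝ hy hp⟩) := Subtype.ext (by simpa using he)
    rw [this]
    exact Submodule.smul_mem _ _ (vsub_mem_vectorSpan ℝ (hsub x hx) (hsub y hy))
  have hint := hD.interior_nonempty_iff_affineSpan_eq_top.2 hspan
  by_cases h0i : (0 : W) ∈ interior D
  · obtain ⟨r, hr, hball⟩ := Metric.mem_nhds_iff.1 (mem_interior_iff_mem_nhds.1 h0i)
    refine ⟨r / 2, by positivity, fun z hz hzr => ?_⟩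
    have : (⟨z - p, hz⟩ : W) ∈ D := hball (by
      rw [mem_ball_zero_iff, Submodule.coe_norm]
      simp only
      linarith)
    simpa [D] using this
  -- Separating `0` from the interior gives a functional with a minimum at `p`. It must be constant
  -- on `C` by hypothesis, yet it is strictly positive on the interior of `D`.
  · exfalso
    obtain ⟨g, hg⟩ := geometric_hahn_banach_point_open hD.interior isOpen_interior h0i
    rw [map_zero] at hg
    have hgD : ∀ w ∈ D, 0 ≤ g w := by
      intro w hw
      have hcl : w ∈ closure (interior D) := by
        rw [hD.closure_interior_eq_closure_of_nonempty_interior hint]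
        exact subset_closure hw
      exact closure_minimal (s := interior D) (t := {w | 0 ≤ g w}) (fun w hw => (hg w hw).le)
        (isClosed_le continuous_const g.continuous) hcl
    obtain ⟨l, hl⟩ := LinearMap.exists_extend g.toLinearMap
    have hlg : ∀ x (hx : x ∈ C), l x - l p = g ⟨x - p, vsub_mem_vectorSpan ℝ hx hp⟩ := by
      intro x hx
      rw [← map_sub]
      exact LinearMap.congr_fun hl ⟨x - p, vsub_mem_vectorSpan ℝ hx hp⟩
    have hconst := h l fun x hx => sub_nonneg.1 (by rw [hlg x hx]; exact hgD _ (hsub x hx))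
    obtain ⟨w, hw⟩ := hint
    have hwC : p + (w : E) ∈ C := show w ∈ D from interior_subset hw
    have h1 := hlg _ hwC
    rw [hconst _ hwC, sub_self] at h1
    have h2 : (⟨p + (w : E) - p, vsub_mem_vectorSpan ℝ hwC hp⟩ : W) = w :=
      Subtype.ext (add_sub_cancel_left p (w : E))
    rw [h2] at h1
    exact (hg w hw).ne h1

end Separation

/-- Every point has small neighbourhoods which are polyhedra. -/
theorem exists_list_affine_neg {E : Type*} [NormedAddCommGroup E] [InnerProductSpace ℝ E]
    [FiniteDimensional ℝ E] (p : E) {δ : ℝ} (hδ : 0 < δ) : ∃ l : List (E →ᵃ[ℝ] ℝ),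
      (∀ a ∈ l, a p < 0) ∧ ∀ z, (∀ a ∈ l, a z ≤ 0) → ‖z - p‖ < δ := by
  let e := stdOrthonormalBasis ℝ E
  set d := Module.finrank ℝ E
  -- The `+ 1` allows `d = 0` and makes the final bound `d * ε < δ` strict.
  set ε := δ / (d + 1) with hε
  have hε0 : 0 < ε := by positivity
  let c : Fin d → E →ᵃ[ℝ] ℝ := fun i => (innerₛₗ ℝ (e i) : E →ₗ[ℝ] ℝ).toAffineMap
  have hc : ∀ i x, c i x = inner ℝ (e i) x := fun i x => rfl
  refine ⟨(List.ofFn fun i => c i - AffineMap.const ℝ E (c i p + ε)) ++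
    List.ofFn fun i => -(c i) + AffineMap.const ℝ E (c i p - ε), ?_, ?_⟩
  · intro a ha
    rw [List.mem_append, List.mem_ofFn, List.mem_ofFn] at ha
    rcases ha with ⟨i, rfl⟩ | ⟨i, rfl⟩
    · simpa using hε0
    · simpa using hε0
  · intro z hz
    have hz1 : ∀ i, |inner ℝ (e i) (z - p)| ≤ ε := by
      intro i
      have h1 := hz (c i - AffineMap.const ℝ E (c i p + ε)) (by
        rw [List.mem_append, List.mem_ofFn]; exact Or.inl ⟨i, rfl⟩)
      have h2 := hz (-(c i) + AffineMap.const ℝ E (c i p - ε)) (by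
        rw [List.mem_append, List.mem_ofFn, List.mem_ofFn]; exact Or.inr ⟨i, rfl⟩)
      simp only [AffineMap.const_apply, Pi.sub_apply, Pi.add_apply, Pi.neg_apply, AffineMap.coe_sub,
        AffineMap.coe_add, AffineMap.coe_neg, hc] at h1 h2
      rw [abs_le, inner_sub_right]
      constructor <;> linarith
    calc ‖z - p‖ = ‖∑ i, inner ℝ (e i) (z - p) • e i‖ := by rw [e.sum_repr']
      _ ≤ ∑ i, ‖(inner ℝ (e i) (z - p) : ℝ) • e i‖ := norm_sum_le _ _
      _ ≤ ∑ _i : Fin d, ε := by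
          refine Finset.sum_le_sum fun i _ => ?_
          rw [norm_smul, e.orthonormal.1 i, mul_one, Real.norm_eq_abs]
          exact hz1 i
      _ = d * ε := by simp
      _ < δ := by
          rw [hε, mul_div_assoc', div_lt_iff₀ (by positivity)]
          nlinarith

/-! ### From the minimum principle to Lipschitz estimates on stars -/

namespace QuasiEmbeddedPolyhedralSpace

variable {X N : Type*} [TopologicalSpace X] [SecondCountableTopology X] [NormedAddCommGroup N]
  [InnerProductSpace ℝ N] [FiniteDimensional ℝ N]

open Classical in
/-- A linear functional with a minimum at `p` on the star of `p` is constant on the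
full-dimensional polyhedra of the star, if there is a balancing condition near `p`. -/
theorem IsMinkowskiWeight.eq_of_isMin {S : QuasiEmbeddedPolyhedralSpace X N}
    {P : PolyhedralStructure X} (hP : S.IsComplex P) {n : ℕ} {V : Set X} {p : X} (hpV : p ∈ V)
    {b : P.restrict V n → ℝ} (hb : S.IsMinkowskiWeight P V n b) (hb0 : ∀ σ, 0 < b σ)
    (l : Module.Dual ℝ N)
    (hl : ∀ σ : P.cells, p ∈ (σ : Set X) → ∀ x ∈ (σ : Set X), l (S.ι p) ≤ l (S.ι x))
    (σ : P.cells) (hσ : p ∈ (σ : Set X)) (hdim : P.dim σ = n) :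
    ∀ x ∈ (σ : Set X), l (S.ι x) = l (S.ι p) := by
  have hfr : ∀ σ : P.cells, p ∈ (σ : Set X) → ∀ k : ℕ, P.dim σ = k ↔
      Module.finrank ℝ (vectorSpan ℝ (S.ι '' (σ : Set X))) = k := by
    intro σ hσ k
    rw [← S.finrank_vectorSpan hP σ ⟨p, hσ⟩, Nat.cast_inj]
  rcases n with _ | m
  -- In dimension zero the polyhedron is a single point, and no balancing is involved.
  · intro x hx
    rw [hfr σ hσ, Submodule.finrank_eq_zero] at hdim
    have := vsub_mem_vectorSpan ℝ (Set.mem_image_of_mem S.ι hx) (Set.mem_image_of_mem S.ι hσ)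
    rw [hdim, Submodule.mem_bot, vsub_eq_sub, sub_eq_zero] at this
    rw [this]
  have : Finite {σ : P.cells // p ∈ (σ : Set X)} := (P.locallyFinite.point_finite p).to_subtype
  have := Fintype.ofFinite {σ : P.cells // p ∈ (σ : Set X)}
  -- The default `1` only serves positivity; balancing at `p` involves full-dimensional polyhedra
  -- containing `p`, which meet `V`.
  let b' : P.cells → ℝ := fun σ => if h : σ ∈ P.restrict V ((m + 1 : ℕ) : ℤ) then b ⟨σ, h⟩ else 1
  have hnormal : ∀ {j k : {σ : P.cells // p ∈ (σ : Set X)}}, P.IsFace j.1 k.1 →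
      Module.finrank ℝ (vectorSpan ℝ (S.ι '' (j.1 : Set X))) = m →
      Module.finrank ℝ (vectorSpan ℝ (S.ι '' (k.1 : Set X))) = m + 1 →
      S.IsUnitNormal (j.1 : Set X) (k.1 : Set X) (S.unitNormal j.1 k.1) := by
    intro j k hjk hj hk
    refine S.isUnitNormal_unitNormal hP j.1 k.1 ⟨p, j.2⟩ hjk ?_
    rw [(hfr j.1 j.2 m).2 hj, (hfr k.1 k.2 (m + 1)).2 hk]
    push_cast
    ring
  let B : BalancedStar N {σ : P.cells // p ∈ (σ : Set X)} m :=
    { K := fun j => S.ι '' (j.1 : Set X)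
      p := S.ι p
      Face := fun j k => P.IsFace j.1 k.1
      b := fun j => b' j.1
      v := fun j k => S.unitNormal j.1 k.1
      polyhedron := fun j => hP.isConvexPolyhedron_image j.1
      mem := fun j => ⟨p, j.2, rfl⟩
      convexFace := fun h => (S.isConvexFace_image hP _ _ h).2
      face_inj := fun {j j' k} h h' he => Subtype.ext (Subtype.ext
        ((hP.2 k.1).2.image_eq_image_iff h.1 h'.1 |>.1 he))
      exists_face := by
        intro k G hG hpG
        obtain ⟨τ, hτ, rfl⟩ := hP.exists_isFace k.1 hG
        obtain ⟨x, hx, hxp⟩ := hpG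
        rw [(hP.2 k.1).2 (hτ.1 hx) k.2 hxp] at hx
        exact ⟨⟨τ, hx⟩, hτ, rfl⟩
      b_pos := by
        intro k
        simp only [b']
        split_ifs
        · exact hb0 _
        · exact one_pos
      norm_v := fun h hj hk => (hnormal h hj hk).1
      v_mem_orthogonal := fun h hj hk => (hnormal h hj hk).2.1
      v_mem := fun h hj hk => (hnormal h hj hk).2.2.1
      v_nonneg := by
        rintro j k h hj hk _ ⟨x, hx, rfl⟩
        exact (hnormal h hj hk).2.2.2 p j.2 x hx
      balanced := by
        intro j hj
        have h1 := hb j.1 ⟨⟨p, j.2, hpV⟩, by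
          rw [(hfr j.1 j.2 m).2 hj]; push_cast; ring⟩
        -- Every polyhedron having `j` as a face contains `p`, so the sum over `V` and the sum over
        -- the star have the same terms.
        have e1 : ∑ᶠ (σ : P.restrict V ((m + 1 : ℕ) : ℤ)) (_ : P.IsFace j.1 σ),
            b σ • S.unitNormal (j.1 : Set X) (σ : Set X) =
            ∑ᶠ σ ∈ {σ : P.cells | P.IsFace j.1 σ ∧ P.dim σ = (m + 1 : ℕ)},
              b' σ • S.unitNormal (j.1 : Set X) (σ : Set X) := by
          refine finsum_mem_eq_of_bijOn
            (s := {σ : P.restrict V ((m + 1 : ℕ) : ℤ) | P.IsFace j.1 σ}) Subtype.val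
            ⟨fun σ hσ => ⟨hσ, σ.2.2⟩, Subtype.val_injective.injOn, ?_⟩ ?_
          · rintro σ ⟨hσ, hd⟩
            exact ⟨⟨σ, ⟨p, hσ.1 j.2, hpV⟩, hd⟩, hσ, rfl⟩
          · intro σ _
            simp only [b', Subtype.coe_prop, dif_pos]
        have e2 : ∑ᶠ k ∈ ({k | P.IsFace j.1 k.1 ∧
            Module.finrank ℝ (vectorSpan ℝ (S.ι '' (k.1 : Set X))) = m + 1} :
              Set {σ : P.cells // p ∈ (σ : Set X)}),
              b' k.1 • S.unitNormal (j.1 : Set X) (k.1 : Set X) =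
            ∑ᶠ σ ∈ {σ : P.cells | P.IsFace j.1 σ ∧ P.dim σ = (m + 1 : ℕ)},
              b' σ • S.unitNormal (j.1 : Set X) (σ : Set X) := by
          refine finsum_mem_eq_of_bijOn Subtype.val
            ⟨fun k hk => ⟨hk.1, (hfr k.1 k.2 _).2 hk.2⟩, Subtype.val_injective.injOn, ?_⟩
            fun _ _ => rfl
          rintro σ ⟨hσ, hd⟩
          exact ⟨⟨σ, hσ.1 j.2⟩, ⟨hσ, (hfr σ (hσ.1 j.2) _).1 hd⟩, rfl⟩
        rw [e1, ← e2] at h1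
        rw [← finsum_mem_coe_finset]
        simpa using h1 }
  intro x hx
  exact B.eq_of_isMin l (by
    rintro k _ ⟨z, hz, rfl⟩
    exact hl k.1 k.2 z hz) ⟨σ, hσ⟩ ((hfr σ hσ (m + 1)).1 hdim) _ ⟨x, hx, rfl⟩

/-- A linear functional with a minimum at `p` on the star of `p` is constant on the star, if there
is a balancing condition near `p`. -/
theorem AdmitsBalancing.exists_eq_of_isMin {S : QuasiEmbeddedPolyhedralSpace X N} {n : ℕ}
    (hn : S.HasPureDimension n) {V : Set X} (hV : S.AdmitsBalancing n V) {p : X} (hpV : p ∈ V) :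
    ∃ P : PolyhedralStructure X, S.IsComplex P ∧ ∀ l : Module.Dual ℝ N,
      (∀ σ : P.cells, p ∈ (σ : Set X) → ∀ x ∈ (σ : Set X), l (S.ι p) ≤ l (S.ι x)) →
      ∀ σ : P.cells, p ∈ (σ : Set X) → ∀ x ∈ (σ : Set X), l (S.ι x) = l (S.ι p) := by
  obtain ⟨P, hP, b, hb, hb0⟩ := hV
  refine ⟨P, hP, fun l hl σ hσ x hx => ?_⟩
  have hfin : {t : Set X | t ∈ P.cells ∧ p ∈ t}.Finite := by
    refine ((P.locallyFinite.point_finite p).image Subtype.val).subset ?_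
    rintro t ⟨ht, hpt⟩
    exact ⟨⟨t, ht⟩, hpt, rfl⟩
  -- Purity gives a maximal polyhedron around `σ` the full dimension, to which the balanced case
  -- applies.
  obtain ⟨t, hσt, ht⟩ := hfin.exists_le_maximal (a := (σ : Set X)) ⟨σ.2, hσ⟩
  have hmax : Maximal (fun s => s ∈ P.cells) t :=
    ⟨ht.1.1, fun s hs hts => ht.2 ⟨hs, hts ht.1.2⟩ hts⟩
  exact hb.eq_of_isMin hP hpV hb0 l hl ⟨t, ht.1.1⟩ ht.1.2
    (hn P hP.1 ⟨t, ht.1.1⟩ hmax) x (hσt hx)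

theorem IsComplex.continuous {S : QuasiEmbeddedPolyhedralSpace X N} {P : PolyhedralStructure X}
    (hP : S.IsComplex P) : Continuous S.ι := by
  refine P.locallyFinite.continuous ?_ P.isClosed fun σ => (hP.2 σ).1.continuousOn
  rw [← Set.sUnion_eq_iUnion]
  exact P.sUnion_cells

/-- Concavity for convex combinations indexed by any finite type. -/
theorem IsConcaveOn.sum_le {S : QuasiEmbeddedPolyhedralSpace X N} {U : Set X} {f : X → ℝ}
    (hf : S.IsConcaveOn U f) {P : PolyhedralStructure X} (hP : S.IsComplex P) {κ : Type*}
    [Fintype κ] {τ : P.cells} {x : X} (hxU : x ∈ U) (hx : x ∈ (τ : Set X)) {y : κ → X} {ν : κ → ℝ}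
    (hy : ∀ i, ∃ σ : P.cells, P.IsFace τ σ ∧ (σ : Set X) ⊆ U ∧ y i ∈ (σ : Set X))
    (hν : ∀ i, 0 ≤ ν i) (hν1 : ∑ i, ν i = 1) (hsum : ∑ i, ν i • S.ι (y i) = S.ι x) :
    ∑ i, ν i * f (y i) ≤ f x := by
  choose σ hσ using hy
  let e := (Fintype.equivFin κ).symm
  have := hf _ x (y ∘ e) (ν ∘ e) ⟨⟨hxU, fun i => (hσ _).2.1 (hσ _).2.2, fun i => hν _,
    by rw [← hν1]; exact e.sum_comp ν,
    by rw [← hsum]; exact e.sum_comp fun i => ν i • S.ι (y i)⟩,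
    P, hP, τ, fun i => σ (e i), hx, fun i => hσ _⟩
  rwa [← e.sum_comp]

/-- A concave function is bounded from below on a compact polyhedron. -/
theorem IsConcaveOn.exists_lower_bound {S : QuasiEmbeddedPolyhedralSpace X N} {U : Set X}
    {f : X → ℝ} (hf : S.IsConcaveOn U f) {P : PolyhedralStructure X} (hP : S.IsComplex P)
    (σ : P.cells) (hσU : (σ : Set X) ⊆ U) (hb : Bornology.IsBounded (S.ι '' (σ : Set X))) :
    ∃ c, ∀ x ∈ (σ : Set X), c ≤ f x := by
  obtain ⟨v, hv, hconv⟩ := (hP.isConvexPolyhedron_image σ).exists_eq_convexHull hb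
  have hvσ : ∀ z ∈ v, ∃ x ∈ (σ : Set X), S.ι x = z := fun z hz => by
    have : z ∈ S.ι '' (σ : Set X) := hconv ▸ subset_convexHull ℝ v hz
    exact this
  rcases isEmpty_or_nonempty X with hX | hX
  · exact ⟨0, fun x => hX.elim x⟩
  choose! g hg hg' using hvσ
  obtain ⟨c, hc⟩ := (hv.image fun z => f (g z)).bddBelow
  refine ⟨c, fun x hx => ?_⟩
  have hxv : S.ι x ∈ convexHull ℝ v := hconv ▸ Set.mem_image_of_mem S.ι hx
  obtain ⟨κ, _, w, z, hw, hw1, hz, hwz⟩ := mem_convexHull_iff_exists_fintype.1 hxv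
  have := hf.sum_le hP (hσU hx) hx (y := fun i => g (z i))
    (fun i => ⟨σ, P.isFace_self σ, hσU, hg _ (hz i)⟩) hw hw1
    (by rw [← hwz]; exact Finset.sum_congr rfl fun i _ => by rw [hg' _ (hz i)])
  refine le_trans ?_ this
  calc c = ∑ i, w i * c := by rw [← Finset.sum_mul, hw1, one_mul]
    _ ≤ _ := Finset.sum_le_sum fun i _ =>
      mul_le_mul_of_nonneg_left (hc ⟨z i, hz i, rfl⟩) (hw i)

/-- A concave function satisfies a lower Lipschitz estimate at every point of a compact
polyhedron. -/
theorem IsConcaveOn.exists_lower_lipschitz {S : QuasiEmbeddedPolyhedralSpace X N} {U : Set X}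
    {f : X → ℝ} (hf : S.IsConcaveOn U f) {P : PolyhedralStructure X} (hP : S.IsComplex P)
    (σ : P.cells) (hσU : (σ : Set X) ⊆ U) (hb : Bornology.IsBounded (S.ι '' (σ : Set X)))
    {p : X} (hp : p ∈ (σ : Set X)) :
    ∃ δ > 0, ∃ C, ∀ y ∈ (σ : Set X), ‖S.ι y - S.ι p‖ ≤ δ →
      f p - C * ‖S.ι y - S.ι p‖ ≤ f y := by
  obtain ⟨c, hc⟩ := hf.exists_lower_bound hP σ hσU hb
  obtain ⟨δ, hδ, hrad⟩ := (hP.isConvexPolyhedron_image σ).exists_radius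
    (Set.mem_image_of_mem S.ι hp)
  refine ⟨δ, hδ, (f p - c) / δ, fun y hy hyδ => ?_⟩
  rcases eq_or_ne (S.ι y) (S.ι p) with h | h
  · rw [(hP.2 σ).2 hy hp h]; simp
  set d := ‖S.ι y - S.ι p‖ with hd
  have hd0 : 0 < d := norm_pos_iff.2 (sub_ne_zero.2 h)
  -- The point at distance `δ` from `p` on the ray through `y`, so that `y` is the combination of
  -- `p` and `x` with weights `1 - d / δ` and `d / δ`.
  obtain ⟨x, hx, hxz⟩ := hrad _ (Set.mem_image_of_mem S.ι hy) (δ / d) (by positivity) (by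
    rw [norm_smul, ← hd, Real.norm_of_nonneg (by positivity), div_mul_cancel₀ _ hd0.ne'])
  have hdδ : d / δ ≤ 1 := (div_le_one hδ).2 hyδ
  have := hf.sum_le hP (hσU hy) hy (y := ![p, x]) (ν := ![1 - d / δ, d / δ]) (κ := Fin 2)
    (fun i => ⟨σ, P.isFace_self σ, hσU, by fin_cases i; exacts [hp, hx]⟩)
    (fun i => by
      fin_cases i
      · exact sub_nonneg.2 hdδ
      · change 0 ≤ d / δ
        positivity)
    (by simp [Fin.sum_univ_two])
    (by
      simp only [Fin.sum_univ_two, Matrix.cons_val_zero, Matrix.cons_val_one]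
      rw [hxz, smul_add, smul_smul, div_mul_div_cancel₀ hδ.ne', div_self hd0.ne', one_smul, sub_smul,
        one_smul]
      abel)
  simp only [Fin.sum_univ_two, Matrix.cons_val_zero, Matrix.cons_val_one] at this
  have hx' := mul_le_mul_of_nonneg_left (hc x hx) (show 0 ≤ d / δ by positivity)
  calc f p - (f p - c) / δ * d = (1 - d / δ) * f p + d / δ * c := by ring
    _ ≤ f y := by linarith

/-- A concave function satisfies an upper Lipschitz estimate at a point `p` which is, in `N`, a
relative interior point of the convex hull of its star. -/
theorem IsConcaveOn.upper_lipschitz {S : QuasiEmbeddedPolyhedralSpace X N} {U : Set X}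
    {f : X → ℝ} (hf : S.IsConcaveOn U f) {P : PolyhedralStructure X} (hP : S.IsComplex P) {p : X}
    (hU : ∀ σ : P.cells, p ∈ (σ : Set X) → (σ : Set X) ⊆ U) {T : Set X}
    (hT : T = {x | ∃ σ : P.cells, p ∈ (σ : Set X) ∧ x ∈ (σ : Set X)}) {r c : ℝ} (hr : 0 < r)
    (hc : ∀ x ∈ T, c ≤ f x)
    (hrad : ∀ z, z - S.ι p ∈ vectorSpan ℝ (convexHull ℝ (S.ι '' T)) → ‖z - S.ι p‖ ≤ r →
      z ∈ convexHull ℝ (S.ι '' T)) :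
    ∀ y ∈ T, f y ≤ f p + (f p - c) / r * ‖S.ι y - S.ι p‖ := by
  intro y hy
  -- Points from different polyhedra may be combined only along a common face containing `p`.
  obtain ⟨τ, hpτ, hτ⟩ := P.exists_common_face p
  have hyT := hy
  rw [hT] at hyT
  obtain ⟨σ, hpσ, hyσ⟩ := hyT
  have hpT : p ∈ T := by rw [hT]; exact ⟨σ, hpσ, hpσ⟩
  rcases eq_or_ne (S.ι y) (S.ι p) with h | h
  · rw [(hP.2 σ).2 hyσ hpσ h]; simp
  set d := ‖S.ι y - S.ι p‖ with hd
  have hd0 : 0 < d := norm_pos_iff.2 (sub_ne_zero.2 h)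
  -- The point opposite to `y` at distance `r`; with it, `ι p` has weights `r / (r + d)` on `ι y`
  -- and `d / (r + d)` on this point.
  have hz := hrad (S.ι p - (r / d) • (S.ι y - S.ι p)) (by
      rw [sub_sub_cancel_left]
      exact neg_mem (Submodule.smul_mem _ _ (vsub_mem_vectorSpan ℝ
        (subset_convexHull ℝ _ ⟨y, hy, rfl⟩) (subset_convexHull ℝ _ ⟨p, hpT, rfl⟩)))) (by
      rw [sub_sub_cancel_left, norm_neg, norm_smul, ← hd, Real.norm_of_nonneg (by positivity),
        div_mul_cancel₀ _ hd0.ne'])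
  obtain ⟨κ, _, w, z, hw, hw1, hzT, hwz⟩ := mem_convexHull_iff_exists_fintype.1 hz
  choose x hx hxz using hzT
  have hmem : ∀ u ∈ T, ∃ σ : P.cells, P.IsFace τ σ ∧ (σ : Set X) ⊆ U ∧ u ∈ (σ : Set X) := by
    intro u hu
    rw [hT] at hu
    obtain ⟨σ, hσ, huσ⟩ := hu
    exact ⟨σ, hτ σ hσ, hU σ hσ, huσ⟩
  have hrd : r + d ≠ 0 := by positivity
  have := hf.sum_le hP (hU σ hpσ hpσ) hpτ (κ := Option κ) (y := fun o => o.elim y x)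
    (ν := fun o => o.elim (r / (r + d)) fun i => d / (r + d) * w i)
    (fun o => by cases o; exacts [hmem y hy, hmem _ (hx _)])
    (fun o => by
      cases o
      · change 0 ≤ r / (r + d)
        positivity
      · exact mul_nonneg (by positivity) (hw _))
    (by
      rw [Fintype.sum_option]
      simp only [Option.elim]
      rw [← Finset.mul_sum, hw1, mul_one, ← add_div, div_self hrd])
    (by
      rw [Fintype.sum_option]
      simp only [Option.elim, mul_smul]
      rw [← Finset.smul_sum]
      simp only [hxz]
      rw [hwz, smul_sub, smul_smul, show d / (r + d) * (r / d) = r / (r + d) by field_simp, smul_sub]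
      have : S.ι p = (r / (r + d)) • S.ι p + (d / (r + d)) • S.ι p := by
        rw [← add_smul, ← add_div, div_self hrd, one_smul]
      nth_rewrite 3 [this]
      abel)
  rw [Fintype.sum_option] at this
  simp only [Option.elim, mul_assoc] at this
  rw [← Finset.mul_sum] at this
  have hlow : c ≤ ∑ i, w i * f (x i) := by
    calc c = ∑ i, w i * c := by rw [← Finset.sum_mul, hw1, one_mul]
      _ ≤ _ := Finset.sum_le_sum fun i _ => mul_le_mul_of_nonneg_left (hc _ (hx i)) (hw i)
  have h1 : r / (r + d) * f y + d / (r + d) * c ≤ f p :=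
    le_trans (by gcongr) this
  have h2 : r * f y + d * c ≤ (r + d) * f p := by
    have := mul_le_mul_of_nonneg_left h1 (show 0 ≤ r + d by positivity)
    rwa [mul_add, ← mul_assoc, ← mul_assoc, mul_div_cancel₀ _ hrd, mul_div_cancel₀ _ hrd] at this
  have h3 : f y ≤ ((r + d) * f p - d * c) / r := by
    rw [le_div_iff₀ hr]; linarith
  refine h3.trans_eq ?_
  field_simp
  ring

/-- Every point of an open set has a star in this set, for a suitable subdivision, that is bounded
and contains small copies of the given polyhedra. -/
theorem IsComplex.exists_small_star {S : QuasiEmbeddedPolyhedralSpace X N}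
    {P : PolyhedralStructure X} (hP : S.IsComplex P) {U : Set X} (hU : IsOpen U) {p : X}
    (hp : p ∈ U) : ∃ P' : PolyhedralStructure X, S.IsComplex P' ∧
      (∀ t : P'.cells, p ∈ (t : Set X) → (t : Set X) ⊆ U ∧
        Bornology.IsBounded (S.ι '' (t : Set X)) ∧ ∃ σ : P.cells, (t : Set X) ⊆ σ) ∧
      ∀ σ : P.cells, p ∈ (σ : Set X) → ∃ t : P'.cells, p ∈ (t : Set X) ∧
        ∀ x ∈ (σ : Set X), ∃ s : ℝ, 0 < s ∧ ∃ y ∈ (t : Set X),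
          S.ι y = S.ι p + s • (S.ι x - S.ι p) := by
  have : Finite {σ : P.cells // p ∈ (σ : Set X)} := (P.locallyFinite.point_finite p).to_subtype
  -- `ι` need not be injective on the star, so neighbourhoods in `N` control `U` on one polyhedron
  -- at a time; finitely many contain `p`.
  have hev : ∀ᶠ z in nhds (S.ι p), ∀ σ : {σ : P.cells // p ∈ (σ : Set X)},
      ∀ y ∈ (σ.1 : Set X), S.ι y = z → y ∈ U := by
    refine Filter.eventually_all.2 fun σ => ?_
    have h1 : (Subtype.val ⁻¹' U : Set (σ.1 : Set X)) ∈ nhds ⟨p, σ.2⟩ :=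
      (hU.preimage continuous_subtype_val).mem_nhds hp
    rw [(hP.isInducing σ.1).nhds_eq_comap] at h1
    obtain ⟨s, hs, hsub⟩ := h1
    filter_upwards [hs] with z hz y hy hyz
    exact @hsub ⟨y, hy⟩ (by
      change S.ι y ∈ s
      rwa [hyz])
  obtain ⟨δ, hδ, hball⟩ := Metric.eventually_nhds_iff.1 hev
  obtain ⟨l, hl, hlδ⟩ := exists_list_affine_neg (S.ι p) hδ
  obtain ⟨P', hP', hcells⟩ := hP.exists_subdivision p l hl
  have hpl : ∀ a ∈ l, a (S.ι p) ≤ 0 := fun a ha => (hl a ha).le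
  refine ⟨P', hP', fun t ht => ?_, fun σ hσ => ?_⟩
  · obtain ⟨σ, hσ, htσ⟩ := (hcells t ht).1 t.2
    have hpσ : p ∈ σ := by
      have : p ∈ (t : Set X) := ht
      rw [htσ] at this
      exact this.1
    have hδt : ∀ x ∈ (t : Set X), x ∈ σ ∧ ‖S.ι x - S.ι p‖ < δ := by
      intro x hx
      rw [htσ] at hx
      exact ⟨hx.1, hlδ _ hx.2⟩
    refine ⟨fun x hx => ?_, ?_, ⟨σ, hσ⟩, fun x hx => (hδt x hx).1⟩
    · exact hball (by rw [dist_eq_norm]; exact (hδt x hx).2) ⟨⟨σ, hσ⟩, hpσ⟩ x (hδt x hx).1 rfl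
    · refine (Metric.isBounded_ball (x := S.ι p) (r := δ)).subset ?_
      rintro _ ⟨x, hx, rfl⟩
      rw [Metric.mem_ball, dist_eq_norm]
      exact (hδt x hx).2
  · refine ⟨⟨_, (hcells (σ ∩ {x | ∀ a ∈ l, a (S.ι x) ≤ 0}) ⟨hσ, hpl⟩).2 ⟨σ, σ.2, rfl⟩⟩,
      ⟨hσ, hpl⟩, fun x hx => ?_⟩
    have hconv := (hP.isConvexPolyhedron_image σ).convex
    have hev : ∀ᶠ s in nhds (0 : ℝ), ∀ a ∈ {a | a ∈ l},
        a (S.ι p + s • (S.ι x - S.ι p)) < 0 := by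
      refine (Filter.eventually_all_finite l.finite_toSet).2 fun a ha => ?_
      have hcont : Continuous fun s : ℝ => a (S.ι p + s • (S.ι x - S.ι p)) :=
        a.continuous_of_finiteDimensional.comp (by fun_prop)
      exact hcont.continuousAt.eventually_lt continuousAt_const (by simpa using hl a ha)
    obtain ⟨η, hη, hs⟩ := Metric.eventually_nhds_iff.1 hev
    -- The bound `1` keeps the scaled point in the image of `σ`, and `η / 2` keeps the cutting
    -- inequalities strict.
    have hmin : 0 < min (η / 2) 1 := lt_min (by positivity) one_pos
    obtain ⟨y, hy, hys⟩ := hconv.add_smul_sub_mem (Set.mem_image_of_mem S.ι hσ)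
      (Set.mem_image_of_mem S.ι hx) ⟨hmin.le, min_le_right (η / 2) 1⟩
    refine ⟨_, hmin, y, ⟨hy, fun a ha => ?_⟩, hys⟩
    rw [hys]
    refine (hs ?_ a ha).le
    rw [dist_zero_right, Real.norm_of_nonneg hmin.le]
    exact (min_le_left _ _).trans_lt (by linarith)

end QuasiEmbeddedPolyhedralSpace

theorem corollary5p3 {X N : Type*} [TopologicalSpace X] [SecondCountableTopology X]
    [NormedAddCommGroup N] [InnerProductSpace ℝ N] [FiniteDimensional ℝ N]
    (S : QuasiEmbeddedPolyhedralSpace X N) (hS : S.IsLocallyBalanceable)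
    (U : Set X) (hU : IsOpen U) (f : X → ℝ) (hf : S.IsConcaveOn U f) :
    ContinuousOn f U := by
  intro p hp
  refine ContinuousAt.continuousWithinAt ?_
  obtain ⟨n, hn, 𝒰, h𝒰, hcov⟩ := hS
  obtain ⟨V, hV, hpV⟩ := Set.mem_sUnion.1 (hcov ▸ Set.mem_univ p)
  obtain ⟨P₀, hP₀, hmin⟩ := (h𝒰 V hV).2.exists_eq_of_isMin hn hpV
  obtain ⟨P, hP, hstar, hcopy⟩ := hP₀.exists_small_star hU hp
  have hfin : Finite {σ : P.cells // p ∈ (σ : Set X)} :=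
    (P.locallyFinite.point_finite p).to_subtype
  obtain ⟨T, hT⟩ : ∃ T, T = {x | ∃ σ : P.cells, p ∈ (σ : Set X) ∧ x ∈ (σ : Set X)} := ⟨_, rfl⟩
  have hTmem : ∀ x, x ∈ T ↔ ∃ σ : P.cells, p ∈ (σ : Set X) ∧ x ∈ (σ : Set X) := fun x => by
    rw [hT]; rfl
  obtain ⟨τ, hpτ, -⟩ := P.exists_common_face p
  have hpT : S.ι p ∈ convexHull ℝ (S.ι '' T) :=
    subset_convexHull ℝ _ ⟨p, (hTmem p).2 ⟨τ, hpτ, hpτ⟩, rfl⟩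
  obtain ⟨r, hr, hrad⟩ := exists_radius_of_forall_isMin (convex_convexHull ℝ (S.ι '' T)) hpT (by
    intro l hl
    -- Balancing concerns `P₀`, not its subdivision. A minimum on the small star is one on the star
    -- in `P₀`, whose points scale into the small star; constancy then descends, because each small
    -- polyhedron lies in one of `P₀`.
    have h1 := hmin l (by
      intro σ hσ x hx
      obtain ⟨t, ht, htσ⟩ := hcopy σ hσ
      obtain ⟨s, hs, y, hy, hys⟩ := htσ x hx
      have := hl _ (subset_convexHull ℝ _ ⟨y, (hTmem y).2 ⟨t, ht, hy⟩, rfl⟩)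
      rw [hys, map_add, map_smul, smul_eq_mul, le_add_iff_nonneg_right, map_sub] at this
      exact sub_nonneg.1 (nonneg_of_mul_nonneg_right this hs))
    refine convexHull_min (t := {x | l x = l (S.ι p)}) ?_ (convex_hyperplane l.isLinear _)
    rintro _ ⟨x, hx, rfl⟩
    obtain ⟨t, ht, hxt⟩ := (hTmem x).1 hx
    obtain ⟨-, -, σ, htσ⟩ := hstar t ht
    exact h1 σ (htσ ht) x (htσ hxt))
  -- bounds on the star
  have hlow : ∀ σ : {σ : P.cells // p ∈ (σ : Set X)}, ∃ c, ∀ x ∈ (σ.1 : Set X), c ≤ f x :=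
    fun σ => hf.exists_lower_bound hP σ.1 (hstar σ.1 σ.2).1 (hstar σ.1 σ.2).2.1
  choose c hc using hlow
  obtain ⟨c₀, hc₀⟩ := (Set.finite_range c).bddBelow
  have hup := hf.upper_lipschitz hP (fun σ hσ => (hstar σ hσ).1) hT hr (c := c₀) (by
    intro x hx
    obtain ⟨σ, hσ, hxσ⟩ := (hTmem x).1 hx
    exact (hc₀ ⟨⟨σ, hσ⟩, rfl⟩).trans (hc ⟨σ, hσ⟩ x hxσ)) hrad
  have hlip : ∀ σ : {σ : P.cells // p ∈ (σ : Set X)}, ∃ δ > 0, ∃ C, ∀ y ∈ (σ.1 : Set X),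
      ‖S.ι y - S.ι p‖ ≤ δ → f p - C * ‖S.ι y - S.ι p‖ ≤ f y := fun σ =>
    hf.exists_lower_lipschitz hP σ.1 (hstar σ.1 σ.2).1 (hstar σ.1 σ.2).2.1 σ.2
  choose δ hδ C hC using hlip
  have hcont : Filter.Tendsto (fun y => ‖S.ι y - S.ι p‖) (nhds p) (nhds 0) := by
    have := (hP.continuous.sub (continuous_const (y := S.ι p))).norm.tendsto p
    simpa using this
  rw [ContinuousAt, tendsto_order]
  constructor
  · intro e he
    have hev : ∀ᶠ y in nhds p, ∀ σ : {σ : P.cells // p ∈ (σ : Set X)},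
        ‖S.ι y - S.ι p‖ < δ σ ∧ e < f p - C σ * ‖S.ι y - S.ι p‖ := by
      refine Filter.eventually_all.2 fun σ => (hcont.eventually_lt_const (hδ σ)).and ?_
      have := (hcont.const_mul (C σ)).const_sub (f p)
      rw [mul_zero, sub_zero] at this
      exact this.eventually_const_lt he
    filter_upwards [hev, P.eventually_exists_mem_cell p] with y hy ⟨σ, hσ, hyσ⟩
    exact (hy ⟨σ, hσ⟩).2.trans_le (hC ⟨σ, hσ⟩ y hyσ (hy ⟨σ, hσ⟩).1.le)
  · intro e he
    have := (hcont.const_mul ((f p - c₀) / r)).const_add (f p)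
    rw [mul_zero, add_zero] at this
    filter_upwards [this.eventually_lt_const he, P.eventually_exists_mem_cell p] with y hy hyσ
    exact (hup y ((hTmem y).2 hyσ)).trans_lt hy
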